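/- Let $G$ be a Lie group (for example a connected and simply connected one), $\Gamma\subset G$ a discrete subgroup such that the quotient manifold $M=\Gamma\backslash G$ (usually written $G/\Gamma$) is compact, and let $(J,g)$ be a Hermitian structure on $M$, that is, an integrable almost complex structure $J$ and a Riemannian metric $g$ with $g(J\cdot,J\cdot)=g$. Assume that the lifts of $J$ and $g$ to $G$ are left-invariant. For an affine connection $\nabla$ on $M$ put $R(x,y,z,w)=g(\nabla_x\nabla_yz-\nabla_y\nabla_xz-\nabla_{[x,y]}z,\,w)$, extended complex-multilinearly; say that its holomorphic sectional curvature is the constant $c\in\mathbb{R}$ if $R(X,\overline X,X,\overline X)=c\,|X|^4$ for every tangent vector $X$ of type $(1,0)$, where $|X|^2=g(X,\overline X)$, and that $g$ is flat with respect to $\nabla$ if $R=0$. Suppose that the Lie algebra $\mathfrak g$ of $G$ has an abelian ideal $\mathfrak a$ which is either (i) of codimension $1$, or (ii) of codimension $2$ with $J\mathfrak a=\mathfrak a$. (a) If the holomorphic sectional curvature of the Chern connection (the unique connection with $\nabla g=0$ and $\nabla J=0$ whose torsion has no $(1,1)$-component) is a constant $c$, then $c=0$ and $g$ is Chern flat.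 (b) If the holomorphic sectional curvature of the Levi-Civita connection is a constant $c$, then $c=0$ and $g$ is Levi-Civita flat and Kähler (the form $\omega=g(J\cdot,\cdot)$ is closed). -/

import Mathlib

open Bundle VectorField
open scoped Manifold ContDiff

noncomputable section

/-! ### Lie groups: the Lie algebra of a smooth real Lie group -/

/-- A smooth real Lie group has the regularity which Mathlib asks for in order to equip its tangent
space at the identity with the structure of a Lie algebra. -/
instance LieGroup.minSmoothness_three_of_infty {E : Type*} [NormedAddCommGroup E] [NormedSpace ℝ E]
    {G : Type*} [Group G] [TopologicalSpace G] [ChartedSpace E G] [LieGroup 𝓘(ℝ, E) ∞ G] :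
    LieGroup 𝓘(ℝ, E) (minSmoothness ℝ 3) G := by
  rw [minSmoothness_of_isRCLikeNormedField]
  infer_instance

namespace HermGeom

variable {E : Type*} [NormedAddCommGroup E] [NormedSpace ℝ E]
variable {M : Type*} [TopologicalSpace M] [ChartedSpace E M]

/-! ### Vector fields -/

variable (E M) in
/-- (Not necessarily continuous) vector fields on `M`. -/
abbrev VField : Type _ := Π x : M, TangentSpace 𝓘(ℝ, E) x

/-- Smooth vector fields. -/
def SmoothVF [IsManifold 𝓘(ℝ, E) 1 M] (X : VField E M) : Prop :=
  ContMDiff 𝓘(ℝ, E) 𝓘(ℝ, E).tangent ∞ (fun x ↦ (⟨x, X x⟩ : TangentBundle 𝓘(ℝ, E) M))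

/-! ### Hermitian manifolds -/

variable (E M) in
/-- A Hermitian structure on the smooth manifold `M`: an integrable almost complex structure `J`
and a smooth Riemannian metric `g` for which `J` is an isometry. -/
structure HermitianStructure [IsManifold 𝓘(ℝ, E) 1 M] where
  /-- the Riemannian metric -/
  g : ContMDiffRiemannianMetric 𝓘(ℝ, E) ∞ E (fun x : M ↦ TangentSpace 𝓘(ℝ, E) x)
  /-- the complex structure -/
  J : Π x : M, TangentSpace 𝓘(ℝ, E) x →L[ℝ] TangentSpace 𝓘(ℝ, E) x
  J_smooth : ContMDiff 𝓘(ℝ, E) (𝓘(ℝ, E).prod 𝓘(ℝ, E →L[ℝ] E)) ∞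
    (fun x ↦ TotalSpace.mk' (E →L[ℝ] E)
      (E := fun x : M ↦ TangentSpace 𝓘(ℝ, E) x →L[ℝ] TangentSpace 𝓘(ℝ, E) x) x (J x))
  J_sq : ∀ (x : M) (v : TangentSpace 𝓘(ℝ, E) x), J x (J x v) = -v
  compatible : ∀ (x : M) (v w : TangentSpace 𝓘(ℝ, E) x),
    g.inner x (J x v) (J x w) = g.inner x v w
  /-- the Nijenhuis tensor vanishes: `[X, Y] - [JX, JY] + J [JX, Y] + J [X, JY] = 0` -/
  integrable : ∀ X Y : VField E M, SmoothVF X → SmoothVF Y → ∀ x : M,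
    mlieBracket 𝓘(ℝ, E) X Y x
      - mlieBracket 𝓘(ℝ, E) (fun y ↦ J y (X y)) (fun y ↦ J y (Y y)) x
      + J x (mlieBracket 𝓘(ℝ, E) (fun y ↦ J y (X y)) Y x)
      + J x (mlieBracket 𝓘(ℝ, E) X (fun y ↦ J y (Y y)) x) = 0

variable (E M) in
/-- Affine connections on `M`. For `D : Connection E M`, the vector `∇_v Y` with `v` tangent to `M`
at `x` is `D Y x v`. -/
abbrev Connection [IsManifold 𝓘(ℝ, E) 1 M] : Type _ :=
  CovariantDerivative 𝓘(ℝ, E) E (fun x : M ↦ TangentSpace 𝓘(ℝ, E) x)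

/-- The curvature `R(X, Y) Z = ∇_X ∇_Y Z - ∇_Y ∇_X Z - ∇_[X, Y] Z`. -/
def curvature [IsManifold 𝓘(ℝ, E) 1 M] (D : Connection E M) (X Y Z : VField E M) : VField E M :=
  fun x ↦ D (fun y ↦ D Z y (Y y)) x (X x) - D (fun y ↦ D Z y (X y)) x (Y x)
    - D Z x (mlieBracket 𝓘(ℝ, E) X Y x)

/-- A connection is flat if its whole curvature tensor vanishes. -/
def IsFlat [IsManifold 𝓘(ℝ, E) 1 M] (D : Connection E M) : Prop :=
  ∀ X Y Z : VField E M, SmoothVF X → SmoothVF Y → SmoothVF Z → ∀ x : M, curvature D X Y Z x = 0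

/-- The `ℂ`-linear extension to the complexification `V ⊕ i V` of an additive complex-valued
function on a real vector space `V`; the vector `u + i v` is written as the pair `(u, v)`. -/
def complexExt {V : Type*} (f : V → ℂ) (w : V × V) : ℂ := f w.1 + Complex.I * f w.2

namespace HermitianStructure

variable [IsManifold 𝓘(ℝ, E) 1 M] (h : HermitianStructure E M)

/-- The vector field `JX`. -/
def JV (X : VField E M) : VField E M := fun x ↦ h.J x (X x)

/-- `∇ g = 0`, that is, `v (g(Y, Z)) = g(∇_v Y, Z) + g(Y, ∇_v Z)`. -/
def IsMetric (D : Connection E M) : Prop :=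
  ∀ Y Z : VField E M, SmoothVF Y → SmoothVF Z → ∀ (x : M) (v : TangentSpace 𝓘(ℝ, E) x),
    mvfderiv 𝓘(ℝ, E) (fun y ↦ h.g.inner y (Y y) (Z y)) x v
      = h.g.inner x (D Y x v) (Z x) + h.g.inner x (Y x) (D Z x v)

/-- `∇ J = 0`, that is, `∇_v (JY) = J ∇_v Y`. -/
def IsComplex (D : Connection E M) : Prop :=
  ∀ Y : VField E M, SmoothVF Y → ∀ (x : M) (v : TangentSpace 𝓘(ℝ, E) x),
    D (h.JV Y) x v = h.J x (D Y x v)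

/-- The Levi-Civita connection: the torsion-free metric connection. -/
def IsLeviCivita [FiniteDimensional ℝ E] [IsManifold 𝓘(ℝ, E) 2 M] (D : Connection E M) : Prop :=
  h.IsMetric D ∧ D.torsion = 0

/-- The Chern connection: the connection with `∇ g = 0` and `∇ J = 0` whose torsion `T` has no
component of type `(1, 1)`. Since `T(v - iJv, w + iJw)` equals
`T(v, w) + T(Jv, Jw) + i (T(v, Jw) - T(Jv, w))`, the latter means `T(Jv, w) = T(v, Jw)`
for all real `v` and `w`. -/
def IsChern [FiniteDimensional ℝ E] [IsManifold 𝓘(ℝ, E) 2 M] (D : Connection E M) : Prop :=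
  h.IsMetric D ∧ h.IsComplex D ∧
    ∀ (x : M) (v w : TangentSpace 𝓘(ℝ, E) x), D.torsion x (h.J x v) w = D.torsion x v (h.J x w)

/-- The `ℂ`-bilinear extension of the metric. -/
def metricC (X Y : VField E M × VField E M) (x : M) : ℂ :=
  complexExt (fun X ↦ complexExt (fun Y ↦ (h.g.inner x (X x) (Y x) : ℂ)) Y) X

/-- The `ℂ`-multilinear extension of `R(X, Y, Z, W) = g(R(X, Y) Z, W)`. -/
def curvatureC (D : Connection E M) (X Y Z W : VField E M × VField E M) (x : M) : ℂ :=
  complexExt (fun X ↦ complexExt (fun Y ↦ complexExt (fun Z ↦ complexExt (fun W ↦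
    (h.g.inner x (curvature D X Y Z x) (W x) : ℂ)) W) Z) Y) X

/-- The field `X - i JX` of type `(1, 0)`. -/
def type10 (X : VField E M) : VField E M × VField E M := (X, -h.JV X)

/-- The field `X + i JX` of type `(0, 1)`, the conjugate of `X - i JX`. -/
def type01 (X : VField E M) : VField E M × VField E M := (X, h.JV X)

/-- The holomorphic sectional curvature of the connection is the constant `c`:
one has `R(ξ, ξ̄, ξ, ξ̄) = c |ξ|⁴` for all `ξ = X - i JX`, where `|ξ|² = g(ξ, ξ̄)`. -/
def HasConstHSC (D : Connection E M) (c : ℝ) : Prop :=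
  ∀ X : VField E M, SmoothVF X → ∀ x : M,
    h.curvatureC D (h.type10 X) (h.type01 X) (h.type10 X) (h.type01 X) x
      = (c : ℂ) * h.metricC (h.type10 X) (h.type01 X) x ^ 2

/-- The fundamental form `ω(X, Y) = g(JX, Y)`. -/
def omega (X Y : VField E M) : M → ℝ := fun x ↦ h.g.inner x (h.J x (X x)) (Y x)

/-- The metric is Kähler: `dω = 0`, with `dω` written through the invariant formula for the
exterior derivative. -/
def IsKahler : Prop :=
  ∀ X Y Z : VField E M, SmoothVF X → SmoothVF Y → SmoothVF Z → ∀ x : M,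
    mvfderiv 𝓘(ℝ, E) (h.omega Y Z) x (X x) - mvfderiv 𝓘(ℝ, E) (h.omega X Z) x (Y x)
      + mvfderiv 𝓘(ℝ, E) (h.omega X Y) x (Z x)
      - h.omega (mlieBracket 𝓘(ℝ, E) X Y) Z x + h.omega (mlieBracket 𝓘(ℝ, E) X Z) Y x
      - h.omega (mlieBracket 𝓘(ℝ, E) Y Z) X x = 0

/-- A Hermitian structure on a Lie group is left-invariant if the left translations preserve
both `J` and `g`. -/
def IsLeftInvariant {G : Type*} [Group G] [TopologicalSpace G] [ChartedSpace E G]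
    [IsManifold 𝓘(ℝ, E) 1 G] (h : HermitianStructure E G) : Prop :=
  ∀ (a x : G) (v w : TangentSpace 𝓘(ℝ, E) x),
    mfderiv 𝓘(ℝ, E) 𝓘(ℝ, E) (fun y : G ↦ a * y) x (h.J x v)
        = h.J (a * x) (mfderiv 𝓘(ℝ, E) 𝓘(ℝ, E) (fun y : G ↦ a * y) x v) ∧
      h.g.inner (a * x) (mfderiv 𝓘(ℝ, E) 𝓘(ℝ, E) (fun y : G ↦ a * y) x v)
        (mfderiv 𝓘(ℝ, E) 𝓘(ℝ, E) (fun y : G ↦ a * y) x w) = h.g.inner x v w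

/-- `hN` is the lift of `h` along the map `p : N → M`: the map `p` is holomorphic and
isometric for the two Hermitian structures. -/
def IsLift {N : Type*} [TopologicalSpace N] [ChartedSpace E N] [IsManifold 𝓘(ℝ, E) 1 N]
    (hN : HermitianStructure E N) (h : HermitianStructure E M) (p : N → M) : Prop :=
  ∀ (x : N) (v w : TangentSpace 𝓘(ℝ, E) x),
    mfderiv 𝓘(ℝ, E) 𝓘(ℝ, E) p x (hN.J x v) = h.J (p x) (mfderiv 𝓘(ℝ, E) 𝓘(ℝ, E) p x v) ∧
      h.g.inner (p x) (mfderiv 𝓘(ℝ, E) 𝓘(ℝ, E) p x v) (mfderiv 𝓘(ℝ, E) 𝓘(ℝ, E) p x w)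
        = hN.g.inner x v w

end HermitianStructure

/-- The map `p : G → M` exhibits `M` as the quotient manifold of the Lie group `G` by the discrete
subgroup `Γ`, acting on `G` by left translations (so that left-invariant tensors descend): `p` is a
surjective local diffeomorphism whose fibres are the `Γ`-orbits. -/
structure IsQuotientBy {G : Type*} [Group G] [TopologicalSpace G] [ChartedSpace E G]
    (Γ : Subgroup G) (p : G → M) : Prop where
  discrete : DiscreteTopology Γ
  localDiffeo : IsLocalDiffeomorph 𝓘(ℝ, E) 𝓘(ℝ, E) ∞ p
  surjective : Function.Surjective p
  fibre : ∀ x y : G, p x = p y ↔ ∃ γ ∈ Γ, y = γ * x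

end HermGeom

end

/-!
The left-invariant vector fields of `G` descend to the quotient `M`, where they form a global frame
in which the metric, the complex structure and the Lie brackets have constant coefficients
(`HermGeom.IsQuotientBy.exists_frame`). The Levi-Civita and the Chern connection are determined by
these data, so they have constant coefficients too, and curvature, torsion and holomorphic sectional
curvature are computed in the Lie algebra `𝔤` with its scalar product and its complex structure.
What remains is linear algebra, with one more input: `𝔤` is unimodular
(`trace_ad_eq_zero_of_compact_quotient`). Indeed a fundamental domain for the discrete subgroup has
finite positive Haar measure, and so do its right translates, hence Haar measure is bi-invariant;
and integrating by parts along left-invariant and right-invariant fields turns this into `tr ad = 0`.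

An abelian ideal `𝔟` of codimension one may be replaced by `𝔟 ⊓ J 𝔟`, which is again an ideal by the
integrability of `J`. So there is always a `J`-stable abelian ideal `𝔞` of codimension two
(`HermitianLieAlgebra.exists_adaptedIdeal`). Let `x` be a unit normal vector, `y = J x`, let
`[x, y] = α x + β y + w` with `w` in `𝔞`, and let `A_x`, `A_y` be the actions on `𝔞`. Unimodularity
says `tr A_x = -β` and `tr A_y = α`, the Jacobi identity says `[A_x, A_y] = α A_x + β A_y`, and
integrability says `A_x + J A_x J = A_y J - J A_y`.

*Levi-Civita* (`leviCivita_rigidity`). Let `S` and `K` be the symmetric and skew parts of the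
actions. The holomorphic sectional curvature of `x` gives `c = -(α² + β²) - 3/4 |w|²`. Its values on
`𝔞` are a quartic form in `S_x` and `S_y`, and polarising it between `x` and `u` in `𝔞` gives a
quadratic form in `u`. Averaging both over an orthonormal basis gives two trace identities. Together
with the integrability condition, which expresses `2 tr (S_x S_y J)` by the parts of `S_x` or `S_y`
anticommuting with `J`, they contradict each other in sign if `dim 𝔞 ≥ 4`, unless `α`, `β` and `w`
vanish (`leviCivita_elimination`); the case `dim 𝔞 = 2` follows from the quartic form at one vector.
Then `c = 0` and `S = 0`, the skew parts commute with each other and with `J`, and the connection is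
flat and preserves `J`, that is, the metric is Kähler.

*Chern* (`AdaptedIdeal.chern_rigidity`). The curvature of `x` gives `c ≤ 0` and that of a vector of
`𝔞` gives `c ≥ 0`, so `c`, `α`, `β` and `w` vanish. The quartic form on `𝔞` says that the component
`σ = A_y + J A_y J` of the connection is skew, and the trace of the mixed curvature says that its
norm is zero. The remaining component `F` is then normal by the mixed curvature, and the curvature of the
connection, which is made of `J [F, Fᵗ]`, vanishes (`chern_vanishing`).
-/

/-! ### Traces of endomorphisms of a Euclidean space with a complex structure -/

section EuclideanTrace

open LinearMap (adjoint trace)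

variable {V : Type*} [NormedAddCommGroup V] [InnerProductSpace ℝ V] [FiniteDimensional ℝ V]

lemma LinearMap.trace_adjoint_real (T : Module.End ℝ V) :
    trace ℝ V (adjoint T) = trace ℝ V T := by
  rw [LinearMap.trace_eq_sum_inner _ (stdOrthonormalBasis ℝ V),
    LinearMap.trace_eq_sum_inner _ (stdOrthonormalBasis ℝ V)]
  refine Finset.sum_congr rfl fun i _ ↦ ?_
  rw [LinearMap.adjoint_inner_right, real_inner_comm]

lemma LinearMap.adjoint_mul (S T : Module.End ℝ V) : adjoint (S * T) = adjoint T * adjoint S :=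
  LinearMap.adjoint_comp S T

lemma LinearMap.trace_adjoint_mul_self (T : Module.End ℝ V) :
    trace ℝ V (adjoint T * T) = ∑ i, ‖T (stdOrthonormalBasis ℝ V i)‖ ^ 2 := by
  rw [LinearMap.trace_eq_sum_inner _ (stdOrthonormalBasis ℝ V)]
  refine Finset.sum_congr rfl fun i _ ↦ ?_
  rw [Module.End.mul_apply, LinearMap.adjoint_inner_right, real_inner_self_eq_norm_sq]

lemma LinearMap.trace_adjoint_mul_self_nonneg (T : Module.End ℝ V) :
    0 ≤ trace ℝ V (adjoint T * T) := by
  rw [LinearMap.trace_adjoint_mul_self]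
  positivity

lemma LinearMap.eq_zero_of_trace_adjoint_mul_self {T : Module.End ℝ V}
    (h : trace ℝ V (adjoint T * T) = 0) : T = 0 := by
  rw [LinearMap.trace_adjoint_mul_self, Finset.sum_eq_zero_iff_of_nonneg (by intros; positivity)] at h
  refine (stdOrthonormalBasis ℝ V).toBasis.ext fun i ↦ ?_
  have := h i (Finset.mem_univ i)
  simpa using this

omit [FiniteDimensional ℝ V] in
/-- An endomorphism anticommuting with a complex structure has trace zero. -/
lemma LinearMap.trace_eq_zero_of_anticomm {J T : Module.End ℝ V} (hJ : J * J = -1)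
    (h : T * J = -(J * T)) : trace ℝ V T = 0 := by
  have h1 : trace ℝ V (J * T * J) = trace ℝ V (J * J * T) := by
    rw [LinearMap.trace_mul_comm, mul_assoc]
  have h2 : J * T * J = T := by rw [mul_assoc, h, mul_neg, ← mul_assoc, hJ]; simp
  rw [h2, hJ] at h1
  simp only [neg_mul, one_mul, map_neg] at h1
  linarith

/-- Parallelogram-type polarisation of a product of two quadratic forms, summed over pairs of
vectors of an orthonormal basis. -/
lemma sum_sum_inner_polarization (P R : Module.End ℝ V) (hP : adjoint P = P) :
    ∑ i, ∑ j, (inner ℝ (P (stdOrthonormalBasis ℝ V i)) (stdOrthonormalBasis ℝ V i) *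
        inner ℝ (R (stdOrthonormalBasis ℝ V j)) (stdOrthonormalBasis ℝ V j)
      + inner ℝ (P (stdOrthonormalBasis ℝ V j)) (stdOrthonormalBasis ℝ V j) *
        inner ℝ (R (stdOrthonormalBasis ℝ V i)) (stdOrthonormalBasis ℝ V i)
      + 4 * (inner ℝ (P (stdOrthonormalBasis ℝ V i)) (stdOrthonormalBasis ℝ V j) *
        inner ℝ (R (stdOrthonormalBasis ℝ V i)) (stdOrthonormalBasis ℝ V j)))
      = 2 * (trace ℝ V P * trace ℝ V R) + 4 * trace ℝ V (P * R) := by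
  have e : ∀ T : Module.End ℝ V, trace ℝ V T =
      ∑ i, inner ℝ (T (stdOrthonormalBasis ℝ V i)) (stdOrthonormalBasis ℝ V i) := fun T ↦ by
    rw [LinearMap.trace_eq_sum_inner _ (stdOrthonormalBasis ℝ V)]
    exact Finset.sum_congr rfl fun i _ ↦ real_inner_comm _ _
  have h1 : ∀ i, ∑ j, (inner ℝ (P (stdOrthonormalBasis ℝ V i)) (stdOrthonormalBasis ℝ V j) *
        inner ℝ (R (stdOrthonormalBasis ℝ V i)) (stdOrthonormalBasis ℝ V j)) =
      inner ℝ ((P * R) (stdOrthonormalBasis ℝ V i)) (stdOrthonormalBasis ℝ V i) := fun i ↦ by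
    have := (stdOrthonormalBasis ℝ V).sum_inner_mul_inner
      (P (stdOrthonormalBasis ℝ V i)) (R (stdOrthonormalBasis ℝ V i))
    rw [Module.End.mul_apply, ← LinearMap.adjoint_inner_right, hP, real_inner_comm, ← this]
    exact Finset.sum_congr rfl fun j _ ↦ by rw [real_inner_comm (R _)]
  rw [e P, e R, e (P * R), Finset.sum_mul_sum]
  simp only [Finset.sum_add_distrib, ← Finset.mul_sum, h1]
  rw [Finset.sum_comm (f := fun i j ↦ inner ℝ (P (stdOrthonormalBasis ℝ V j)) _ * _)]
  simp only [← Finset.mul_sum]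
  ring

lemma even_finrank_of_sq_eq_neg_one {J : Module.End ℝ V} (hJ : J * J = -1) :
    Even (Module.finrank ℝ V) := by
  by_contra h
  rw [Nat.not_even_iff_odd] at h
  have h1 := congrArg LinearMap.det hJ
  have h2 : LinearMap.det (-1 : Module.End ℝ V) = (-1) ^ Module.finrank ℝ V := by
    have := LinearMap.det_smul (-1 : ℝ) (1 : Module.End ℝ V)
    simpa using this
  rw [map_mul, h2, h.neg_one_pow] at h1
  nlinarith [mul_self_nonneg (LinearMap.det J)]

end EuclideanTrace

/-! ### Trace identities for symmetric and skew endomorphisms -/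

section EndomorphismIdentities

open LinearMap (adjoint trace)

variable {V : Type*} [NormedAddCommGroup V] [InnerProductSpace ℝ V] [FiniteDimensional ℝ V]

/-- For symmetric `S, T` and skew `J`, the trace of `S T J` is skew in `S, T`. -/
lemma trace_symm_symm_skew {S T J : Module.End ℝ V} (hS : adjoint S = S) (hT : adjoint T = T)
    (hJ : adjoint J = -J) : trace ℝ V (T * S * J) = -trace ℝ V (S * T * J) := by
  rw [← LinearMap.trace_adjoint_real (S * T * J)]
  simp only [LinearMap.adjoint_mul, hS, hT, hJ]
  rw [neg_mul, map_neg, neg_neg, LinearMap.trace_mul_comm]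

lemma trace_skew_skew_skew {S T J : Module.End ℝ V} (hS : adjoint S = -S) (hT : adjoint T = -T)
    (hJ : adjoint J = -J) : trace ℝ V (T * S * J) = -trace ℝ V (S * T * J) := by
  rw [← LinearMap.trace_adjoint_real (S * T * J)]
  simp only [LinearMap.adjoint_mul, hS, hT, hJ]
  simp only [neg_mul, mul_neg, map_neg, neg_neg]
  rw [LinearMap.trace_mul_comm]

lemma trace_symm_mul_skew {S K : Module.End ℝ V} (hS : adjoint S = S) (hK : adjoint K = -K) :
    trace ℝ V (S * K) = 0 := by
  have := LinearMap.trace_adjoint_real (S * K)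
  rw [LinearMap.adjoint_mul, hS, hK, neg_mul, map_neg, LinearMap.trace_mul_comm] at this
  linarith

/-- The trace of `S K J` is symmetric under exchanging `S` and `K`, for symmetric `S`
and skew `K, J`. -/
lemma trace_symm_skew_skew {S K J : Module.End ℝ V} (hS : adjoint S = S) (hK : adjoint K = -K)
    (hJ : adjoint J = -J) : trace ℝ V (S * K * J) = trace ℝ V (K * S * J) := by
  rw [← LinearMap.trace_adjoint_real (S * K * J)]
  simp only [LinearMap.adjoint_mul, hS, hK, hJ]
  simp only [neg_mul, mul_neg, neg_neg]
  rw [LinearMap.trace_mul_comm]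

omit [FiniteDimensional ℝ V] in
/-- The relation `S + J S J = T J - J T` (the integrability of the complex structure) computes
`2 tr (S T J)` as `tr (S²) + tr (S J S J)`, which is up to the factor `2` the squared norm (with a
sign, if `S` is skew) of the part `S + J S J` of `S` anticommuting with `J`. -/
lemma two_mul_trace_mul_mul {S T J : Module.End ℝ V}
    (hskew : trace ℝ V (T * S * J) = -trace ℝ V (S * T * J))
    (h : S + J * S * J = T * J - J * T) :
    2 * trace ℝ V (S * T * J) = trace ℝ V (S * S) + trace ℝ V (S * J * S * J) := by
  have h1 := congrArg (fun X ↦ trace ℝ V (S * X)) h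
  simp only [mul_add, mul_sub, map_add, map_sub] at h1
  have h2 : trace ℝ V (S * (J * T)) = trace ℝ V (T * S * J) := by
    rw [← mul_assoc, LinearMap.trace_mul_comm, ← mul_assoc]
  simp only [← mul_assoc] at h1 h2
  linarith

omit [FiniteDimensional ℝ V] in
lemma integrability_swap {S T J : Module.End ℝ V} (hJ : J * J = -1)
    (h : S + J * S * J = T * J - J * T) : T + J * T * J = J * S - S * J := by
  have h1 := congrArg (fun X ↦ X * J) h
  have h2 : J * S * J * J = -(J * S) := by rw [mul_assoc, hJ]; simp
  have h3 : T * J * J = -T := by rw [mul_assoc, hJ]; simp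
  simp only [add_mul, sub_mul, h2, h3] at h1
  rw [← sub_eq_zero] at h1 ⊢
  rw [← h1]
  abel

/-- For skew `K`, the hypothesis says that the part `K + J K J` of `K` anticommuting with `J` has
norm zero, so `K` commutes with `J`. -/
lemma commute_of_trace_eq_zero {K J : Module.End ℝ V} (hJ : J * J = -1) (hJs : adjoint J = -J)
    (hK : adjoint K = -K)
    (h : trace ℝ V (K * K) + trace ℝ V (K * J * K * J) = 0) : K * J = J * K := by
  have h0 : K + J * K * J = 0 := by
    apply LinearMap.eq_zero_of_trace_adjoint_mul_self
    have h1 : adjoint (K + J * K * J) = -(K + J * K * J) := by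
      simp only [map_add, LinearMap.adjoint_mul, hJs, hK]
      simp only [neg_mul, mul_neg, neg_neg, mul_assoc]; abel
    have h2 : J * K * J * (J * K * J) = - (J * (K * K * J)) := by
      calc _ = J * K * (J * J) * K * J := by simp only [mul_assoc]
        _ = _ := by rw [hJ]; simp [mul_assoc]
    have h3 : trace ℝ V (J * (K * K * J)) = - trace ℝ V (K * K) := by
      rw [LinearMap.trace_mul_comm, mul_assoc, hJ]; simp
    have h4 : trace ℝ V (J * K * J * K) = trace ℝ V (K * J * K * J) := by
      rw [mul_assoc, mul_assoc, LinearMap.trace_mul_comm]; simp only [mul_assoc]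
    rw [h1, neg_mul, map_neg, neg_eq_zero, add_mul, mul_add, mul_add, h2]
    simp only [map_add, map_neg, h3]
    simp only [← mul_assoc, h4]
    linarith
  have h5 := congrArg (fun X ↦ J * X) h0
  have h6 : J * (J * K * J) = -(K * J) := by
    rw [← mul_assoc, ← mul_assoc, hJ]; simp
  simp only [mul_add, h6, mul_zero] at h5
  exact (add_neg_eq_zero.mp h5).symm

end EndomorphismIdentities

/-! ### Trace inequalities for the Levi-Civita connection -/

section LeviCivitaTrace

open LinearMap (adjoint trace)

variable {V : Type*} [NormedAddCommGroup V] [InnerProductSpace ℝ V] [FiniteDimensional ℝ V]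

/-- The trace identity obtained from the terms of the holomorphic sectional curvature which are
quadratic both along the ideal and transversally to it. The six summands of `hmix` are the six
curvatures of the polarisation `HermitianLieAlgebra.HasConstHSC.polarize`; the identity is the sum
of `hmix` over an orthonormal basis. -/
lemma leviCivita_trace_identity {J Sx Sy Kx Ky : Module.End ℝ V} (hJ : J * J = -1)
    (hJs : adjoint J = -J)
    (hSx : adjoint Sx = Sx) (hSy : adjoint Sy = Sy) (hKx : adjoint Kx = -Kx)
    (hKy : adjoint Ky = -Ky) {α β c : ℝ} (w : V)
    (hjac : (Sx + Kx) * (Sy + Ky) - (Sy + Ky) * (Sx + Kx) = α • (Sx + Kx) + β • (Sy + Ky))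
    (htx : trace ℝ V Sx = -β) (hty : trace ℝ V Sy = α)
    (hmix : ∀ u : V,
      (-inner ℝ (Ky (J u)) (Kx u) + inner ℝ (Kx (J u)) (Ky u) - α * inner ℝ (Kx (J u)) u
        - β * inner ℝ (Ky (J u)) u)
      + (-inner ℝ (Sy (J u)) (Sx u) + inner ℝ (Sy u) (Sx (J u)))
      + (α * inner ℝ (Sy (J u)) (J u) - inner ℝ (Kx (J u)) (Sx (J u)) + 1 / 4 * inner ℝ w (J u) ^ 2
        - inner ℝ (Sx (Sx (J u) + Kx (J u))) (J u))
      + (-β * inner ℝ (Sx u) u - inner ℝ (Sy u) (Ky u) + 1 / 4 * inner ℝ w u ^ 2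
        - inner ℝ (Sy (Sy u + Ky u)) u)
      + (inner ℝ (Sy (J u)) (Kx u) + α * inner ℝ (Sx (J u)) u
        + inner ℝ (Sy (Sx (J u) + Kx (J u))) u)
      + (inner ℝ (Ky (J u)) (Sx u) - β * inner ℝ (Sy u) (J u)
        + inner ℝ (Sx (Sy u + Ky u)) (J u))
      = 2 * c * ‖u‖ ^ 2) :
    -6 * trace ℝ V (Sx * Sy * J) + (α ^ 2 + β ^ 2) + 1 / 2 * ‖w‖ ^ 2
      - trace ℝ V (Sx * Sx) - trace ℝ V (Sy * Sy) = 2 * c * Module.finrank ℝ V := by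
  set b := stdOrthonormalBasis ℝ V
  have e : ∀ T : Module.End ℝ V, ∑ i, inner ℝ (T (b i)) (b i) = trace ℝ V T := fun T ↦ by
    rw [LinearMap.trace_eq_sum_inner _ b]
    exact Finset.sum_congr rfl fun i _ ↦ real_inner_comm _ _
  have a1 : ∀ (T R : Module.End ℝ V) (u v : V), inner ℝ (T u) (R v) = inner ℝ ((adjoint R * T) u) v :=
    fun T R u v ↦ by rw [Module.End.mul_apply, LinearMap.adjoint_inner_left]
  have a2 : ∀ (T : Module.End ℝ V) (u v : V), inner ℝ (T u) (J v) = inner ℝ ((adjoint J * T) u) v :=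
    fun T u v ↦ a1 T J u v
  have hw1 : ∑ i, inner ℝ w (b i) ^ 2 = ‖w‖ ^ 2 := by
    rw [← real_inner_self_eq_norm_sq, ← b.sum_inner_mul_inner w w]
    exact Finset.sum_congr rfl fun i _ ↦ by rw [sq, real_inner_comm w]
  have hw2 : ∑ i, inner ℝ w (J (b i)) ^ 2 = ‖w‖ ^ 2 := by
    have h1 : ∀ u, inner ℝ w (J u) = inner ℝ (-J w) u := fun u ↦ by
      rw [← LinearMap.adjoint_inner_left, hJs]; rfl
    have h2 : inner ℝ (-J w) (-J w) = inner ℝ w w := by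
      rw [← h1, map_neg, ← Module.End.mul_apply, hJ]; simp
    rw [← real_inner_self_eq_norm_sq, ← h2, ← b.sum_inner_mul_inner (-J w) (-J w)]
    exact Finset.sum_congr rfl fun i _ ↦ by rw [h1, sq, real_inner_comm (-J w)]
  have hsum := Finset.sum_congr (s₁ := Finset.univ) rfl fun i _ ↦ hmix (b i)
  have hb : ∀ i, ‖b i‖ = 1 := fun i ↦ b.orthonormal.1 i
  simp only [map_add, inner_add_left, Finset.sum_add_distrib, Finset.sum_sub_distrib,
    Finset.sum_neg_distrib, ← Finset.mul_sum, hw1, hw2, hb] at hsum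
  simp only [← Module.End.mul_apply] at hsum
  simp only [a1, LinearMap.adjoint_mul, hSx, hKx, hKy, hJs, e] at hsum
  simp only [Finset.sum_const, Finset.card_univ, Fintype.card_fin, nsmul_eq_mul] at hsum
  simp only [neg_mul, mul_neg, map_neg] at hsum
  have hc : ∀ X, trace ℝ V (J * X) = trace ℝ V (X * J) := fun X ↦ LinearMap.trace_mul_comm ..
  simp only [hc, mul_assoc, hJ, mul_neg, mul_one, map_neg] at hsum
  have s1 := trace_symm_mul_skew hSx hJs
  have s2 := trace_symm_mul_skew hSy hJs
  have s3 := trace_symm_mul_skew hSx hKx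
  have s4 := trace_symm_mul_skew hSy hKy
  have s5 := LinearMap.trace_mul_comm ℝ Ky Sy
  have s6 := trace_symm_symm_skew hSx hSy hJs
  have s7 := trace_symm_skew_skew hSy hKx hJs
  have s8 := trace_symm_skew_skew hSx hKy hJs
  have s9 := trace_symm_skew_skew hSy hKy hJs
  have hj := congrArg (fun X ↦ trace ℝ V (X * J)) hjac
  simp only [add_mul, mul_add, sub_mul, map_add, map_sub, smul_mul_assoc, map_smul,
    smul_eq_mul] at hj
  simp only [mul_assoc] at hj s6 s7 s8 s9 ⊢
  rw [s1, s2] at hj hsum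
  rw [htx, hty] at hsum
  linarith

end LeviCivitaTrace

section LeviCivitaEndomorphisms

open LinearMap (adjoint trace)

variable {V : Type*} [NormedAddCommGroup V] [InnerProductSpace ℝ V] [FiniteDimensional ℝ V]

lemma polarize_product {P R : Module.End ℝ V} (hP : adjoint P = P) (hR : adjoint R = R) (u v : V) :
    inner ℝ (P (u + v)) (u + v) * inner ℝ (R (u + v)) (u + v)
      + inner ℝ (P (u - v)) (u - v) * inner ℝ (R (u - v)) (u - v)
      - 2 * (inner ℝ (P u) u * inner ℝ (R u) u) - 2 * (inner ℝ (P v) v * inner ℝ (R v) v)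
    = 2 * (inner ℝ (P u) u * inner ℝ (R v) v + inner ℝ (P v) v * inner ℝ (R u) u
      + 4 * (inner ℝ (P u) v * inner ℝ (R u) v)) := by
  have h1 : inner ℝ (P v) u = inner ℝ (P u) v := by
    rw [← LinearMap.adjoint_inner_right, hP, real_inner_comm]
  have h2 : inner ℝ (R v) u = inner ℝ (R u) v := by
    rw [← LinearMap.adjoint_inner_right, hR, real_inner_comm]
  simp only [map_add, map_sub, inner_add_left, inner_add_right, inner_sub_left, inner_sub_right,
    h1, h2]
  ring

omit [FiniteDimensional ℝ V] in
lemma polarize_norm (u v : V) :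
    ‖u + v‖ ^ 4 + ‖u - v‖ ^ 4 - 2 * ‖u‖ ^ 4 - 2 * ‖v‖ ^ 4
      = 4 * ‖u‖ ^ 2 * ‖v‖ ^ 2 + 8 * inner ℝ u v ^ 2 := by
  have e : ∀ z : V, ‖z‖ ^ 4 = (‖z‖ ^ 2) ^ 2 := fun z ↦ by ring
  simp only [e, norm_add_sq_real, norm_sub_sq_real]
  ring

/-- Averaging the holomorphic sectional curvature over the directions in the ideal. -/
lemma leviCivita_quartic_trace {J Sx Sy : Module.End ℝ V} (hJ : J * J = -1)
    (hJs : adjoint J = -J) (hSx : adjoint Sx = Sx) (hSy : adjoint Sy = Sy) {α β c : ℝ}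
    (htx : trace ℝ V Sx = -β) (hty : trace ℝ V Sy = α)
    (hquad : ∀ u : V,
      inner ℝ (Sx u) (J u) ^ 2 - inner ℝ (Sx u) u * inner ℝ (Sx (J u)) (J u)
      + (inner ℝ (Sy u) (J u) ^ 2 - inner ℝ (Sy u) u * inner ℝ (Sy (J u)) (J u)) = c * ‖u‖ ^ 4) :
    2 * (trace ℝ V (Sx * Sx) + trace ℝ V (Sy * Sy))
      + 6 * (trace ℝ V (Sx * J * Sx * J) + trace ℝ V (Sy * J * Sy * J)) - 2 * (α ^ 2 + β ^ 2)
      = c * (2 * (Module.finrank ℝ V : ℝ) ^ 2 + 4 * Module.finrank ℝ V) := by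
  set b := stdOrthonormalBasis ℝ V
  -- The symmetric operators of the quadratic forms `⟨S u, J u⟩` and `⟨S J u, J u⟩`.
  let B : Module.End ℝ V → Module.End ℝ V := fun S ↦ (1 / 2 : ℝ) • (S * J - J * S)
  let R : Module.End ℝ V → Module.End ℝ V := fun S ↦ -(J * S * J)
  have hBs : ∀ {S}, adjoint S = S → adjoint (B S) = B S := fun {S} hS ↦ by
    have h1 : adjoint (S * J - J * S) = S * J - J * S := by
      simp only [map_sub, LinearMap.adjoint_mul, hS, hJs]
      simp only [neg_mul, mul_neg, sub_neg_eq_add]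
      abel
    have h2 := map_smulₛₗ (adjoint (𝕜 := ℝ) (E := V) (F := V)) (1 / 2 : ℝ) (S * J - J * S)
    rw [h1, conj_trivial] at h2
    exact h2
  have hRs : ∀ {S}, adjoint S = S → adjoint (R S) = R S := fun {S} hS ↦ by
    simp only [R, map_neg, LinearMap.adjoint_mul, hS, hJs]
    simp only [neg_mul, mul_neg, neg_neg, mul_assoc]
  have e1 : ∀ {S : Module.End ℝ V}, adjoint S = S → ∀ u, inner ℝ (S u) (J u) = inner ℝ (B S u) u :=
      fun {S} hS u ↦ by
    have h1 : inner ℝ (S u) (J u) = -inner ℝ (J (S u)) u := by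
      rw [← LinearMap.adjoint_inner_left, hJs]; simp
    have h2 : inner ℝ (S (J u)) u = inner ℝ (S u) (J u) := by
      rw [← LinearMap.adjoint_inner_right, hS, real_inner_comm]
    simp only [B, LinearMap.smul_apply, LinearMap.sub_apply, Module.End.mul_apply, inner_smul_left,
      inner_sub_left, h2, h1]
    simp; ring
  have e2 : ∀ (S : Module.End ℝ V) (u), inner ℝ (S (J u)) (J u) = inner ℝ (R S u) u :=
      fun S u ↦ by
    rw [← LinearMap.adjoint_inner_left, hJs]; simp [R]
  have tB : ∀ S, trace ℝ V (B S) = 0 := fun S ↦ by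
    simp only [B, map_smul, map_sub, LinearMap.trace_mul_comm ℝ J, sub_self, smul_zero]
  have tR : ∀ S, trace ℝ V (R S) = trace ℝ V S := fun S ↦ by
    simp only [R, map_neg]; rw [LinearMap.trace_mul_comm, ← mul_assoc, hJ]; simp
  have tBB : ∀ S, trace ℝ V (B S * B S) =
      1 / 2 * (trace ℝ V (S * S) + trace ℝ V (S * J * S * J)) := fun S ↦ by
    have c1 : trace ℝ V (J * S * (J * S)) = trace ℝ V (S * J * S * J) := by
      rw [mul_assoc, LinearMap.trace_mul_comm]; simp only [mul_assoc]
    have c2 : trace ℝ V (J * S * (S * J)) = - trace ℝ V (S * S) := by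
      rw [mul_assoc, LinearMap.trace_mul_comm, mul_assoc, mul_assoc, hJ]; simp
    have c3 : S * J * (J * S) = -(S * S) := by
      rw [mul_assoc, ← mul_assoc J, hJ]; simp
    simp only [B, smul_mul_smul_comm, sub_mul, mul_sub, map_smul, map_sub, c1, c2, c3, map_neg,
      smul_eq_mul]
    rw [show S * J * S * J = S * J * (S * J) from mul_assoc _ _ _]
    ring
  have tSR : ∀ S, trace ℝ V (S * R S) = - trace ℝ V (S * J * S * J) := fun S ↦ by
    simp only [R, mul_neg, map_neg, mul_assoc]
  have key : ∀ u v : V, ∀ S : Module.End ℝ V, adjoint S = S →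
      (inner ℝ (S (u + v)) (J (u + v)) ^ 2
          - inner ℝ (S (u + v)) (u + v) * inner ℝ (S (J (u + v))) (J (u + v)))
        + (inner ℝ (S (u - v)) (J (u - v)) ^ 2
          - inner ℝ (S (u - v)) (u - v) * inner ℝ (S (J (u - v))) (J (u - v)))
        - 2 * (inner ℝ (S u) (J u) ^ 2 - inner ℝ (S u) u * inner ℝ (S (J u)) (J u))
        - 2 * (inner ℝ (S v) (J v) ^ 2 - inner ℝ (S v) v * inner ℝ (S (J v)) (J v))
      = 2 * (inner ℝ (B S u) u * inner ℝ (B S v) v + inner ℝ (B S v) v * inner ℝ (B S u) u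
          + 4 * (inner ℝ (B S u) v * inner ℝ (B S u) v))
        - 2 * (inner ℝ (S u) u * inner ℝ (R S v) v + inner ℝ (S v) v * inner ℝ (R S u) u
          + 4 * (inner ℝ (S u) v * inner ℝ (R S u) v)) := fun u v S hS ↦ by
    rw [← polarize_product (hBs hS) (hBs hS), ← polarize_product hS (hRs hS)]
    simp only [e1 hS, e2]
    ring
  have hpt : ∀ i j, (2 * (inner ℝ (B Sx (b i)) (b i) * inner ℝ (B Sx (b j)) (b j)
          + inner ℝ (B Sx (b j)) (b j) * inner ℝ (B Sx (b i)) (b i)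
          + 4 * (inner ℝ (B Sx (b i)) (b j) * inner ℝ (B Sx (b i)) (b j)))
        - 2 * (inner ℝ (Sx (b i)) (b i) * inner ℝ (R Sx (b j)) (b j)
          + inner ℝ (Sx (b j)) (b j) * inner ℝ (R Sx (b i)) (b i)
          + 4 * (inner ℝ (Sx (b i)) (b j) * inner ℝ (R Sx (b i)) (b j))))
      + (2 * (inner ℝ (B Sy (b i)) (b i) * inner ℝ (B Sy (b j)) (b j)
          + inner ℝ (B Sy (b j)) (b j) * inner ℝ (B Sy (b i)) (b i)
          + 4 * (inner ℝ (B Sy (b i)) (b j) * inner ℝ (B Sy (b i)) (b j)))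
        - 2 * (inner ℝ (Sy (b i)) (b i) * inner ℝ (R Sy (b j)) (b j)
          + inner ℝ (Sy (b j)) (b j) * inner ℝ (R Sy (b i)) (b i)
          + 4 * (inner ℝ (Sy (b i)) (b j) * inner ℝ (R Sy (b i)) (b j))))
      = c * (4 + 8 * (inner ℝ (b i) (b j) * inner ℝ (b j) (b i))) := fun i j ↦ by
    rw [← key _ _ Sx hSx, ← key _ _ Sy hSy]
    have h1 := hquad (b i + b j)
    have h2 := hquad (b i - b j)
    have h3 := hquad (b i)
    have h4 := hquad (b j)
    have h5 := polarize_norm (b i) (b j)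
    have n1 : ‖b i‖ = 1 := b.orthonormal.1 i
    have n2 : ‖b j‖ = 1 := b.orthonormal.1 j
    rw [n1, n2] at h5
    rw [n1] at h3
    rw [n2] at h4
    rw [real_inner_comm (b i) (b j)]
    linear_combination h1 + h2 - 2 * h3 - 2 * h4 + c * h5
  have hsum := Finset.sum_congr (s₁ := Finset.univ) rfl fun i _ ↦
    Finset.sum_congr (s₁ := Finset.univ) rfl fun j _ ↦ hpt i j
  have nn : ∀ i, inner ℝ (b i) (b i) = 1 := fun i ↦ by
    rw [real_inner_self_eq_norm_sq, b.orthonormal.1 i]; norm_num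
  have pol := fun S hS ↦ sum_sum_inner_polarization (V := V) (B S) (B S) (hBs hS)
  have pol' := fun S hS ↦ sum_sum_inner_polarization (V := V) S (R S) hS
  have p1 := pol Sx hSx
  have p2 := pol Sy hSy
  have p3 := pol' Sx hSx
  have p4 := pol' Sy hSy
  rw [tB, tBB] at p1 p2
  rw [tR, tSR] at p3 p4
  rw [htx] at p3
  rw [hty] at p4
  simp only [mul_add, Finset.sum_add_distrib, Finset.sum_sub_distrib, ← Finset.mul_sum,
    b.sum_inner_mul_inner, nn, Finset.sum_const, Finset.card_univ, Fintype.card_fin,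
    nsmul_eq_mul] at hsum p1 p2 p3 p4
  linear_combination hsum / 2 - p1 - p2 + p3 + p4


/-- In real dimension two the quartic equation at one vector bounds `c` from below. -/
lemma leviCivita_quartic_dim_two {J Sx Sy : Module.End ℝ V} (hJ : J * J = -1)
    (hJs : adjoint J = -J) {α β c : ℝ} (hdim : Module.finrank ℝ V = 2)
    (htx : trace ℝ V Sx = -β) (hty : trace ℝ V Sy = α)
    (hquad : ∀ u : V,
      inner ℝ (Sx u) (J u) ^ 2 - inner ℝ (Sx u) u * inner ℝ (Sx (J u)) (J u)
      + (inner ℝ (Sy u) (J u) ^ 2 - inner ℝ (Sy u) u * inner ℝ (Sy (J u)) (J u)) = c * ‖u‖ ^ 4) :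
    -c ≤ 1 / 4 * (α ^ 2 + β ^ 2) := by
  let b := (stdOrthonormalBasis ℝ V).reindex (finCongr hdim)
  have e : ∀ T : Module.End ℝ V, trace ℝ V T = inner ℝ (T (b 0)) (b 0) + inner ℝ (T (b 1)) (b 1) :=
    fun T ↦ by
      rw [LinearMap.trace_eq_sum_inner _ b, Fin.sum_univ_two, real_inner_comm, real_inner_comm (b 1)]
  have n0 : ‖b 0‖ = 1 := b.orthonormal.1 0
  have n1 : ‖b 1‖ = 1 := b.orthonormal.1 1
  have h0 : inner ℝ (b 0) (J (b 0)) = 0 := by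
    have : inner ℝ (b 0) (J (b 0)) = -inner ℝ (b 0) (J (b 0)) := by
      conv_lhs => rw [← LinearMap.adjoint_inner_left, hJs, LinearMap.neg_apply, inner_neg_left,
        real_inner_comm]
    linarith
  have h1 : J (b 0) = inner ℝ (b 1) (J (b 0)) • b 1 := by
    have := b.sum_repr' (J (b 0))
    rw [Fin.sum_univ_two, h0, zero_smul, zero_add] at this
    exact this.symm
  set s := inner ℝ (b 1) (J (b 0)) with hs
  have h2 : inner ℝ (J (b 0)) (J (b 0)) = 1 := by
    rw [← LinearMap.adjoint_inner_left, hJs, LinearMap.neg_apply, ← Module.End.mul_apply, hJ]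
    simp [n0]
  have h3 : s ^ 2 = 1 := by
    rw [h1, inner_smul_left, inner_smul_right, real_inner_self_eq_norm_sq, n1] at h2
    simp at h2
    linarith
  have h4 : ∀ T : Module.End ℝ V, inner ℝ (T (J (b 0))) (J (b 0)) = inner ℝ (T (b 1)) (b 1) :=
    fun T ↦ by
      rw [h1, map_smul, inner_smul_left, inner_smul_right]
      simp only [conj_trivial]
      rw [← mul_assoc, ← sq, h3, one_mul]
  have h5 := hquad (b 0)
  rw [h4, h4, n0] at h5
  rw [e] at htx hty
  have hβ : β = -(inner ℝ (Sx (b 0)) (b 0) + inner ℝ (Sx (b 1)) (b 1)) := by linarith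
  rw [hβ, ← hty]
  nlinarith [sq_nonneg (inner ℝ (Sx (b 0)) (J (b 0))), sq_nonneg (inner ℝ (Sy (b 0)) (J (b 0))),
    sq_nonneg (inner ℝ (Sx (b 0)) (b 0) - inner ℝ (Sx (b 1)) (b 1)),
    sq_nonneg (inner ℝ (Sy (b 0)) (b 0) - inner ℝ (Sy (b 1)) (b 1))]

/-- The numbers `tr (S²) ± tr (S J S J)` are nonnegative, being up to a factor the squared norms of
the parts of `S` anticommuting and commuting with `J`. -/
lemma abs_trace_mul_mul_mul_le {J S : Module.End ℝ V} (hJ : J * J = -1) (hJs : adjoint J = -J)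
    (hS : adjoint S = S) :
    |trace ℝ V (S * J * S * J)| ≤ trace ℝ V (S * S) := by
  have hT : adjoint (S * J) = -(J * S) := by rw [LinearMap.adjoint_mul, hS, hJs, neg_mul]
  have c1 : trace ℝ V (J * S * (J * S)) = trace ℝ V (S * J * S * J) := by
    rw [mul_assoc, LinearMap.trace_mul_comm]; simp only [mul_assoc]
  have c2 : trace ℝ V (J * S * (S * J)) = - trace ℝ V (S * S) := by
    rw [mul_assoc, LinearMap.trace_mul_comm, mul_assoc, mul_assoc, hJ]; simp
  have c3 : S * J * (J * S) = -(S * S) := by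
    rw [mul_assoc, ← mul_assoc J, hJ]; simp
  have c4 : trace ℝ V (S * J * (S * J)) = trace ℝ V (S * J * S * J) := by
    simp only [mul_assoc]
  have hT' : adjoint (J * S) = -(S * J) := by rw [LinearMap.adjoint_mul, hS, hJs, mul_neg]
  have h1 := LinearMap.trace_adjoint_mul_self_nonneg (S * J + J * S)
  have h2 := LinearMap.trace_adjoint_mul_self_nonneg (S * J - J * S)
  simp only [map_add, map_sub, hT, hT'] at h1 h2
  simp only [add_mul, sub_mul, mul_add, mul_sub, neg_mul, map_add, map_sub, map_neg, c1, c2, c3,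
    c4] at h1 h2
  rw [abs_le]
  constructor <;> linarith

/-- In real dimension at least four, eliminating the part of `S` commuting with `J` from the two
averaged curvature equations bounds the squared norm of the anticommuting part by a negative
multiple of the squares of the structure constants. Here `k` is the dimension of the ideal,
`Z = α² + β²`, `W = ‖w‖²`, `t = tr (Sx Sy J)`, while `sx, sy` and `qx, qy` stand for `tr (S²)` and
`tr (S J S J)` with `S = Sx, Sy`. -/
lemma leviCivita_elimination {k Z W c sx sy qx qy t : ℝ} (hk : 4 ≤ k) (hZ : 0 ≤ Z) (hW : 0 ≤ W)
    (hc : c = -Z - 3 / 4 * W) (bx : -sx ≤ qx) (bY : -sy ≤ qy) (t1 : 2 * t = sx + qx)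
    (t2 : 2 * t = sy + qy) (hq : 2 * (sx + sy) + 6 * (qx + qy) - 2 * Z = c * (2 * k ^ 2 + 4 * k))
    (hmix : -6 * t + Z + 1 / 2 * W - sx - sy = 2 * c * k) : Z = 0 ∧ W = 0 := by
  have hk' : 4 * k - 2 * k ^ 2 ≤ -16 := by nlinarith
  have hprod := mul_le_mul_of_nonneg_left hk' (show 0 ≤ Z + 3 / 4 * W by linarith)
  have helim : 12 * ((sx + sy) + (qx + qy)) =
      6 * Z + 2 * W + (Z + 3 / 4 * W) * (4 * k - 2 * k ^ 2) := by
    rw [hc] at hq hmix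
    linear_combination 1 * hq - 4 * hmix - 6 * t1 - 6 * t2
  constructor <;> linarith

/-- The numerical heart of the Levi-Civita case: the curvature of the two-plane transversal to the
ideal, the averaged curvature of the ideal, and the averaged mixed curvature are incompatible
unless everything vanishes. -/
lemma leviCivita_vanishing {J Sx Sy Kx Ky : Module.End ℝ V} (hJ : J * J = -1)
    (hJs : adjoint J = -J)
    (hSx : adjoint Sx = Sx) (hSy : adjoint Sy = Sy) (hKx : adjoint Kx = -Kx)
    (hKy : adjoint Ky = -Ky) {α β c : ℝ} (w : V)
    (hjac : (Sx + Kx) * (Sy + Ky) - (Sy + Ky) * (Sx + Kx) = α • (Sx + Kx) + β • (Sy + Ky))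
    (hint : Sx + J * Sx * J = Sy * J - J * Sy) (hintK : Kx + J * Kx * J = Ky * J - J * Ky)
    (htx : trace ℝ V Sx = -β) (hty : trace ℝ V Sy = α)
    (hc : c = -(α ^ 2 + β ^ 2) - 3 / 4 * ‖w‖ ^ 2)
    (hquad : ∀ u : V,
      inner ℝ (Sx u) (J u) ^ 2 - inner ℝ (Sx u) u * inner ℝ (Sx (J u)) (J u)
      + (inner ℝ (Sy u) (J u) ^ 2 - inner ℝ (Sy u) u * inner ℝ (Sy (J u)) (J u)) = c * ‖u‖ ^ 4)
    (hmix : -6 * trace ℝ V (Sx * Sy * J) + (α ^ 2 + β ^ 2) + 1 / 2 * ‖w‖ ^ 2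
      - trace ℝ V (Sx * Sx) - trace ℝ V (Sy * Sy) = 2 * c * Module.finrank ℝ V) :
    c = 0 ∧ α = 0 ∧ β = 0 ∧ w = 0 ∧ Sx = 0 ∧ Sy = 0 ∧ Kx * J = J * Kx ∧ Ky * J = J * Ky := by
  have hq := leviCivita_quartic_trace hJ hJs hSx hSy htx hty hquad
  have t1 := two_mul_trace_mul_mul (trace_symm_symm_skew hSx hSy hJs) hint
  have t2 : 2 * trace ℝ V (Sx * Sy * J) = trace ℝ V (Sy * Sy) + trace ℝ V (Sy * J * Sy * J) := by
    have h1 := congrArg (fun X ↦ trace ℝ V (Sy * X)) (integrability_swap hJ hint)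
    simp only [mul_add, mul_sub, map_add, map_sub] at h1
    have h2 : trace ℝ V (Sy * (J * Sx)) = trace ℝ V (Sx * Sy * J) := by
      rw [← mul_assoc, LinearMap.trace_mul_comm, ← mul_assoc]
    have h3 := trace_symm_symm_skew hSx hSy hJs
    simp only [← mul_assoc] at h1 h2
    linarith
  have bx := abs_le.1 (abs_trace_mul_mul_mul_le hJ hJs hSx)
  have bY := abs_le.1 (abs_trace_mul_mul_mul_le hJ hJs hSy)
  have hev := even_finrank_of_sq_eq_neg_one hJ
  have hw := sq_nonneg ‖w‖
  have ha := sq_nonneg α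
  have hb := sq_nonneg β
  have h0 : α ^ 2 + β ^ 2 = 0 ∧ ‖w‖ ^ 2 = 0 := by
    rcases Nat.lt_or_ge (Module.finrank ℝ V) 3 with h3 | h3
    · have : Module.finrank ℝ V = 0 ∨ Module.finrank ℝ V = 2 := by
        obtain ⟨r, hr⟩ := hev; omega
      rcases this with h | h
      · have := Module.finrank_zero_iff.1 h
        have e0 : ∀ T : Module.End ℝ V, trace ℝ V T = 0 := fun T ↦ by
          rw [Subsingleton.elim T 0, map_zero]
        rw [e0] at htx hty
        rw [Subsingleton.elim w 0, ← hty, show β = 0 by linarith]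
        simp
      · have := leviCivita_quartic_dim_two hJ hJs h htx hty hquad
        constructor <;> linarith
    · have h4 : (4 : ℝ) ≤ Module.finrank ℝ V := by
        have : 4 ≤ Module.finrank ℝ V := by obtain ⟨r, hr⟩ := hev; omega
        exact_mod_cast this
      exact leviCivita_elimination h4 (by positivity) hw hc bx.1 bY.1 t1 t2 hq hmix
  obtain ⟨hz, hω⟩ := h0
  have hα : α = 0 := pow_eq_zero_iff two_ne_zero |>.1 (by linarith)
  have hβ : β = 0 := pow_eq_zero_iff two_ne_zero |>.1 (by linarith)
  have hw0 : w = 0 := norm_eq_zero.1 (pow_eq_zero_iff (two_ne_zero)|>.1 hω)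
  have hc0 : c = 0 := by rw [hc, hz, hω]; norm_num
  have hSx0 : Sx = 0 := LinearMap.eq_zero_of_trace_adjoint_mul_self (by
    rw [hSx]; rw [hc0] at hmix; linarith)
  have hSy0 : Sy = 0 := LinearMap.eq_zero_of_trace_adjoint_mul_self (by
    rw [hSy]; rw [hc0] at hmix; linarith)
  have hKK : trace ℝ V (Kx * Ky * J) = 0 := by
    have h1 := congrArg (fun X ↦ trace ℝ V (X * J)) hjac
    have h2 := trace_skew_skew_skew hKx hKy hJs
    simp only [hSx0, hSy0, hα, hβ, zero_add, sub_mul, map_sub, zero_smul, zero_mul, map_zero] at h1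
    linarith
  have hKx0 : Kx * J = J * Kx := by
    apply commute_of_trace_eq_zero hJ hJs hKx
    rw [← two_mul_trace_mul_mul (trace_skew_skew_skew hKx hKy hJs) hintK, hKK, mul_zero]
  refine ⟨hc0, hα, hβ, hw0, hSx0, hSy0, hKx0, ?_⟩
  rw [← sub_eq_zero, ← hintK, ← hKx0, mul_assoc, hJ]
  simp

end LeviCivitaEndomorphisms

/-! ### The trace identity for the Chern connection -/

section ChernEndomorphisms

open LinearMap (adjoint trace)

variable {V : Type*} [NormedAddCommGroup V] [InnerProductSpace ℝ V] [FiniteDimensional ℝ V]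

lemma eq_zero_of_symm_of_inner_self {T : Module.End ℝ V} (hT : adjoint T = T)
    (h : ∀ u, inner ℝ (T u) u = 0) : T = 0 := by
  have hs : T.IsSymmetric := fun u v ↦ by
    rw [← LinearMap.adjoint_inner_right, hT]
  exact hs.inner_map_self_eq_zero.1 h

lemma adjoint_eq_neg_of_inner_self {T : Module.End ℝ V} (h : ∀ u, inner ℝ (T u) u = 0) :
    adjoint T = -T := by
  rw [eq_neg_iff_add_eq_zero]
  apply eq_zero_of_symm_of_inner_self
  · rw [map_add, LinearMap.adjoint_adjoint, add_comm]
  · intro u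
    rw [LinearMap.add_apply, inner_add_left, LinearMap.adjoint_inner_left, real_inner_comm, h,
      add_zero]

/-- Here `hmix` is the mixed curvature of the Chern connection. Its average over `u` forces the
component `σ` to vanish, and then `hmix` itself says that the remaining operator `F` is normal. -/
lemma chern_vanishing {J σ F Ax Ay : Module.End ℝ V} (hJ : J * J = -1)
    (hσs : adjoint σ = -σ) (hσx : σ = J * Ax - Ax * J) (hσy : σ = Ay + J * Ay * J)
    (hF : F * J = J * F)
    (hmix : ∀ u : V, -(1 / 2) * (inner ℝ (F u) (F u) - inner ℝ (adjoint F u) (adjoint F u))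
      - 1 / 2 * inner ℝ (σ u) (σ u) - inner ℝ (F u) (σ u)
      + inner ℝ (σ (Ax (J u))) u - inner ℝ (σ (Ay u)) u = 0) :
    σ = 0 ∧ adjoint F * F = F * adjoint F := by
  have hσJ : σ * J = -(J * σ) := by
    rw [hσx, sub_mul, mul_sub, mul_assoc, mul_assoc Ax, hJ, ← mul_assoc J J, hJ]
    simp
  have hσ : σ = 0 := by
    set b := stdOrthonormalBasis ℝ V
    have e : ∀ T : Module.End ℝ V, ∑ i, inner ℝ (T (b i)) (b i) = trace ℝ V T := fun T ↦ by
      rw [LinearMap.trace_eq_sum_inner _ b]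
      exact Finset.sum_congr rfl fun i _ ↦ real_inner_comm _ _
    have a1 : ∀ (T R : Module.End ℝ V) (u v : V),
        inner ℝ (T u) (R v) = inner ℝ ((adjoint R * T) u) v :=
      fun T R u v ↦ by rw [Module.End.mul_apply, LinearMap.adjoint_inner_left]
    have hsum := Finset.sum_congr (s₁ := Finset.univ) rfl fun i _ ↦ hmix (b i)
    simp only [Finset.sum_add_distrib, Finset.sum_sub_distrib, ← Finset.mul_sum] at hsum
    simp only [← Module.End.mul_apply] at hsum
    simp only [a1, LinearMap.adjoint_adjoint, e, hσs, Finset.sum_const_zero] at hsum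
    have t1 : trace ℝ V (σ * F) = 0 := by
      apply LinearMap.trace_eq_zero_of_anticomm hJ
      rw [mul_assoc, hF, ← mul_assoc, hσJ, neg_mul, mul_assoc]
    have t2 := LinearMap.trace_mul_comm ℝ F (adjoint F)
    have t3 : trace ℝ V (σ * σ) = 2 * trace ℝ V (σ * Ay) := by
      have h1 : trace ℝ V (σ * (J * Ay * J)) = trace ℝ V (σ * Ay) := by
        have h2 : J * (σ * J) = σ := by rw [hσJ, mul_neg, ← mul_assoc, hJ]; simp
        rw [← mul_assoc, LinearMap.trace_mul_comm, ← mul_assoc, ← mul_assoc, mul_assoc J, h2]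
      have h3 := congrArg (fun X ↦ trace ℝ V (σ * X)) hσy
      simp only [mul_add, map_add, h1] at h3
      linarith
    have t4 : trace ℝ V (σ * σ) = -2 * trace ℝ V (σ * (Ax * J)) := by
      have h1 : trace ℝ V (σ * (J * Ax)) = -trace ℝ V (σ * (Ax * J)) := by
        rw [← mul_assoc, hσJ, neg_mul, map_neg, mul_assoc, LinearMap.trace_mul_comm, mul_assoc]
      have h3 := congrArg (fun X ↦ trace ℝ V (σ * X)) hσx
      simp only [mul_sub, map_sub, h1] at h3
      linarith
    apply LinearMap.eq_zero_of_trace_adjoint_mul_self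
    rw [hσs]
    simp only [neg_mul, map_neg] at hsum ⊢
    linarith
  refine ⟨hσ, ?_⟩
  rw [← sub_eq_zero]
  apply eq_zero_of_symm_of_inner_self
  · simp only [map_sub, LinearMap.adjoint_mul, LinearMap.adjoint_adjoint]
  · intro u
    have h := hmix u
    simp only [hσ, LinearMap.zero_apply, inner_zero_left, inner_zero_right] at h
    have h1 : inner ℝ (F (adjoint F u)) u = inner ℝ (adjoint F u) (adjoint F u) := by
      rw [LinearMap.adjoint_inner_right]
    rw [LinearMap.sub_apply, inner_sub_left, Module.End.mul_apply, Module.End.mul_apply,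
      LinearMap.adjoint_inner_left, h1]
    linarith

end ChernEndomorphisms

/-! ### Lie algebras with a Hermitian structure and an abelian ideal -/

section HermitianLieAlgebras

open LinearMap (adjoint trace)

variable {W : Type*} [NormedAddCommGroup W] [InnerProductSpace ℝ W]

variable (W) in
/-- A real Lie algebra with a Hermitian structure. The bracket is recorded as a bilinear map on a
Euclidean space, the scalar product being the metric. -/
structure HermitianLieAlgebra where
  /-- the Lie bracket -/
  br : W →ₗ[ℝ] W →ₗ[ℝ] W
  /-- the complex structure -/
  J : W →ₗ[ℝ] W
  br_self : ∀ a, br a a = 0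
  jacobi : ∀ a b c, br a (br b c) = br (br a b) c + br b (br a c)
  J_sq : ∀ a, J (J a) = -a
  inner_J_J : ∀ a b, inner ℝ (J a) (J b) = inner ℝ a b
  integrable : ∀ a b, br a b - br (J a) (J b) + J (br (J a) b) + J (br a (J b)) = 0

namespace HermitianLieAlgebra

variable (L : HermitianLieAlgebra W)

lemma br_skew (a b : W) : L.br b a = -L.br a b := by
  have h := L.br_self (a + b)
  simp only [map_add, LinearMap.add_apply, L.br_self, zero_add, add_zero] at h
  exact eq_neg_of_add_eq_zero_left h

lemma inner_J_left (a b : W) : inner ℝ (L.J a) b = -inner ℝ a (L.J b) := by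
  rw [← L.inner_J_J a, L.J_sq, inner_neg_right, neg_neg]

lemma inner_J_self (a : W) : inner ℝ (L.J a) a = 0 := by
  linarith [L.inner_J_left a a, real_inner_comm a (L.J a)]

/-- The curvature `R(a, b) z` of the left-invariant connection `n`, where `n a b` stands for
`∇_a b`. -/
def curv (n : W →ₗ[ℝ] W →ₗ[ℝ] W) (a b z : W) : W :=
  n a (n b z) - n b (n a z) - n (L.br a b) z

/-- The connection `n` is metric. -/
def IsMetric (n : W →ₗ[ℝ] W →ₗ[ℝ] W) : Prop :=
  ∀ a b z, inner ℝ (n a b) z + inner ℝ b (n a z) = 0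

/-- The holomorphic sectional curvature of the connection `n` is the constant `c`. For the vector
`ξ = u - i J u` of type `(1, 0)` and a metric connection, `R(ξ, ξ̄, ξ, ξ̄)` is four times the left
hand side, and `|ξ|⁴` is `4 ‖u‖ ^ 4`. -/
def HasConstHSC (n : W →ₗ[ℝ] W →ₗ[ℝ] W) (c : ℝ) : Prop :=
  ∀ u, inner ℝ (L.curv n u (L.J u) (L.J u)) u = c * ‖u‖ ^ 4

lemma inner_curv {n : W →ₗ[ℝ] W →ₗ[ℝ] W} (hn : IsMetric n) (a b z t : W) :
    inner ℝ (L.curv n a b z) t =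
      -inner ℝ (n b z) (n a t) + inner ℝ (n a z) (n b t) - inner ℝ (n (L.br a b) z) t := by
  rw [curv, inner_sub_left, inner_sub_left]
  linarith [hn a (n b z) t, hn b (n a z) t]

/-- Polarisation of constant holomorphic sectional curvature at two vectors. -/
lemma HasConstHSC.polarize {n : W →ₗ[ℝ] W →ₗ[ℝ] W} {c : ℝ} {L : HermitianLieAlgebra W}
    (h : L.HasConstHSC n c) (x u : W) (hx : ‖x‖ = 1) (hxu : inner ℝ x u = 0) :
    inner ℝ (L.curv n x (L.J x) (L.J u)) u + inner ℝ (L.curv n u (L.J u) (L.J x)) x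
      + inner ℝ (L.curv n x (L.J u) (L.J u)) x + inner ℝ (L.curv n u (L.J x) (L.J x)) u
      + inner ℝ (L.curv n x (L.J u) (L.J x)) u + inner ℝ (L.curv n u (L.J x) (L.J u)) x
    = 2 * c * ‖u‖ ^ 2 := by
  have h1 := h (x + u)
  have h2 := h (x - u)
  have h3 := h x
  have h4 := h u
  have n1 : ‖x + u‖ ^ 2 = 1 + ‖u‖ ^ 2 := by rw [norm_add_sq_real, hxu, hx]; ring
  have n2 : ‖x - u‖ ^ 2 = 1 + ‖u‖ ^ 2 := by rw [norm_sub_sq_real, hxu, hx]; ring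
  have e : ∀ z : W, ‖z‖ ^ 4 = (‖z‖ ^ 2) ^ 2 := fun z ↦ by ring
  rw [e, n1] at h1
  rw [e, n2] at h2
  rw [hx] at h3
  rw [e] at h4
  simp only [curv, map_add, map_sub, LinearMap.add_apply, LinearMap.sub_apply, inner_add_left,
    inner_sub_left, inner_add_right, inner_sub_right] at h1 h2 h3 h4 ⊢
  linear_combination (1 / 2) * (h1 + h2 - 2 * h3 - 2 * h4)

/-- An abelian ideal of codimension two, stable under the complex structure, together with a unit
vector `x` such that `x, J x` span its orthogonal complement. -/
structure AdaptedIdeal where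
  /-- the ideal -/
  𝔞 : Submodule ℝ W
  /-- a unit normal vector of the ideal -/
  x : W
  br_mem : ∀ a, ∀ u ∈ 𝔞, L.br a u ∈ 𝔞
  br_eq_zero : ∀ u ∈ 𝔞, ∀ v ∈ 𝔞, L.br u v = 0
  J_mem : ∀ u ∈ 𝔞, L.J u ∈ 𝔞
  norm_x : ‖x‖ = 1
  inner_x : ∀ u ∈ 𝔞, inner ℝ x u = 0
  decomp : ∀ z, z - inner ℝ x z • x - inner ℝ (L.J x) z • L.J x ∈ 𝔞

namespace AdaptedIdeal

variable {L} (D : L.AdaptedIdeal)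

/-- The second unit normal vector of the ideal. -/
def y : W := L.J D.x

/-- The action of the Lie algebra on the ideal. -/
def act (t : W) : Module.End ℝ D.𝔞 := (L.br t).restrict (D.br_mem t)

/-- The complex structure of the ideal. -/
def J𝔞 : Module.End ℝ D.𝔞 := L.J.restrict D.J_mem

@[simp] lemma coe_act (t : W) (u : D.𝔞) : (D.act t u : W) = L.br t u := rfl
@[simp] lemma coe_J𝔞 (u : D.𝔞) : (D.J𝔞 u : W) = L.J u := rfl

lemma J𝔞_sq : D.J𝔞 * D.J𝔞 = -1 := by
  ext u; simp [L.J_sq]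

lemma J_y : L.J D.y = -D.x := L.J_sq _

lemma inner_x_x : inner ℝ D.x D.x = (1 : ℝ) := by rw [real_inner_self_eq_norm_sq, D.norm_x]; norm_num
lemma inner_y_y : inner ℝ D.y D.y = (1 : ℝ) := by rw [y, L.inner_J_J, D.inner_x_x]
lemma inner_y_x : inner ℝ D.y D.x = (0 : ℝ) := L.inner_J_self _
lemma inner_x_y : inner ℝ D.x D.y = (0 : ℝ) := by rw [real_inner_comm, D.inner_y_x]
lemma inner_x_coe (u : D.𝔞) : inner ℝ D.x (u : W) = 0 := D.inner_x u u.2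
lemma inner_coe_x (u : D.𝔞) : inner ℝ (u : W) D.x = 0 := by rw [real_inner_comm, D.inner_x_coe]
lemma inner_y_coe (u : D.𝔞) : inner ℝ D.y (u : W) = 0 := by
  rw [y, L.inner_J_left, ← coe_J𝔞, D.inner_x_coe, neg_zero]
lemma inner_coe_y (u : D.𝔞) : inner ℝ (u : W) D.y = 0 := by rw [real_inner_comm, D.inner_y_coe]

lemma exists_decomp (z : W) : ∃ (α β : ℝ) (u : D.𝔞), z = α • D.x + β • D.y + u :=
  ⟨inner ℝ D.x z, inner ℝ D.y z, ⟨_, D.decomp z⟩, by simp [y]⟩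

lemma ext_inner {z z' : W} (hx : inner ℝ z D.x = inner ℝ z' D.x) (hy : inner ℝ z D.y = inner ℝ z' D.y)
    (hu : ∀ u : D.𝔞, inner ℝ z (u : W) = inner ℝ z' u) : z = z' := by
  refine ext_inner_right ℝ fun v ↦ ?_
  obtain ⟨α, β, u, rfl⟩ := D.exists_decomp v
  simp only [inner_add_right, inner_smul_right, hx, hy, hu]

lemma br_coe_coe (u v : D.𝔞) : L.br u v = 0 := D.br_eq_zero u u.2 v v.2
lemma br_coe_left (u : D.𝔞) (t : W) : L.br u t = -(D.act t u : D.𝔞) := by rw [L.br_skew t, coe_act]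

lemma adjoint_J𝔞 [FiniteDimensional ℝ W] : adjoint D.J𝔞 = -D.J𝔞 := by
  refine LinearMap.ext fun u ↦ ext_inner_right ℝ fun v ↦ ?_
  rw [LinearMap.adjoint_inner_left, real_inner_comm, LinearMap.neg_apply, inner_neg_left]
  change inner ℝ (L.J v) (u : W) = -inner ℝ (L.J u) (v : W)
  rw [L.inner_J_left, real_inner_comm]

/-- The integrability of the complex structure, for the action on the ideal. -/
lemma act_integrable : D.act D.x + D.J𝔞 * D.act D.x * D.J𝔞 = D.act D.y * D.J𝔞 - D.J𝔞 * D.act D.y := by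
  ext u
  have h := L.integrable D.x u
  simp only [LinearMap.add_apply, LinearMap.sub_apply, Module.End.mul_apply, Submodule.coe_add,
    Submodule.coe_sub, coe_act, coe_J𝔞]
  rw [← sub_eq_zero, ← h]
  simp only [y]
  abel

/-- The Jacobi identity, for the action on the ideal. -/
lemma act_jacobi {α β : ℝ} {w : D.𝔞} (hw : L.br D.x D.y = α • D.x + β • D.y + w) :
    D.act D.x * D.act D.y - D.act D.y * D.act D.x = α • D.act D.x + β • D.act D.y := by
  ext u
  have h := L.jacobi D.x D.y u
  rw [hw] at h
  simp only [map_add, map_smul, LinearMap.add_apply, LinearMap.smul_apply, D.br_coe_coe,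
    add_zero] at h
  simp only [LinearMap.add_apply, LinearMap.sub_apply, Module.End.mul_apply, Submodule.coe_add,
    Submodule.coe_sub, coe_act, LinearMap.smul_apply, Submodule.coe_smul, h]
  abel

/-- The trace of an endomorphism of the Lie algebra preserving the ideal. -/
lemma trace_eq [FiniteDimensional ℝ W] (T : Module.End ℝ W) (hT : ∀ u ∈ D.𝔞, T u ∈ D.𝔞) :
    trace ℝ W T = inner ℝ D.x (T D.x) + inner ℝ D.y (T D.y) + trace ℝ D.𝔞 (T.restrict hT) := by
  have rank_one : ∀ v : W, trace ℝ W (T ∘ₗ (LinearMap.toSpanSingleton ℝ W v ∘ₗ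
      (innerₛₗ ℝ v))) = inner ℝ v (T v) := fun v ↦ by
    rw [← LinearMap.comp_assoc, LinearMap.trace_comp_comm']
    rw [LinearMap.trace_eq_sum_inner _ (OrthonormalBasis.singleton Unit ℝ)]
    simp
  let proj : W →ₗ[ℝ] D.𝔞 := LinearMap.codRestrict D.𝔞
    (LinearMap.id - LinearMap.toSpanSingleton ℝ W D.x ∘ₗ (innerₛₗ ℝ D.x)
      - LinearMap.toSpanSingleton ℝ W D.y ∘ₗ (innerₛₗ ℝ D.y))
    (fun z ↦ by simpa [y] using D.decomp z)
  have hproj : ∀ u : D.𝔞, proj u = u := fun u ↦ by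
    ext; simp [proj, D.inner_x_coe, D.inner_y_coe]
  have hid : T = T ∘ₗ (LinearMap.toSpanSingleton ℝ W D.x ∘ₗ (innerₛₗ ℝ D.x))
      + T ∘ₗ (LinearMap.toSpanSingleton ℝ W D.y ∘ₗ (innerₛₗ ℝ D.y))
      + T ∘ₗ (D.𝔞.subtype ∘ₗ proj) := by
    rw [← LinearMap.comp_add, ← LinearMap.comp_add]
    ext z
    simp [proj]
  have hr : proj ∘ₗ (T ∘ₗ D.𝔞.subtype) = T.restrict hT := by
    ext u
    have := hproj ⟨T u, hT u u.2⟩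
    simpa using congrArg Subtype.val this
  conv_lhs => rw [hid, map_add, map_add, rank_one, rank_one, ← LinearMap.comp_assoc,
    LinearMap.trace_comp_comm', hr]

lemma trace_act_x [FiniteDimensional ℝ W] (h : trace ℝ W (L.br D.x) = 0) {α β : ℝ} {w : D.𝔞}
    (hw : L.br D.x D.y = α • D.x + β • D.y + w) : trace ℝ D.𝔞 (D.act D.x) = -β := by
  rw [D.trace_eq _ (D.br_mem _), L.br_self, hw] at h
  simp only [inner_add_right, inner_smul_right, inner_zero_right, D.inner_y_x, D.inner_y_y,
    D.inner_y_coe] at h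
  change _ + trace ℝ D.𝔞 (D.act D.x) = 0 at h
  linarith

lemma trace_act_y [FiniteDimensional ℝ W] (h : trace ℝ W (L.br D.y) = 0) {α β : ℝ} {w : D.𝔞}
    (hw : L.br D.x D.y = α • D.x + β • D.y + w) : trace ℝ D.𝔞 (D.act D.y) = α := by
  rw [D.trace_eq _ (D.br_mem _), L.br_self, L.br_skew D.x, hw] at h
  simp only [inner_add_right, inner_smul_right, inner_zero_right, inner_neg_right, D.inner_x_x,
    D.inner_x_y, D.inner_x_coe] at h
  change _ + trace ℝ D.𝔞 (D.act D.y) = 0 at h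
  linarith

end AdaptedIdeal
end HermitianLieAlgebra
end HermitianLieAlgebras

/-! ### The Levi-Civita connection in the presence of an adapted ideal -/

noncomputable section LeviCivitaAlgebra

open LinearMap (adjoint trace)

variable {W : Type*} [NormedAddCommGroup W] [InnerProductSpace ℝ W] [FiniteDimensional ℝ W]

namespace HermitianLieAlgebra

/-- The connection `n` is torsion-free. -/
def IsTorsionFree (L : HermitianLieAlgebra W) (n : W →ₗ[ℝ] W →ₗ[ℝ] W) : Prop :=
  ∀ a b, n a b - n b a = L.br a b

variable {L : HermitianLieAlgebra W}

omit [FiniteDimensional ℝ W] in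
/-- The Koszul formula. -/
lemma koszul {n : W →ₗ[ℝ] W →ₗ[ℝ] W} (hm : IsMetric n) (ht : L.IsTorsionFree n) (a b z : W) :
    2 * inner ℝ (n a b) z =
      inner ℝ (L.br a b) z - inner ℝ (L.br b z) a + inner ℝ (L.br z a) b := by
  simp only [← ht a b, ← ht b z, ← ht z a, inner_sub_left]
  linarith [hm a b z, hm b a z, hm z a b, hm b z a, hm a z b, real_inner_comm z (n a b),
    real_inner_comm b (n a z), real_inner_comm a (n b z), real_inner_comm z (n b a),
    real_inner_comm b (n z a), real_inner_comm a (n z b)]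

namespace AdaptedIdeal

variable (D : L.AdaptedIdeal)

/-- The symmetric part of the action on the ideal. -/
def sym (t : W) : Module.End ℝ D.𝔞 := (1 / 2 : ℝ) • (D.act t + adjoint (D.act t))

/-- The skew part of the action on the ideal. -/
def skw (t : W) : Module.End ℝ D.𝔞 := (1 / 2 : ℝ) • (D.act t - adjoint (D.act t))

lemma sym_add_skw (t : W) : D.sym t + D.skw t = D.act t := by
  simp only [sym, skw]; module

lemma adjoint_half_smul (T : Module.End ℝ D.𝔞) :
    adjoint ((1 / 2 : ℝ) • T) = (1 / 2 : ℝ) • adjoint T := by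
  have h := map_smulₛₗ (adjoint (𝕜 := ℝ) (E := D.𝔞) (F := D.𝔞)) (1 / 2 : ℝ) T
  rwa [conj_trivial] at h

lemma adjoint_sym (t : W) : adjoint (D.sym t) = D.sym t := by
  rw [sym, adjoint_half_smul, map_add, LinearMap.adjoint_adjoint, add_comm]

lemma adjoint_skw (t : W) : adjoint (D.skw t) = -D.skw t := by
  rw [skw, adjoint_half_smul, map_sub, LinearMap.adjoint_adjoint]
  module

lemma trace_sym (t : W) : trace ℝ D.𝔞 (D.sym t) = trace ℝ D.𝔞 (D.act t) := by
  rw [sym, map_smul, map_add, LinearMap.trace_adjoint_real, smul_eq_mul]; ring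

lemma sym_integrable :
    D.sym D.x + D.J𝔞 * D.sym D.x * D.J𝔞 = D.sym D.y * D.J𝔞 - D.J𝔞 * D.sym D.y ∧
    D.skw D.x + D.J𝔞 * D.skw D.x * D.J𝔞 = D.skw D.y * D.J𝔞 - D.J𝔞 * D.skw D.y := by
  have h1 := D.act_integrable
  have h2 := congrArg adjoint h1
  simp only [map_add, map_sub, LinearMap.adjoint_mul, D.adjoint_J𝔞] at h2
  simp only [neg_mul, mul_neg, neg_neg, sub_neg_eq_add, mul_assoc] at h1 h2
  simp only [sym, skw, mul_smul_comm, smul_mul_assoc, mul_assoc, mul_add, add_mul, mul_sub, sub_mul,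
    smul_add, smul_sub]
  constructor
  · linear_combination (norm := module) (1 / 2 : ℝ) • h1 + (1 / 2 : ℝ) • h2
  · linear_combination (norm := module) (1 / 2 : ℝ) • h1 - (1 / 2 : ℝ) • h2

lemma inner_act_add (t : W) (u v : D.𝔞) :
    inner ℝ (D.act t u) v + inner ℝ (D.act t v) u = 2 * inner ℝ (D.sym t u) v := by
  simp only [sym, LinearMap.smul_apply, LinearMap.add_apply, inner_smul_left, inner_add_left,
    LinearMap.adjoint_inner_left, conj_trivial, real_inner_comm u]
  ring

section Formulas

variable {n : W →ₗ[ℝ] W →ₗ[ℝ] W} (hm : IsMetric n) (ht : L.IsTorsionFree n)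
  {α β : ℝ} {w : D.𝔞} (hw : L.br D.x D.y = α • D.x + β • D.y + w)

include hm ht in
lemma leviCivita_coe_coe (u v : D.𝔞) :
    n u v = inner ℝ (D.sym D.x u) v • D.x + inner ℝ (D.sym D.y u) v • D.y := by
  have ax := D.inner_act_add D.x u v
  have ay := D.inner_act_add D.y u v
  simp only [Submodule.coe_inner, coe_act] at ax ay
  apply D.ext_inner
  · have h := koszul hm ht u v D.x
    simp only [D.br_coe_coe, L.br_skew D.x v, inner_neg_left, inner_zero_left] at h
    simp only [inner_add_left, inner_smul_left, D.inner_x_x, D.inner_y_x, conj_trivial,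
      Submodule.coe_inner]
    linarith
  · have h := koszul hm ht u v D.y
    simp only [D.br_coe_coe, L.br_skew D.y v, inner_neg_left, inner_zero_left] at h
    simp only [inner_add_left, inner_smul_left, D.inner_x_y, D.inner_y_y, conj_trivial,
      Submodule.coe_inner]
    linarith
  · intro v'
    have h := koszul hm ht u v v'
    simp only [D.br_coe_coe, inner_zero_left] at h
    simp only [inner_add_left, inner_smul_left, D.inner_x_coe, D.inner_y_coe]
    linarith

include hm ht hw in
lemma leviCivita_coe_x (u : D.𝔞) :
    n u D.x = -(D.sym D.x u : D.𝔞) - (1 / 2 * inner ℝ w u) • D.y := by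
  apply D.ext_inner
  · have h := hm u D.x D.x
    rw [real_inner_comm] at h
    simp only [inner_sub_left, inner_neg_left, inner_smul_left, D.inner_coe_x, D.inner_y_x]
    linarith [real_inner_comm D.x (n u D.x)]
  · have h := koszul hm ht u D.x D.y
    simp only [hw, D.br_coe_left, L.br_skew (u : W) D.y, inner_neg_left, inner_add_left,
      inner_smul_left, neg_neg, D.inner_coe_x, D.inner_coe_y, D.inner_x_coe, D.inner_y_coe] at h
    simp only [inner_sub_left, inner_neg_left, inner_smul_left, D.inner_coe_y, D.inner_y_y,
      conj_trivial, Submodule.coe_inner]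
    linarith
  · intro v
    have ax := D.inner_act_add D.x u v
    have h := koszul hm ht u D.x v
    simp only [D.br_coe_coe, L.br_skew D.x (u : W), inner_neg_left, inner_zero_left] at h
    simp only [inner_sub_left, inner_neg_left, inner_smul_left, D.inner_y_coe]
    simp only [Submodule.coe_inner, coe_act] at ax
    linarith

include hm ht hw in
lemma leviCivita_coe_y (u : D.𝔞) :
    n u D.y = -(D.sym D.y u : D.𝔞) + (1 / 2 * inner ℝ w u) • D.x := by
  apply D.ext_inner
  · have h := koszul hm ht u D.y D.x
    simp only [hw, L.br_skew D.x D.y, D.br_coe_left, L.br_skew (u : W) D.x, inner_neg_left,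
      inner_add_left, inner_smul_left, neg_neg, D.inner_coe_x, D.inner_coe_y, D.inner_x_coe,
      D.inner_y_coe] at h
    simp only [inner_add_left, inner_neg_left, inner_smul_left, D.inner_coe_x, D.inner_x_x,
      conj_trivial, Submodule.coe_inner]
    linarith
  · have h := hm u D.y D.y
    simp only [inner_add_left, inner_neg_left, inner_smul_left, D.inner_coe_y, D.inner_x_y]
    linarith [real_inner_comm D.y (n u D.y)]
  · intro v
    have ay := D.inner_act_add D.y u v
    have h := koszul hm ht u D.y v
    simp only [D.br_coe_coe, L.br_skew D.y (u : W), inner_neg_left, inner_zero_left] at h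
    simp only [inner_add_left, inner_neg_left, inner_smul_left, D.inner_x_coe]
    simp only [Submodule.coe_inner, coe_act] at ay
    linarith

include hm ht hw in
lemma leviCivita_x_coe (u : D.𝔞) :
    n D.x u = (D.skw D.x u : D.𝔞) - (1 / 2 * inner ℝ w u) • D.y := by
  have h1 := ht D.x u
  have h2 := congrArg (fun T ↦ ((T u : D.𝔞) : W)) (D.sym_add_skw D.x)
  simp only [LinearMap.add_apply, Submodule.coe_add, coe_act] at h2
  rw [D.leviCivita_coe_x hm ht hw, ← h2, sub_eq_iff_eq_add] at h1
  rw [h1]; abel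

include hm ht hw in
lemma leviCivita_y_coe (u : D.𝔞) :
    n D.y u = (D.skw D.y u : D.𝔞) + (1 / 2 * inner ℝ w u) • D.x := by
  have h1 := ht D.y u
  have h2 := congrArg (fun T ↦ ((T u : D.𝔞) : W)) (D.sym_add_skw D.y)
  simp only [LinearMap.add_apply, Submodule.coe_add, coe_act] at h2
  rw [D.leviCivita_coe_y hm ht hw, ← h2, sub_eq_iff_eq_add] at h1
  rw [h1]; abel

omit [FiniteDimensional ℝ W] in
include hm ht hw in
lemma leviCivita_x_x : n D.x D.x = -α • D.y := by
  apply D.ext_inner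
  · have h := hm D.x D.x D.x
    simp only [inner_smul_left, D.inner_y_x]
    linarith [real_inner_comm D.x (n D.x D.x)]
  · have h := koszul hm ht D.x D.x D.y
    simp only [L.br_self, L.br_skew D.x D.y, hw, inner_neg_left, inner_add_left, inner_smul_left,
      D.inner_x_x, D.inner_y_x, D.inner_coe_x, inner_zero_left, conj_trivial] at h
    simp only [inner_smul_left, D.inner_y_y, conj_trivial]
    linarith
  · intro v
    have h := koszul hm ht D.x D.x v
    simp only [L.br_self, D.br_coe_left, inner_neg_left, inner_zero_left] at h
    simp only [← coe_act, D.inner_coe_x] at h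
    simp only [inner_smul_left, D.inner_y_coe]
    linarith

omit [FiniteDimensional ℝ W] in
include hm ht hw in
lemma leviCivita_x_y : n D.x D.y = α • D.x + (1 / 2 : ℝ) • (w : W) := by
  apply D.ext_inner
  · have h := hm D.x D.y D.x
    rw [D.leviCivita_x_x hm ht hw, inner_smul_right, D.inner_y_y] at h
    simp only [inner_add_left, inner_smul_left, D.inner_x_x, D.inner_coe_x, conj_trivial]
    linarith
  · have h := hm D.x D.y D.y
    simp only [inner_add_left, inner_smul_left, D.inner_x_y, D.inner_coe_y]
    linarith [real_inner_comm D.y (n D.x D.y)]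
  · intro v
    have h := koszul hm ht D.x D.y v
    rw [L.br_skew (v : W) D.y, neg_eq_iff_eq_neg.2 (D.br_coe_left v D.y), D.br_coe_left] at h
    simp only [hw, inner_neg_left, inner_add_left, inner_smul_left, D.inner_x_coe, D.inner_y_coe,
      D.inner_coe_x, D.inner_coe_y] at h
    simp only [inner_add_left, inner_smul_left, D.inner_x_coe, conj_trivial]
    linarith

omit [FiniteDimensional ℝ W] in
include hm ht hw in
lemma leviCivita_y_x : n D.y D.x = -β • D.y - (1 / 2 : ℝ) • (w : W) := by
  have h := ht D.x D.y
  rw [hw, D.leviCivita_x_y hm ht hw] at h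
  linear_combination (norm := module) -h

omit [FiniteDimensional ℝ W] in
include hm ht hw in
lemma leviCivita_y_y : n D.y D.y = β • D.x := by
  apply D.ext_inner
  · have h := hm D.y D.y D.x
    rw [D.leviCivita_y_x hm ht hw] at h
    simp only [inner_sub_right, inner_smul_right, D.inner_y_y, D.inner_y_coe] at h
    simp only [inner_smul_left, D.inner_x_x, conj_trivial]
    linarith
  · have h := hm D.y D.y D.y
    simp only [inner_smul_left, D.inner_x_y]
    linarith [real_inner_comm D.y (n D.y D.y)]
  · intro v
    have h := koszul hm ht D.y D.y v
    simp only [L.br_self, D.br_coe_left, inner_neg_left, inner_zero_left] at h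
    simp only [← coe_act, D.inner_coe_y] at h
    simp only [inner_smul_left, D.inner_x_coe]
    linarith

end Formulas

end AdaptedIdeal
end HermitianLieAlgebra
end LeviCivitaAlgebra

/-! ### Rigidity of the Levi-Civita connection on the Lie algebra -/

noncomputable section LeviCivitaTheorem

open LinearMap (adjoint trace)

variable {W : Type*} [NormedAddCommGroup W] [InnerProductSpace ℝ W] [FiniteDimensional ℝ W]

namespace HermitianLieAlgebra

variable {L : HermitianLieAlgebra W}

namespace AdaptedIdeal

variable (D : L.AdaptedIdeal)

lemma act_apply_eq (t : W) (u : D.𝔞) : D.act t u = D.sym t u + D.skw t u := by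
  rw [← D.sym_add_skw]; rfl

section Curvature

variable {n : W →ₗ[ℝ] W →ₗ[ℝ] W} (hm : IsMetric n) (ht : L.IsTorsionFree n)
  {α β : ℝ} {w : D.𝔞} (hw : L.br D.x D.y = α • D.x + β • D.y + w)

include hm ht hw in
lemma leviCivita_curv_x_y :
    inner ℝ (L.curv n D.x D.y D.y) D.x = -(α ^ 2 + β ^ 2) - 3 / 4 * ‖w‖ ^ 2 := by
  simp only [L.inner_curv hm, hw, map_add, map_smul, LinearMap.add_apply, LinearMap.smul_apply,
    D.leviCivita_x_x hm ht hw, D.leviCivita_x_y hm ht hw, D.leviCivita_y_x hm ht hw,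
    D.leviCivita_y_y hm ht hw, D.leviCivita_coe_y hm ht hw]
  simp only [inner_add_left, inner_sub_right, inner_neg_left,
    inner_smul_left, inner_smul_right, D.inner_x_x, D.inner_x_y,
    D.inner_x_coe, D.inner_coe_x, D.inner_coe_y, conj_trivial, ← Submodule.coe_inner,
    real_inner_self_eq_norm_sq]
  ring

include hm ht in
lemma leviCivita_curv_coe (u : D.𝔞) :
    inner ℝ (L.curv n u (D.J𝔞 u) (D.J𝔞 u)) (u : W) =
      inner ℝ (D.sym D.x u) (D.J𝔞 u) ^ 2
        - inner ℝ (D.sym D.x u) u * inner ℝ (D.sym D.x (D.J𝔞 u)) (D.J𝔞 u)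
      + (inner ℝ (D.sym D.y u) (D.J𝔞 u) ^ 2
        - inner ℝ (D.sym D.y u) u * inner ℝ (D.sym D.y (D.J𝔞 u)) (D.J𝔞 u)) := by
  have e : ∀ (t : W) (a b : D.𝔞), inner ℝ (D.sym t a) b = inner ℝ (D.sym t b) a := fun t a b ↦ by
    rw [← LinearMap.adjoint_inner_right, adjoint_sym, real_inner_comm]
  simp only [L.inner_curv hm, D.br_coe_coe, map_zero, LinearMap.zero_apply,
    D.leviCivita_coe_coe hm ht]
  simp only [inner_add_left, inner_add_right,
    inner_smul_left, inner_smul_right, D.inner_x_x, D.inner_y_x, D.inner_x_y, D.inner_y_y,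
    conj_trivial, inner_zero_left]
  rw [e D.x (D.J𝔞 u) u, e D.y (D.J𝔞 u) u]
  ring

include hm ht hw in
lemma leviCivita_curv_mixed {c : ℝ} (hc : L.HasConstHSC n c) (u : D.𝔞) :
    (-inner ℝ (D.skw D.y (D.J𝔞 u)) (D.skw D.x u) + inner ℝ (D.skw D.x (D.J𝔞 u)) (D.skw D.y u)
        - α * inner ℝ (D.skw D.x (D.J𝔞 u)) u - β * inner ℝ (D.skw D.y (D.J𝔞 u)) u)
      + (-inner ℝ (D.sym D.y (D.J𝔞 u)) (D.sym D.x u) + inner ℝ (D.sym D.y u) (D.sym D.x (D.J𝔞 u)))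
      + (α * inner ℝ (D.sym D.y (D.J𝔞 u)) (D.J𝔞 u)
        - inner ℝ (D.skw D.x (D.J𝔞 u)) (D.sym D.x (D.J𝔞 u)) + 1 / 4 * inner ℝ w (D.J𝔞 u) ^ 2
        - inner ℝ (D.sym D.x (D.sym D.x (D.J𝔞 u) + D.skw D.x (D.J𝔞 u))) (D.J𝔞 u))
      + (-β * inner ℝ (D.sym D.x u) u - inner ℝ (D.sym D.y u) (D.skw D.y u)
        + 1 / 4 * inner ℝ w u ^ 2 - inner ℝ (D.sym D.y (D.sym D.y u + D.skw D.y u)) u)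
      + (inner ℝ (D.sym D.y (D.J𝔞 u)) (D.skw D.x u) + α * inner ℝ (D.sym D.x (D.J𝔞 u)) u
        + inner ℝ (D.sym D.y (D.sym D.x (D.J𝔞 u) + D.skw D.x (D.J𝔞 u))) u)
      + (inner ℝ (D.skw D.y (D.J𝔞 u)) (D.sym D.x u) - β * inner ℝ (D.sym D.y u) (D.J𝔞 u)
        + inner ℝ (D.sym D.x (D.sym D.y u + D.skw D.y u)) (D.J𝔞 u))
      = 2 * c * ‖u‖ ^ 2 := by
  have e : ∀ (t : W) (a b : D.𝔞), inner ℝ (D.sym t a) b = inner ℝ (D.sym t b) a := fun t a b ↦ by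
    rw [← LinearMap.adjoint_inner_right, adjoint_sym, real_inner_comm]
  have h := hc.polarize D.x u D.norm_x (D.inner_x_coe u)
  change inner ℝ (L.curv n D.x D.y (D.J𝔞 u)) (u : W) + inner ℝ (L.curv n u (D.J𝔞 u) D.y) D.x
      + inner ℝ (L.curv n D.x (D.J𝔞 u) (D.J𝔞 u)) D.x + inner ℝ (L.curv n u D.y D.y) (u : W)
      + inner ℝ (L.curv n D.x (D.J𝔞 u) D.y) (u : W) + inner ℝ (L.curv n u D.y (D.J𝔞 u)) D.x
    = _ at h
  rw [← act_apply_eq, ← act_apply_eq]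
  simp only [L.inner_curv hm, hw, D.br_coe_coe, D.br_coe_left, ← D.coe_act D.x, map_add, map_smul,
    map_neg, map_zero, LinearMap.zero_apply, LinearMap.neg_apply,
    LinearMap.add_apply, LinearMap.smul_apply,
    D.leviCivita_x_x hm ht hw, D.leviCivita_x_y hm ht hw, D.leviCivita_y_x hm ht hw,
    D.leviCivita_y_y hm ht hw, D.leviCivita_coe_y hm ht hw, D.leviCivita_coe_x hm ht hw,
    D.leviCivita_x_coe hm ht hw, D.leviCivita_y_coe hm ht hw, D.leviCivita_coe_coe hm ht] at h
  simp only [inner_add_left, inner_add_right, inner_sub_left, inner_sub_right, inner_neg_left,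
    inner_neg_right, inner_smul_left, inner_smul_right, D.inner_x_x, D.inner_y_x, D.inner_x_y,
    D.inner_y_y, D.inner_x_coe, D.inner_coe_x, D.inner_y_coe, D.inner_coe_y, conj_trivial,
    inner_zero_left, ← Submodule.coe_inner] at h
  rw [e D.x (D.J𝔞 u) u] at h ⊢
  rw [e D.y (D.J𝔞 u) u] at h
  rw [show ‖u‖ = ‖(u : W)‖ from rfl]
  linear_combination h

end Curvature

include D in
/-- A left-invariant Levi-Civita connection of constant holomorphic sectional curvature on a
unimodular Lie algebra with an adapted abelian ideal is flat and parallelises the complex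
structure. -/
theorem leviCivita_rigidity (huni : ∀ a, trace ℝ W (L.br a) = 0) {n : W →ₗ[ℝ] W →ₗ[ℝ] W}
    (hm : IsMetric n) (ht : L.IsTorsionFree n) {c : ℝ} (hc : L.HasConstHSC n c) :
    c = 0 ∧ (∀ a b z, L.curv n a b z = 0) ∧ ∀ a b, n a (L.J b) = L.J (n a b) := by
  obtain ⟨α, β, w, hw⟩ := D.exists_decomp (L.br D.x D.y)
  have hjac := D.act_jacobi hw
  simp only [← D.sym_add_skw] at hjac
  have htx : trace ℝ D.𝔞 (D.sym D.x) = -β := by rw [D.trace_sym, D.trace_act_x (huni _) hw]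
  have hty : trace ℝ D.𝔞 (D.sym D.y) = α := by rw [D.trace_sym, D.trace_act_y (huni _) hw]
  have hcxy : c = -(α ^ 2 + β ^ 2) - 3 / 4 * ‖w‖ ^ 2 := by
    rw [← D.leviCivita_curv_x_y hm ht hw, y, hc D.x, D.norm_x]; ring
  have hquad : ∀ u : D.𝔞, inner ℝ (D.sym D.x u) (D.J𝔞 u) ^ 2
        - inner ℝ (D.sym D.x u) u * inner ℝ (D.sym D.x (D.J𝔞 u)) (D.J𝔞 u)
      + (inner ℝ (D.sym D.y u) (D.J𝔞 u) ^ 2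
        - inner ℝ (D.sym D.y u) u * inner ℝ (D.sym D.y (D.J𝔞 u)) (D.J𝔞 u)) = c * ‖u‖ ^ 4 :=
    fun u ↦ by rw [← D.leviCivita_curv_coe hm ht]; exact hc u
  obtain ⟨rfl, rfl, rfl, rfl, hSx, hSy, hKx, hKy⟩ := leviCivita_vanishing D.J𝔞_sq D.adjoint_J𝔞
    (D.adjoint_sym _) (D.adjoint_sym _) (D.adjoint_skw _) (D.adjoint_skw _) w hjac
    D.sym_integrable.1 D.sym_integrable.2 htx hty hcxy hquad
    (leviCivita_trace_identity D.J𝔞_sq D.adjoint_J𝔞 (D.adjoint_sym _) (D.adjoint_sym _)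
      (D.adjoint_skw _) (D.adjoint_skw _) w hjac htx hty (D.leviCivita_curv_mixed hm ht hw hc))
  have xx : n D.x D.x = 0 := by simp [D.leviCivita_x_x hm ht hw]
  have xy : n D.x D.y = 0 := by simp [D.leviCivita_x_y hm ht hw]
  have yx : n D.y D.x = 0 := by simp [D.leviCivita_y_x hm ht hw]
  have yy : n D.y D.y = 0 := by simp [D.leviCivita_y_y hm ht hw]
  have ux : ∀ u : D.𝔞, n u D.x = 0 := fun u ↦ by simp [D.leviCivita_coe_x hm ht hw, hSx]
  have uy : ∀ u : D.𝔞, n u D.y = 0 := fun u ↦ by simp [D.leviCivita_coe_y hm ht hw, hSy]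
  have uv : ∀ u v : D.𝔞, n u v = 0 := fun u v ↦ by simp [D.leviCivita_coe_coe hm ht, hSx, hSy]
  have xu : ∀ u : D.𝔞, n D.x u = (D.skw D.x u : D.𝔞) := fun u ↦ by
    simp [D.leviCivita_x_coe hm ht hw]
  have yu : ∀ u : D.𝔞, n D.y u = (D.skw D.y u : D.𝔞) := fun u ↦ by
    simp [D.leviCivita_y_coe hm ht hw]
  have bxy : L.br D.x D.y = 0 := by simp [hw]
  have byx : L.br D.y D.x = 0 := by rw [L.br_skew, bxy, neg_zero]
  have hcomm : ∀ u : D.𝔞, D.skw D.x (D.skw D.y u) = D.skw D.y (D.skw D.x u) := fun u ↦ by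
    have h := congrArg (fun T ↦ T u) hjac
    simpa [hSx, hSy, sub_eq_zero] using h
  refine ⟨rfl, fun a b z ↦ ?_, fun a b ↦ ?_⟩
  · obtain ⟨a₁, a₂, a₃, rfl⟩ := D.exists_decomp a
    obtain ⟨b₁, b₂, b₃, rfl⟩ := D.exists_decomp b
    obtain ⟨z₁, z₂, z₃, rfl⟩ := D.exists_decomp z
    simp only [curv, map_add, map_smul, LinearMap.add_apply, LinearMap.smul_apply, xx, xy, yx, yy, ux,
      uy, uv, xu, yu, bxy, byx, L.br_self, D.br_coe_coe, D.br_coe_left, ← D.coe_act, map_neg,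
      map_zero, LinearMap.zero_apply, LinearMap.neg_apply, hcomm]
    module
  · obtain ⟨a₁, a₂, a₃, rfl⟩ := D.exists_decomp a
    obtain ⟨b₁, b₂, b₃, rfl⟩ := D.exists_decomp b
    have e1 : ∀ u, D.skw D.x (D.J𝔞 u) = D.J𝔞 (D.skw D.x u) := fun u ↦ congrArg (fun T ↦ T u) hKx
    have e2 : ∀ u, D.skw D.y (D.J𝔞 u) = D.J𝔞 (D.skw D.y u) := fun u ↦ congrArg (fun T ↦ T u) hKy
    have e3 : L.J D.x = D.y := rfl
    simp only [map_add, map_smul, LinearMap.add_apply, LinearMap.smul_apply, e3, D.J_y, ← D.coe_J𝔞,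
      map_neg, xx, xy, yx, yy, ux, uy, uv, xu, yu, e1, e2, map_zero]
    module

end AdaptedIdeal
end HermitianLieAlgebra
end LeviCivitaTheorem

/-! ### The Chern connection in the presence of an adapted ideal -/

noncomputable section ChernAlgebra

variable {W : Type*} [NormedAddCommGroup W] [InnerProductSpace ℝ W]

namespace HermitianLieAlgebra

/-- The connection `n` parallelises the complex structure. -/
def IsComplex (L : HermitianLieAlgebra W) (n : W →ₗ[ℝ] W →ₗ[ℝ] W) : Prop :=
  ∀ a b, n a (L.J b) = L.J (n a b)

/-- The torsion `T` of the connection `n` has no component of type `(1, 1)`: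
`T(Ja, b) = T(a, Jb)`. -/
def IsChernTorsion (L : HermitianLieAlgebra W) (n : W →ₗ[ℝ] W →ₗ[ℝ] W) : Prop :=
  ∀ a b, n (L.J a) b - n b (L.J a) - L.br (L.J a) b = n a (L.J b) - n (L.J b) a - L.br a (L.J b)

variable {L : HermitianLieAlgebra W}

/-- The `(0, 1)`-part of the Chern connection is determined by the bracket. -/
lemma two_smul_chern_zero_one {n : W →ₗ[ℝ] W →ₗ[ℝ] W} (hJ : L.IsComplex n)
    (ht : L.IsChernTorsion n) (a b : W) :
    (2 : ℝ) • (n (L.J a) b - L.J (n a b)) =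
      L.br (L.J a) b - L.br a (L.J b) - L.J (L.br (L.J a) (L.J b) + L.br a b) := by
  have h1 := ht a b
  have h2 := congrArg L.J (ht a (L.J b))
  simp only [hJ _ _, L.J_sq, map_neg, map_sub, LinearMap.neg_apply] at h1 h2
  rw [map_add]
  linear_combination (norm := module) h1 - h2

namespace AdaptedIdeal

variable (D : L.AdaptedIdeal)

/-- The operator of the ideal which turns out to be `u ↦ ∇_{Ju} x - J ∇_u x` for the Chern
connection `∇`, see `chern_zero_one_coe_x`. -/
def chernσ : Module.End ℝ D.𝔞 := D.act D.y + D.J𝔞 * D.act D.y * D.J𝔞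

/-- The operator of the ideal which turns out to be `u ↦ ∇_y u - J ∇_x u` for the Chern
connection `∇`, see `chern_zero_one_x_coe`. -/
def chernF : Module.End ℝ D.𝔞 := (1 / 2 : ℝ) •
  (D.act D.y - D.act D.x * D.J𝔞 - D.J𝔞 * D.act D.y * D.J𝔞 - D.J𝔞 * D.act D.x)

lemma chernσ_eq : D.chernσ = D.J𝔞 * D.act D.x - D.act D.x * D.J𝔞 := by
  have h := integrability_swap D.J𝔞_sq D.act_integrable
  exact h

lemma J𝔞_J𝔞 (u : D.𝔞) : D.J𝔞 (D.J𝔞 u) = -u := by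
  have := congrArg (fun T ↦ T u) D.J𝔞_sq
  simpa using this

lemma inner_J𝔞_J𝔞 (u v : D.𝔞) : inner ℝ (D.J𝔞 u) (D.J𝔞 v) = inner ℝ u v := L.inner_J_J _ _

lemma inner_J𝔞_left (u v : D.𝔞) : inner ℝ (D.J𝔞 u) v = -inner ℝ u (D.J𝔞 v) := L.inner_J_left _ _

lemma chernσ_J𝔞 (u : D.𝔞) : D.chernσ (D.J𝔞 u) = -D.J𝔞 (D.chernσ u) := by
  simp [chernσ, D.J𝔞_J𝔞, map_add]

lemma chernF_mul_J𝔞 : D.chernF * D.J𝔞 = D.J𝔞 * D.chernF := by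
  ext1 u
  simp only [chernF, LinearMap.smul_apply, Module.End.mul_apply, LinearMap.sub_apply, map_smul,
    map_sub, J𝔞_J𝔞, map_neg]
  module

lemma chernF_J𝔞 (u : D.𝔞) : D.chernF (D.J𝔞 u) = D.J𝔞 (D.chernF u) :=
  congrArg (fun T ↦ T u) D.chernF_mul_J𝔞

section Formulas

variable {n : W →ₗ[ℝ] W →ₗ[ℝ] W} (hm : IsMetric n) (hJ : L.IsComplex n) (ht : L.IsChernTorsion n)
  {α β : ℝ} {w : D.𝔞} (hw : L.br D.x D.y = α • D.x + β • D.y + w)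

include hJ ht hw in
lemma chern_zero_one_x_x : n D.y D.x - L.J (n D.x D.x) = -(α • D.x + β • D.y + w) := by
  have h := two_smul_chern_zero_one hJ ht D.x D.x
  change (2 : ℝ) • (n D.y D.x - _) = L.br D.y D.x - L.br D.x D.y - L.J (L.br D.y D.y + _) at h
  rw [L.br_self, L.br_self, add_zero, map_zero, L.br_skew D.x D.y, hw] at h
  linear_combination (norm := module) (1 / 2 : ℝ) • h

include hJ ht in
lemma chern_zero_one_x_coe (u : D.𝔞) : n D.y u - L.J (n D.x u) = (D.chernF u : D.𝔞) := by
  have h := two_smul_chern_zero_one hJ ht D.x u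
  change (2 : ℝ) • (n D.y u - _) = L.br D.y u - L.br D.x (L.J u) -
    L.J (L.br D.y (L.J u) + L.br D.x u) at h
  rw [map_add] at h
  simp only [chernF, LinearMap.smul_apply, LinearMap.sub_apply, Module.End.mul_apply,
    Submodule.coe_smul, Submodule.coe_sub, coe_act, coe_J𝔞]
  linear_combination (norm := module) (1 / 2 : ℝ) • h

include hJ ht in
lemma chern_zero_one_coe_x (u : D.𝔞) :
    n (D.J𝔞 u) D.x - L.J (n u D.x) = (D.chernσ u : D.𝔞) := by
  have h := two_smul_chern_zero_one hJ ht u D.x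
  change (2 : ℝ) • (n (D.J𝔞 u) D.x - _) = L.br (D.J𝔞 u) D.x - L.br u D.y -
    L.J (L.br (D.J𝔞 u) D.y + L.br u D.x) at h
  rw [map_add] at h
  have e1 := congrArg (fun T ↦ ((T u : D.𝔞) : W)) D.chernσ_eq
  have e2 : ((D.chernσ u : D.𝔞) : W) = L.br D.y u + L.J (L.br D.y (L.J u)) := rfl
  simp only [LinearMap.sub_apply, Module.End.mul_apply, Submodule.coe_sub, coe_J𝔞, coe_act] at e1
  simp only [D.br_coe_left] at h
  simp only [coe_act, coe_J𝔞, map_neg] at h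
  rw [D.coe_J𝔞]
  linear_combination (norm := module) (1 / 2 : ℝ) • h - (1 / 2 : ℝ) • e1 - (1 / 2 : ℝ) • e2

include hJ ht in
lemma chern_zero_one_coe_coe (u v : D.𝔞) : n (D.J𝔞 u) v = L.J (n u v) := by
  have h := two_smul_chern_zero_one hJ ht u v
  rw [← D.coe_J𝔞, ← D.coe_J𝔞 v, D.br_coe_coe, D.br_coe_coe, D.br_coe_coe, D.br_coe_coe] at h
  simp only [sub_self, add_zero, map_zero] at h
  linear_combination (norm := module) (1 / 2 : ℝ) • h

include hm in
lemma inner_conn_self (a b : W) : inner ℝ (n a b) b = 0 := by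
  linarith [hm a b b, real_inner_comm b (n a b)]

include hm hJ ht hw in
lemma chern_x_x : n D.x D.x = -α • D.y - (1 / 2 : ℝ) • (D.J𝔞 w : D.𝔞) := by
  have h := D.chern_zero_one_x_x hJ ht hw
  apply D.ext_inner
  · simp only [inner_sub_left, inner_smul_left, D.inner_y_x, D.inner_coe_x]
    rw [inner_conn_self hm]; simp
  · have h1 := congrArg (fun z ↦ inner ℝ z D.x) h
    simp only [inner_sub_left, inner_neg_left, inner_add_left, inner_smul_left, D.inner_x_x,
      D.inner_y_x, D.inner_coe_x, inner_conn_self hm, L.inner_J_left, conj_trivial] at h1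
    change 0 - -inner ℝ (n D.x D.x) D.y = _ at h1
    simp only [inner_sub_left, inner_smul_left, D.inner_y_y, D.inner_coe_y, conj_trivial]
    linarith
  · intro v
    have h1 := congrArg (fun z ↦ inner ℝ z (L.J v)) h
    have h2 := congrArg (fun z ↦ inner ℝ z D.x) (D.chern_zero_one_x_coe hJ ht (D.J𝔞 v))
    simp only [inner_sub_left, inner_neg_left, inner_add_left, inner_smul_left, L.inner_J_J] at h1
    rw [← D.coe_J𝔞, D.inner_x_coe, D.inner_y_coe] at h1
    simp only [D.coe_J𝔞, hJ _ _, L.J_sq, inner_sub_left, inner_neg_left, D.inner_coe_x] at h2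
    have h3 := hm D.y (L.J v) D.x
    have h4 := hm D.x v D.x
    have h5 := L.inner_J_left w v
    rw [hJ] at h3
    simp only [inner_sub_left, inner_smul_left, D.inner_y_coe, D.coe_J𝔞, conj_trivial] at h1 ⊢
    linarith [real_inner_comm (L.J v) (n D.y D.x), real_inner_comm (v : W) (n D.x D.x)]

include hm hJ ht hw in
lemma chern_y_x : n D.y D.x = -β • D.y - (1 / 2 : ℝ) • (w : W) := by
  have h := D.chern_zero_one_x_x hJ ht hw
  rw [D.chern_x_x hm hJ ht hw] at h
  simp only [map_sub, map_smul, D.J_y, D.coe_J𝔞, L.J_sq] at h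
  linear_combination (norm := module) h

include hm hJ ht hw in
lemma chern_x_y : n D.x D.y = α • D.x + (1 / 2 : ℝ) • (w : W) := by
  rw [y, hJ, D.chern_x_x hm hJ ht hw]
  simp only [map_sub, map_smul, D.J_y, D.coe_J𝔞, L.J_sq]
  module

include hm hJ ht hw in
lemma chern_y_y : n D.y D.y = β • D.x - (1 / 2 : ℝ) • (D.J𝔞 w : D.𝔞) := by
  conv_lhs => enter [2]; rw [y]
  rw [hJ, D.chern_y_x hm hJ ht hw]
  simp only [map_sub, map_smul, D.J_y, D.coe_J𝔞]
  module

include hm hJ ht in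
lemma chern_coe_x (u : D.𝔞) : n u D.x = (1 / 2 : ℝ) • (D.J𝔞 (D.chernσ u) : D.𝔞) := by
  have h := D.chern_zero_one_coe_x hJ ht u
  apply D.ext_inner
  · rw [inner_conn_self hm, inner_smul_left, D.inner_coe_x, mul_zero]
  · have h1 := congrArg (fun z ↦ inner ℝ z D.x) h
    simp only [inner_sub_left, D.inner_coe_x, inner_conn_self hm, L.inner_J_left] at h1
    change 0 - -inner ℝ (n u D.x) D.y = _ at h1
    rw [inner_smul_left, D.inner_coe_y]
    linarith
  · intro v
    have h1 := congrArg (fun z ↦ inner ℝ z (L.J v)) h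
    have h2 := congrArg (fun z ↦ inner ℝ z D.x) (D.chern_zero_one_coe_coe hJ ht u (D.J𝔞 v))
    simp only [inner_sub_left, L.inner_J_J] at h1
    simp only [D.coe_J𝔞, hJ _ _, L.J_sq, inner_neg_left] at h2
    have h3 := hm (L.J u) (L.J v) D.x
    have h4 := hm u v D.x
    have h5 := L.inner_J_left (D.chernσ u) v
    rw [hJ] at h3
    simp only [inner_smul_left, D.coe_J𝔞, conj_trivial] at h1 ⊢
    linarith [real_inner_comm (L.J v) (n (L.J u) D.x), real_inner_comm (v : W) (n u D.x)]

include hm hJ ht in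
lemma chern_coe_y (u : D.𝔞) : n u D.y = -((1 / 2 : ℝ) • (D.chernσ u : W)) := by
  rw [y, hJ, D.chern_coe_x hm hJ ht, map_smul, D.coe_J𝔞, L.J_sq, smul_neg]

include hm hJ ht in
lemma chern_coe_coe (u v : D.𝔞) :
    n u v = -(1 / 2 * inner ℝ v (D.J𝔞 (D.chernσ u))) • D.x
      + (1 / 2 * inner ℝ v (D.chernσ u)) • D.y := by
  apply D.ext_inner
  · have h := hm u v D.x
    rw [D.chern_coe_x hm hJ ht, inner_smul_right] at h
    simp only [inner_add_left, inner_smul_left, D.inner_x_x, D.inner_y_x, conj_trivial,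
      Submodule.coe_inner]
    linarith
  · have h := hm u v D.y
    rw [D.chern_coe_y hm hJ ht, inner_neg_right, inner_smul_right] at h
    simp only [inner_add_left, inner_smul_left, D.inner_x_y, D.inner_y_y, conj_trivial,
      Submodule.coe_inner]
    linarith
  · intro v'
    simp only [inner_add_left, inner_smul_left, D.inner_x_coe, D.inner_y_coe, mul_zero, add_zero]
    have key : ∀ u : D.𝔞, inner ℝ (n (D.J𝔞 u) v) (v' : W) = 0 := fun u ↦ by
      have h1 := hm u v (L.J v')
      rw [hJ, ← D.chern_zero_one_coe_coe hJ ht] at h1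
      have h2 := hm (D.J𝔞 u) v v'
      have h3 := D.chern_zero_one_coe_coe hJ ht u v
      have h4 := L.inner_J_left (n u v) v'
      rw [← h3] at h4
      linarith
    have h := key (-D.J𝔞 u)
    rwa [map_neg, D.J𝔞_J𝔞, neg_neg] at h

end Formulas

end AdaptedIdeal
end HermitianLieAlgebra
end ChernAlgebra

/-! ### Rigidity of the Chern connection on the Lie algebra -/

noncomputable section ChernTheorem

open LinearMap (adjoint trace)

variable {W : Type*} [NormedAddCommGroup W] [InnerProductSpace ℝ W] [FiniteDimensional ℝ W]

namespace HermitianLieAlgebra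

variable {L : HermitianLieAlgebra W}

namespace AdaptedIdeal

variable (D : L.AdaptedIdeal)

section Curvature

variable {n : W →ₗ[ℝ] W →ₗ[ℝ] W} (hm : IsMetric n) (hJ : L.IsComplex n) (ht : L.IsChernTorsion n)

omit [FiniteDimensional ℝ W] in
include hm hJ ht in
lemma chern_curv_x_y {α β : ℝ} {w : D.𝔞} (hw : L.br D.x D.y = α • D.x + β • D.y + w) :
    inner ℝ (L.curv n D.x D.y D.y) D.x = -(α ^ 2 + β ^ 2) - 1 / 2 * ‖w‖ ^ 2 := by
  simp only [L.inner_curv hm, hw, map_add, map_smul, LinearMap.add_apply, LinearMap.smul_apply,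
    D.chern_x_x hm hJ ht hw, D.chern_x_y hm hJ ht hw, D.chern_y_x hm hJ ht hw,
    D.chern_y_y hm hJ ht hw, D.chern_coe_y hm hJ ht]
  simp only [inner_add_left, inner_sub_left, inner_sub_right, inner_neg_left,
    inner_smul_left, inner_smul_right, D.inner_x_x, D.inner_x_y,
    D.inner_x_coe, D.inner_coe_x, D.inner_coe_y, conj_trivial, ← Submodule.coe_inner,
    D.inner_J𝔞_J𝔞, real_inner_self_eq_norm_sq]
  ring

omit [FiniteDimensional ℝ W] in
include hm hJ ht in
lemma chern_curv_coe (u : D.𝔞) :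
    inner ℝ (L.curv n u (D.J𝔞 u) (D.J𝔞 u)) (u : W) =
      1 / 2 * (inner ℝ u (D.J𝔞 (D.chernσ u)) ^ 2 + inner ℝ u (D.chernσ u) ^ 2) := by
  simp only [L.inner_curv hm, D.br_coe_coe, map_zero, LinearMap.zero_apply,
    D.chern_coe_coe hm hJ ht, D.chernσ_J𝔞, map_neg, D.J𝔞_J𝔞]
  simp only [inner_add_left, inner_add_right, inner_neg_right,
    inner_smul_left, inner_smul_right, D.inner_x_x, D.inner_y_x, D.inner_x_y, D.inner_y_y,
    conj_trivial, inner_zero_left, D.inner_J𝔞_J𝔞, D.inner_J𝔞_left]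
  simp only [map_neg, neg_neg, D.J𝔞_J𝔞]
  ring

include hm hJ ht in
lemma chern_x_coe (hw : L.br D.x D.y = 0) (u : D.𝔞) :
    n D.x u = (1 / 2 : ℝ) • (D.J𝔞 (D.chernF u + adjoint D.chernF u) : W) := by
  have hw' : L.br D.x D.y = (0 : ℝ) • D.x + (0 : ℝ) • D.y + (0 : D.𝔞) := by simp [hw]
  have xx : n D.x D.x = 0 := by simp [D.chern_x_x hm hJ ht hw']
  have xy : n D.x D.y = 0 := by simp [D.chern_x_y hm hJ ht hw']
  apply D.ext_inner
  · have h := hm D.x u D.x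
    rw [xx, inner_zero_right] at h
    rw [inner_smul_left, D.inner_coe_x]
    linarith
  · have h := hm D.x u D.y
    rw [xy, inner_zero_right] at h
    rw [inner_smul_left, D.inner_coe_y]
    linarith
  · intro v
    have key : ∀ v : D.𝔞, 2 * inner ℝ (L.J (n D.x u)) (v : W) =
        -inner ℝ (D.chernF u + adjoint D.chernF u) v := fun v ↦ by
      have h1 := congrArg (fun z ↦ inner ℝ z (v : W)) (D.chern_zero_one_x_coe hJ ht u)
      have h2 := congrArg (fun z ↦ inner ℝ z (u : W)) (D.chern_zero_one_x_coe hJ ht v)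
      simp only [inner_sub_left] at h1 h2
      have h3 := hm D.y u v
      have h4 := hm D.x (L.J v) u
      rw [hJ] at h4
      have h5 := L.inner_J_left (n D.x u) v
      rw [inner_add_left, LinearMap.adjoint_inner_left, Submodule.coe_inner, Submodule.coe_inner]
      linarith [real_inner_comm (L.J v) (n D.x u), real_inner_comm (u : W) (n D.y v),
        real_inner_comm (u : W) (D.chernF v : D.𝔞)]
    have h := key (D.J𝔞 v)
    rw [D.coe_J𝔞, L.inner_J_J] at h
    have h2 := D.inner_J𝔞_left (D.chernF u + adjoint D.chernF u) v
    rw [inner_smul_left, conj_trivial, ← Submodule.coe_inner, h2]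
    linarith

include hm hJ ht in
lemma chern_y_coe (hw : L.br D.x D.y = 0) (u : D.𝔞) :
    n D.y u = (1 / 2 : ℝ) • ((D.chernF u - adjoint D.chernF u : D.𝔞) : W) := by
  have h := D.chern_zero_one_x_coe hJ ht u
  rw [D.chern_x_coe hm hJ ht hw, map_smul, D.coe_J𝔞, L.J_sq, Submodule.coe_add] at h
  rw [Submodule.coe_sub]
  linear_combination (norm := module) h

lemma adjoint_chernF_J𝔞 (u : D.𝔞) :
    adjoint D.chernF (D.J𝔞 u) = D.J𝔞 (adjoint D.chernF u) := by
  have h := congrArg adjoint D.chernF_mul_J𝔞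
  simp only [LinearMap.adjoint_mul, D.adjoint_J𝔞] at h
  have h1 := congrArg (fun T ↦ T u) h
  simpa using h1.symm

include hm hJ ht in
lemma chern_curv_mixed (hw : L.br D.x D.y = 0) (hc : L.HasConstHSC n 0) (u : D.𝔞) :
    -(1 / 2) * (inner ℝ (D.chernF u) (D.chernF u)
        - inner ℝ (adjoint D.chernF u) (adjoint D.chernF u))
      - 1 / 2 * inner ℝ (D.chernσ u) (D.chernσ u) - inner ℝ (D.chernF u) (D.chernσ u)
      + inner ℝ (D.chernσ (D.act D.x (D.J𝔞 u))) u - inner ℝ (D.chernσ (D.act D.y u)) u = 0 := by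
  have hw' : L.br D.x D.y = (0 : ℝ) • D.x + (0 : ℝ) • D.y + (0 : D.𝔞) := by simp [hw]
  have xx : n D.x D.x = 0 := by simp [D.chern_x_x hm hJ ht hw']
  have xy : n D.x D.y = 0 := by simp [D.chern_x_y hm hJ ht hw']
  have yx : n D.y D.x = 0 := by simp [D.chern_y_x hm hJ ht hw']
  have yy : n D.y D.y = 0 := by simp [D.chern_y_y hm hJ ht hw']
  have h := hc.polarize D.x u D.norm_x (D.inner_x_coe u)
  change inner ℝ (L.curv n D.x D.y (D.J𝔞 u)) (u : W) + inner ℝ (L.curv n u (D.J𝔞 u) D.y) D.x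
      + inner ℝ (L.curv n D.x (D.J𝔞 u) (D.J𝔞 u)) D.x + inner ℝ (L.curv n u D.y D.y) (u : W)
      + inner ℝ (L.curv n D.x (D.J𝔞 u) D.y) (u : W) + inner ℝ (L.curv n u D.y (D.J𝔞 u)) D.x
    = _ at h
  simp only [L.inner_curv hm, hw, D.br_coe_coe, D.br_coe_left, ← D.coe_act D.x,
    map_neg, map_zero, LinearMap.zero_apply, LinearMap.neg_apply,
    xx, xy, yx, yy, D.chern_coe_y hm hJ ht, D.chern_coe_x hm hJ ht,
    D.chern_x_coe hm hJ ht hw, D.chern_y_coe hm hJ ht hw, D.chern_coe_coe hm hJ ht,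
    D.chernF_J𝔞, D.adjoint_chernF_J𝔞, D.chernσ_J𝔞, ← map_add, ← map_sub, D.J𝔞_J𝔞] at h
  simp only [Submodule.coe_neg, inner_add_left, inner_add_right, inner_neg_left,
    inner_neg_right, inner_smul_left, inner_smul_right, D.inner_x_x, D.inner_y_x, conj_trivial,
    inner_zero_left, inner_zero_right, ← Submodule.coe_inner, D.inner_J𝔞_J𝔞] at h
  simp only [inner_sub_left, inner_sub_right] at h
  linear_combination h + 1 / 2 * real_inner_comm (D.chernF u) (D.chernσ u)
    + 1 / 2 * real_inner_comm u (D.chernσ (D.act D.x (D.J𝔞 u)))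
    - 1 / 2 * real_inner_comm u (D.chernσ (D.act D.y u))

end Curvature

include D in
/-- A left-invariant Chern connection of constant holomorphic sectional curvature on a
unimodular Lie algebra with an adapted abelian ideal is flat. -/
theorem chern_rigidity (huni : ∀ a, trace ℝ W (L.br a) = 0) {n : W →ₗ[ℝ] W →ₗ[ℝ] W}
    (hm : IsMetric n) (hJ : L.IsComplex n) (ht : L.IsChernTorsion n) {c : ℝ}
    (hc : L.HasConstHSC n c) :
    c = 0 ∧ ∀ a b z, L.curv n a b z = 0 := by
  obtain ⟨α, β, w, hw⟩ := D.exists_decomp (L.br D.x D.y)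
  have htx := D.trace_act_x (huni _) hw
  have hty := D.trace_act_y (huni _) hw
  have hcxy : c = -(α ^ 2 + β ^ 2) - 1 / 2 * ‖w‖ ^ 2 := by
    rw [← D.chern_curv_x_y hm hJ ht hw, y, hc D.x, D.norm_x]; ring
  have hquad : ∀ u : D.𝔞, 1 / 2 * (inner ℝ u (D.J𝔞 (D.chernσ u)) ^ 2
      + inner ℝ u (D.chernσ u) ^ 2) = c * ‖u‖ ^ 4 :=
    fun u ↦ by rw [← D.chern_curv_coe hm hJ ht]; exact hc u
  have hz : α ^ 2 + β ^ 2 = 0 ∧ ‖w‖ ^ 2 = 0 := by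
    have := sq_nonneg ‖w‖
    have := sq_nonneg α
    have := sq_nonneg β
    rcases subsingleton_or_nontrivial D.𝔞 with h | h
    · have e0 : ∀ T : Module.End ℝ D.𝔞, trace ℝ D.𝔞 T = 0 := fun T ↦ by
        rw [Subsingleton.elim T 0, map_zero]
      rw [e0] at htx hty
      rw [Subsingleton.elim w 0, ← hty, show β = 0 by linarith]
      simp
    · -- the curvature of a direction in the ideal is nonnegative
      obtain ⟨u, hu⟩ := exists_ne (0 : D.𝔞)
      have hu4 : 0 < ‖u‖ ^ 4 := by have := norm_pos_iff.2 hu; positivity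
      have hc0 : 0 ≤ c := by
        have h1 : 0 ≤ c * ‖u‖ ^ 4 := by rw [← hquad]; positivity
        exact nonneg_of_mul_nonneg_left h1 hu4
      constructor <;> linarith
  have hα : α = 0 := pow_eq_zero_iff two_ne_zero |>.1
    (by linarith [hz.1, sq_nonneg α, sq_nonneg β])
  have hβ : β = 0 := pow_eq_zero_iff two_ne_zero |>.1
    (by linarith [hz.1, sq_nonneg α, sq_nonneg β])
  have hw0 : w = 0 := norm_eq_zero.1 (pow_eq_zero_iff two_ne_zero |>.1 hz.2)
  have hc0 : c = 0 := by rw [hcxy, hz.1, hz.2]; norm_num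
  subst hα hβ hw0 hc0
  have bxy : L.br D.x D.y = 0 := by simp [hw]
  have byx : L.br D.y D.x = 0 := by rw [L.br_skew, bxy, neg_zero]
  have hσs : adjoint D.chernσ = -D.chernσ := adjoint_eq_neg_of_inner_self fun u ↦ by
    have h := hquad u
    rw [real_inner_comm]
    refine pow_eq_zero_iff two_ne_zero |>.1 ?_
    linarith [sq_nonneg (inner ℝ u (D.J𝔞 (D.chernσ u))), sq_nonneg (inner ℝ u (D.chernσ u))]
  obtain ⟨hσ, hF⟩ := chern_vanishing D.J𝔞_sq hσs D.chernσ_eq rfl D.chernF_mul_J𝔞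
    (D.chern_curv_mixed hm hJ ht bxy hc)
  have xx : n D.x D.x = 0 := by simp [D.chern_x_x hm hJ ht hw]
  have xy : n D.x D.y = 0 := by simp [D.chern_x_y hm hJ ht hw]
  have yx : n D.y D.x = 0 := by simp [D.chern_y_x hm hJ ht hw]
  have yy : n D.y D.y = 0 := by simp [D.chern_y_y hm hJ ht hw]
  have ux : ∀ u : D.𝔞, n u D.x = 0 := fun u ↦ by simp [D.chern_coe_x hm hJ ht, hσ]
  have uy : ∀ u : D.𝔞, n u D.y = 0 := fun u ↦ by simp [D.chern_coe_y hm hJ ht, hσ]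
  have uv : ∀ u v : D.𝔞, n u v = 0 := fun u v ↦ by simp [D.chern_coe_coe hm hJ ht, hσ]
  have xu := D.chern_x_coe hm hJ ht bxy
  have yu := D.chern_y_coe hm hJ ht bxy
  have hF' : ∀ u : D.𝔞, adjoint D.chernF (D.chernF u) = D.chernF (adjoint D.chernF u) :=
    fun u ↦ congrArg (fun T ↦ T u) hF
  refine ⟨rfl, fun a b z ↦ ?_⟩
  obtain ⟨a₁, a₂, a₃, rfl⟩ := D.exists_decomp a
  obtain ⟨b₁, b₂, b₃, rfl⟩ := D.exists_decomp b
  obtain ⟨z₁, z₂, z₃, rfl⟩ := D.exists_decomp z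
  simp only [curv, map_add, map_sub, map_smul, LinearMap.add_apply, LinearMap.smul_apply, xx, xy,
    yx, yy, ux, uy, uv, xu, yu, bxy, byx, L.br_self, D.br_coe_coe, D.br_coe_left, ← D.coe_act,
    map_neg, map_zero, LinearMap.zero_apply, LinearMap.neg_apply, Submodule.coe_add,
    Submodule.coe_sub, D.chernF_J𝔞, D.adjoint_chernF_J𝔞, hF']
  module

end AdaptedIdeal
end HermitianLieAlgebra
end ChernTheorem

/-! ### Existence of adapted ideals -/

noncomputable section AdaptedIdealExists

variable {W : Type*} [NormedAddCommGroup W] [InnerProductSpace ℝ W] [FiniteDimensional ℝ W]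

namespace HermitianLieAlgebra

variable (L : HermitianLieAlgebra W)

omit [FiniteDimensional ℝ W] in
lemma inner_self_J (x : W) : inner ℝ x (L.J x) = 0 := by
  rw [real_inner_comm, L.inner_J_self]

lemma mem_of_inner_eq_zero {𝔟 : Submodule ℝ W} (h : Module.finrank ℝ (W ⧸ 𝔟) = 1) {x : W}
    (hx : x ∈ 𝔟ᗮ) (hx0 : x ≠ 0) {z : W} (hz : inner ℝ x z = 0) : z ∈ 𝔟 := by
  have hfr : Module.finrank ℝ 𝔟ᗮ = 1 := by
    have h1 := 𝔟.finrank_add_finrank_orthogonal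
    have h2 := 𝔟.finrank_quotient_add_finrank
    omega
  rw [← Submodule.orthogonal_orthogonal 𝔟, Submodule.mem_orthogonal]
  intro u hu
  obtain ⟨t, ht⟩ := (finrank_eq_one_iff_of_nonzero' (⟨x, hx⟩ : 𝔟ᗮ) (by simpa using hx0)).1 hfr
    ⟨u, hu⟩
  have : u = t • x := by simpa using (congrArg Subtype.val ht).symm
  rw [this, inner_smul_left, hz, mul_zero]

lemma exists_unit_orthogonal {𝔟 : Submodule ℝ W} (h : Module.finrank ℝ (W ⧸ 𝔟) ≠ 0) :
    ∃ x ∈ 𝔟ᗮ, ‖x‖ = 1 := by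
  have hb : 𝔟ᗮ ≠ ⊥ := fun hb ↦ h <| by
    rw [Submodule.orthogonal_eq_bot_iff] at hb
    have h2 := 𝔟.finrank_quotient_add_finrank
    rw [hb, finrank_top] at h2
    rw [hb]; omega
  obtain ⟨x, hx, hx0⟩ := Submodule.exists_mem_ne_zero_of_ne_bot hb
  exact ⟨(‖x‖⁻¹ : ℝ) • x, 𝔟ᗮ.smul_mem _ hx, norm_smul_inv_norm (𝕜 := ℝ) hx0⟩

/-- If `𝔟` is an abelian ideal of codimension one, then `𝔟 ⊓ J 𝔟` is a complex abelian ideal of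
real codimension two. -/
lemma exists_adaptedIdeal_of_finrank_eq_one {𝔟 : Submodule ℝ W}
    (hmem : ∀ a, ∀ u ∈ 𝔟, L.br a u ∈ 𝔟) (hab : ∀ u ∈ 𝔟, ∀ v ∈ 𝔟, L.br u v = 0)
    (h : Module.finrank ℝ (W ⧸ 𝔟) = 1) : Nonempty L.AdaptedIdeal := by
  obtain ⟨x, hx, hx1⟩ := exists_unit_orthogonal (𝔟 := 𝔟) (by omega)
  have hx0 : x ≠ 0 := fun h ↦ by simp [h] at hx1
  have hxx : inner ℝ x x = 1 := by rw [real_inner_self_eq_norm_sq, hx1, one_pow]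
  have mem {z : W} (hz : inner ℝ x z = 0) : z ∈ 𝔟 := mem_of_inner_eq_zero h hx hx0 hz
  have hy : L.J x ∈ 𝔟 := mem (L.inner_self_J x)
  have hort {u : W} (hu : u ∈ 𝔟) : inner ℝ x u = 0 := Submodule.inner_left_of_mem_orthogonal hu hx
  refine ⟨{ 𝔞 := 𝔟 ⊓ 𝔟.comap L.J, x := x, norm_x := hx1, br_mem := ?_, br_eq_zero := ?_,
            J_mem := ?_, inner_x := ?_, decomp := ?_ }⟩
  · rintro a u ⟨hu, hJu⟩
    refine ⟨hmem a u hu, ?_⟩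
    have ha : a - (inner ℝ x a : ℝ) • x ∈ 𝔟 := mem <| by
      rw [inner_sub_right, inner_smul_right, hxx]; ring
    have e : L.br a u = (inner ℝ x a : ℝ) • L.br x u := by
      have := hab _ ha u hu
      rwa [map_sub, map_smul, LinearMap.sub_apply, LinearMap.smul_apply, sub_eq_zero] at this
    have hint := L.integrable x u
    rw [hab _ hy _ hu, hab _ hy _ hJu, map_zero] at hint
    have h1 : L.J (L.br x u) = L.br x (L.J u) := by
      have h2 := congrArg L.J hint
      simp only [map_add, map_sub, map_zero, L.J_sq] at h2
      linear_combination (norm := module) h2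
    change L.J (L.br a u) ∈ 𝔟
    rw [e, map_smul, h1]
    exact 𝔟.smul_mem _ (hmem _ _ hJu)
  · exact fun u hu v hv ↦ hab u hu.1 v hv.1
  · rintro u ⟨hu, hJu⟩
    refine ⟨hJu, ?_⟩
    change L.J (L.J u) ∈ 𝔟
    rw [L.J_sq]
    exact 𝔟.neg_mem hu
  · exact fun u hu ↦ hort hu.1
  · intro z
    have hyx : inner ℝ x (L.J x) = 0 := L.inner_self_J x
    constructor
    · apply mem
      rw [inner_sub_right, inner_sub_right, inner_smul_right, inner_smul_right, hxx, hyx]; ring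
    · apply mem
      simp only [map_sub, map_smul, L.J_sq, inner_sub_right, inner_smul_right, inner_neg_right,
        hxx, hyx, L.inner_J_left]
      ring

lemma exists_adaptedIdeal_of_finrank_eq_two {𝔟 : Submodule ℝ W}
    (hmem : ∀ a, ∀ u ∈ 𝔟, L.br a u ∈ 𝔟) (hab : ∀ u ∈ 𝔟, ∀ v ∈ 𝔟, L.br u v = 0)
    (hJ : ∀ u ∈ 𝔟, L.J u ∈ 𝔟)
    (h : Module.finrank ℝ (W ⧸ 𝔟) = 2) : Nonempty L.AdaptedIdeal := by
  obtain ⟨x, hx, hx1⟩ := exists_unit_orthogonal (𝔟 := 𝔟) (by omega)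
  have hxx : inner ℝ x x = 1 := by rw [real_inner_self_eq_norm_sq, hx1, one_pow]
  have hyy : inner ℝ (L.J x) (L.J x) = 1 := by rw [L.inner_J_J, hxx]
  have hxy : inner ℝ x (L.J x) = 0 := L.inner_self_J x
  have hy : L.J x ∈ 𝔟ᗮ := by
    rw [Submodule.mem_orthogonal']
    intro u hu
    rw [L.inner_J_left, Submodule.inner_left_of_mem_orthogonal (hJ u hu) hx, neg_zero]
  have hfr : Module.finrank ℝ 𝔟ᗮ = 2 := by
    have h1 := 𝔟.finrank_add_finrank_orthogonal
    have h2 := 𝔟.finrank_quotient_add_finrank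
    omega
  have hspan : Submodule.span ℝ {x, L.J x} = 𝔟ᗮ := by
    apply Submodule.eq_of_le_of_finrank_eq
    · rw [Submodule.span_le]
      rintro z (rfl | rfl)
      exacts [hx, hy]
    · have hli : LinearIndependent ℝ ![x, L.J x] := by
        rw [LinearIndependent.pair_iff]
        intro s t hst
        have h1 := congrArg (inner ℝ x) hst
        have h2 := congrArg (inner ℝ (L.J x)) hst
        simp only [inner_add_right, inner_smul_right, hxx, hxy, hyy, L.inner_J_self,
          inner_zero_right] at h1 h2
        constructor <;> linarith
      have := finrank_span_eq_card hli
      rw [hfr]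
      rwa [Matrix.range_cons_cons_empty, Fintype.card_fin] at this
  refine ⟨{ 𝔞 := 𝔟, x := x, norm_x := hx1, br_mem := hmem, br_eq_zero := hab, J_mem := hJ,
            inner_x := ?_, decomp := ?_ }⟩
  · exact fun u hu ↦ Submodule.inner_left_of_mem_orthogonal hu hx
  · intro z
    rw [← Submodule.orthogonal_orthogonal 𝔟, ← hspan, Submodule.mem_orthogonal]
    intro u hu
    induction hu using Submodule.span_induction with
    | mem u hu =>
      rcases hu with rfl | rfl
      · simp only [inner_sub_right, inner_smul_right, hxx, hxy]; ring
      · simp only [inner_sub_right, inner_smul_right, hyy, L.inner_J_self]; ring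
    | zero => exact inner_zero_left _
    | add u v _ _ hu hv => rw [inner_add_left, hu, hv, add_zero]
    | smul a u _ hu => rw [inner_smul_left, hu, mul_zero]

lemma exists_adaptedIdeal {𝔟 : Submodule ℝ W}
    (hmem : ∀ a, ∀ u ∈ 𝔟, L.br a u ∈ 𝔟) (hab : ∀ u ∈ 𝔟, ∀ v ∈ 𝔟, L.br u v = 0)
    (h : Module.finrank ℝ (W ⧸ 𝔟) = 1 ∨
      Module.finrank ℝ (W ⧸ 𝔟) = 2 ∧ ∀ u ∈ 𝔟, L.J u ∈ 𝔟) : Nonempty L.AdaptedIdeal :=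
  h.elim (L.exists_adaptedIdeal_of_finrank_eq_one hmem hab)
    fun h ↦ L.exists_adaptedIdeal_of_finrank_eq_two hmem hab h.2 h.1

end HermitianLieAlgebra

/-- A scalar product on a finite-dimensional space is carried to the standard one by a linear
isomorphism with a Euclidean space. -/
lemma exists_linearEquiv_euclideanSpace {V : Type*} [AddCommGroup V] [Module ℝ V]
    [FiniteDimensional ℝ V] (B : V → V → ℝ) (hsymm : ∀ a b, B a b = B b a)
    (hadd : ∀ a b c, B (a + b) c = B a c + B b c) (hsmul : ∀ (t : ℝ) a b, B (t • a) b = t * B a b)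
    (hpos : ∀ a, a ≠ 0 → 0 < B a a) :
    ∃ φ : EuclideanSpace ℝ (Fin (Module.finrank ℝ V)) ≃ₗ[ℝ] V,
      ∀ a b, B (φ a) (φ b) = inner ℝ a b := by
  have h0 : B 0 0 = 0 := by simpa using hsmul 0 0 0
  let core : InnerProductSpace.Core ℝ V :=
    { inner := B
      conj_inner_symm := fun a b ↦ hsymm b a
      re_inner_nonneg := fun a ↦ by
        rcases eq_or_ne a 0 with rfl | ha
        · exact h0.ge
        · exact (hpos a ha).le
      add_left := hadd
      smul_left := fun a b t ↦ hsmul t a b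
      definite := fun a ha ↦ by
        by_contra h
        exact (hpos a h).ne' ha }
  let _ : NormedAddCommGroup V := core.toNormedAddCommGroup
  let _ : InnerProductSpace ℝ V := InnerProductSpace.ofCore core.toCore
  let ψ := (stdOrthonormalBasis ℝ V).repr
  exact ⟨ψ.symm.toLinearEquiv, fun a b ↦ ψ.symm.inner_map_map a b⟩

end AdaptedIdealExists

/-! ### Groups with a discrete cocompact subgroup are unimodular -/

noncomputable section RightInvariance

open MeasureTheory Measure Set Filter
open scoped Topology Pointwise

/-- A section of finite measure of an open, locally injective map onto a compact space. -/
lemma exists_measurableSet_injOn_image_eq_univ {X Y : Type*} [TopologicalSpace X]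
    [MeasurableSpace X] [BorelSpace X] [TopologicalSpace Y] [CompactSpace Y] (μ : Measure X)
    [IsLocallyFiniteMeasure μ] {p : X → Y} (hcont : Continuous p) (hopen : IsOpenMap p)
    (hinj : ∀ x, ∃ U ∈ 𝓝 x, InjOn p U) (hsurj : Function.Surjective p) :
    ∃ F : Set X, MeasurableSet F ∧ μ F < ⊤ ∧ InjOn p F ∧ p '' F = univ := by
  suffices H : ∃ F : Set X, MeasurableSet F ∧ MeasurableSet (p ⁻¹' (p '' F)) ∧ μ F < ⊤ ∧
      InjOn p F ∧ univ ⊆ p '' F by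
    obtain ⟨F, h1, -, h2, h3, h4⟩ := H
    exact ⟨F, h1, h2, h3, univ_subset_iff.1 h4⟩
  refine isCompact_univ.induction_on (p := fun K : Set Y ↦ ∃ F : Set X, MeasurableSet F ∧
      MeasurableSet (p ⁻¹' (p '' F)) ∧ μ F < ⊤ ∧ InjOn p F ∧ K ⊆ p '' F) ?_ ?_ ?_ ?_
  · exact ⟨∅, by simp⟩
  · rintro s t hst ⟨F, h1, h2, h3, h4, h5⟩
    exact ⟨F, h1, h2, h3, h4, hst.trans h5⟩
  · rintro s t ⟨F, h1, h2, h3, h4, h5⟩ ⟨F', h1', h2', h3', h4', h5'⟩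
    have e : p '' (F ∪ F' \ p ⁻¹' (p '' F)) = p '' F ∪ p '' F' := by
      ext y
      constructor
      · rintro ⟨x, hx | hx, rfl⟩
        exacts [Or.inl ⟨x, hx, rfl⟩, Or.inr ⟨x, hx.1, rfl⟩]
      · rintro (⟨x, hx, rfl⟩ | ⟨x, hx, rfl⟩)
        · exact ⟨x, Or.inl hx, rfl⟩
        · by_cases h : x ∈ p ⁻¹' (p '' F)
          · obtain ⟨z, hz, hzx⟩ := h
            exact ⟨z, Or.inl hz, hzx⟩
          · exact ⟨x, Or.inr ⟨hx, h⟩, rfl⟩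
    refine ⟨F ∪ F' \ p ⁻¹' (p '' F), h1.union (h1'.diff h2), ?_, ?_, ?_, ?_⟩
    · rw [e, preimage_union]
      exact h2.union h2'
    · exact (measure_union_lt_top h3 ((measure_mono sdiff_subset).trans_lt h3'))
    · rintro x (hx | hx) z (hz | hz) hxz
      · exact h4 hx hz hxz
      · exact (hz.2 ⟨x, hx, hxz⟩).elim
      · exact (hx.2 ⟨z, hz, hxz.symm⟩).elim
      · exact h4' hx.1 hz.1 hxz
    · rw [e]
      exact union_subset_union h5 h5'
  · intro y _
    obtain ⟨x, rfl⟩ := hsurj y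
    obtain ⟨U, hU, hUi⟩ := hinj x
    obtain ⟨V, hV, hVo, hVμ⟩ := μ.exists_isOpen_measure_lt_top x
    obtain ⟨U', hU'U, hU'o, hxU'⟩ := mem_nhds_iff.1 hU
    have ho : IsOpen (U' ∩ V) := hU'o.inter hVo
    refine ⟨p '' (U' ∩ V), mem_nhdsWithin_of_mem_nhds (hopen.image_mem_nhds
      (ho.mem_nhds ⟨hxU', hV⟩)), U' ∩ V, ho.measurableSet,
      (hcont.isOpen_preimage _ (hopen _ ho)).measurableSet,
      (measure_mono inter_subset_right).trans_lt hVμ,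
      hUi.mono (inter_subset_left.trans hU'U), le_rfl⟩

/-- A locally compact group with a discrete cocompact subgroup is unimodular: a fundamental domain
for the left translations by the subgroup has positive finite measure, and so do its right
translates, which are again fundamental domains. -/
theorem isMulRightInvariant_of_compact_quotient {G : Type*} [Group G] [TopologicalSpace G]
    [IsTopologicalGroup G] [LocallyCompactSpace G] [SecondCountableTopology G]
    [MeasurableSpace G] [BorelSpace G] {Y : Type*} [TopologicalSpace Y] [CompactSpace Y]
    (μ : Measure G) [IsHaarMeasure μ] [InnerRegular μ] (Γ : Subgroup G) [DiscreteTopology Γ]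
    {p : G → Y} (hcont : Continuous p) (hopen : IsOpenMap p)
    (hinj : ∀ x, ∃ U ∈ 𝓝 x, InjOn p U) (hsurj : Function.Surjective p)
    (hfib : ∀ x y, p x = p y ↔ ∃ γ ∈ Γ, y = γ * x) : IsMulRightInvariant μ := by
  obtain ⟨F, hFm, hFμ, hFi, hFs⟩ :=
    exists_measurableSet_injOn_image_eq_univ μ hcont hopen hinj hsurj
  have : Countable Γ := TopologicalSpace.separableSpace_iff_countable.1 inferInstance
  have hfd : ∀ g : G, IsFundamentalDomain Γ ((fun x ↦ x * g) ⁻¹' F) μ := fun g ↦ by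
    refine IsFundamentalDomain.mk' ((measurable_mul_const g) hFm).nullMeasurableSet fun x ↦ ?_
    obtain ⟨z, hz, hzx⟩ := (hFs.symm ▸ mem_univ _ : p (x * g) ∈ p '' F)
    obtain ⟨γ, hγ, rfl⟩ := (hfib _ _).1 hzx.symm
    refine ⟨⟨γ, hγ⟩, by simpa [Subgroup.smul_def, mul_assoc] using hz, ?_⟩
    rintro ⟨δ, hδ⟩ hδz
    have hδz' : δ * (x * g) ∈ F := by simpa [Subgroup.smul_def, mul_assoc] using hδz
    have h := hFi hδz' hz ((hfib _ _).2 ⟨γ * δ⁻¹, Γ.mul_mem hγ (Γ.inv_mem hδ), by group⟩)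
    exact Subtype.ext (mul_right_cancel h)
  have hone : ∀ g : G, modularCharacterFun g = 1 := fun g ↦ by
    have h1 := map_right_mul_eq_modularCharacterFun_smul μ g
    have h2 := congrArg (fun ν : Measure G ↦ ν F) h1
    simp only [map_apply (measurable_mul_const g) hFm] at h2
    have h3 := (hfd g).measure_eq (hfd 1)
    simp only [mul_one, preimage_id'] at h3
    have h4 : μ F ≠ 0 := by
      have := (hfd 1).measure_ne_zero (NeZero.ne μ)
      simpa using this
    rw [h3, Measure.smul_apply, ENNReal.smul_def, smul_eq_mul] at h2
    have h5 := (ENNReal.mul_eq_right h4 hFμ.ne).1 h2.symm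
    exact_mod_cast h5
  exact ⟨fun g ↦ by rw [map_right_mul_eq_modularCharacterFun_smul, hone, one_smul]⟩

end RightInvariance

/-! ### Vector fields as derivations -/

noncomputable section VectorFieldsAsDerivations

open Set Filter
open scoped Topology

variable {E : Type*} [NormedAddCommGroup E] [NormedSpace ℝ E]
variable {M : Type*} [TopologicalSpace M] [ChartedSpace E M]

/-- The derivative of a smooth function along a smooth vector field is smooth. -/
lemma ContMDiffAt.mvfderiv_apply [IsManifold 𝓘(ℝ, E) 1 M] {F : Type*} [NormedAddCommGroup F]
    [NormedSpace ℝ F] {f : M → F} {Y : HermGeom.VField E M} (hf : ContMDiff 𝓘(ℝ, E) 𝓘(ℝ, F) ∞ f)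
    {x : M}
    (hY : ContMDiffAt 𝓘(ℝ, E) 𝓘(ℝ, E).tangent ∞ (fun y ↦ (⟨y, Y y⟩ : TangentBundle 𝓘(ℝ, E) M)) x) :
    ContMDiffAt 𝓘(ℝ, E) 𝓘(ℝ, F) ∞ (fun y ↦ mvfderiv 𝓘(ℝ, E) f y (Y y)) x := by
  have h1 : ContMDiff 𝓘(ℝ, E).tangent 𝓘(ℝ, F).tangent ∞ (tangentMap 𝓘(ℝ, E) 𝓘(ℝ, F) f) :=
    hf.contMDiff_tangentMap (m := ∞) le_rfl
  have h2 : ContMDiffAt 𝓘(ℝ, E) 𝓘(ℝ, F).tangent ∞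
      (fun y ↦ tangentMap 𝓘(ℝ, E) 𝓘(ℝ, F) f ⟨y, Y y⟩) x := h1.contMDiffAt.comp x hY
  exact (contMDiff_snd_tangentBundle_modelSpace F 𝓘(ℝ, F)).contMDiffAt.comp x h2

variable [IsManifold 𝓘(ℝ, E) ∞ M]

lemma HermGeom.SmoothVF.mdifferentiableAt {X : HermGeom.VField E M} (hX : HermGeom.SmoothVF X)
    (x : M) : MDifferentiableAt 𝓘(ℝ, E) 𝓘(ℝ, E).tangent
      (fun y ↦ (⟨y, X y⟩ : TangentBundle 𝓘(ℝ, E) M)) x :=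
  (hX x).mdifferentiableAt (by simp)

lemma isManifold_minSmoothness_three : IsManifold 𝓘(ℝ, E) (minSmoothness ℝ 3) M := by
  rw [minSmoothness_of_isRCLikeNormedField]
  infer_instance

attribute [local instance] isManifold_minSmoothness_three

/-- The Lie bracket of two vector fields is the commutator of the corresponding derivations. -/
lemma mvfderiv_mlieBracket [CompleteSpace E] {X Y : HermGeom.VField E M}
    (hX : HermGeom.SmoothVF X) (hY : HermGeom.SmoothVF Y) {f : M → ℝ}
    (hf : ContMDiff 𝓘(ℝ, E) 𝓘(ℝ, ℝ) ∞ f) (x : M) :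
    mvfderiv 𝓘(ℝ, E) f x (mlieBracket 𝓘(ℝ, E) X Y x) =
      mvfderiv 𝓘(ℝ, E) (fun y ↦ mvfderiv 𝓘(ℝ, E) f y (Y y)) x (X x)
        - mvfderiv 𝓘(ℝ, E) (fun y ↦ mvfderiv 𝓘(ℝ, E) f y (X y)) x (Y x) := by
  rcases subsingleton_or_nontrivial E with hE | hE
  · have e : ∀ (y : M) (v : TangentSpace 𝓘(ℝ, E) y), v = 0 := fun y v ↦ Subsingleton.elim (α := E) _ _
    simp [e _ (X _), e _ (Y _), e x (mlieBracket 𝓘(ℝ, E) X Y x)]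
  obtain ⟨z, hz⟩ := exists_ne (0 : E)
  -- The Jacobi identity for `X`, `Y` and `f • Z`, where `Z` does not vanish at `x`.
  let Z : HermGeom.VField E M := FiberBundle.extend E (E := fun y : M ↦ TangentSpace 𝓘(ℝ, E) y) (x := x) z
  have hZ : ContMDiffAt 𝓘(ℝ, E) 𝓘(ℝ, E).tangent ∞
      (fun y ↦ (⟨y, Z y⟩ : TangentBundle 𝓘(ℝ, E) M)) x :=
    FiberBundle.contMDiffAt_extend ..
  have hZx : Z x ≠ 0 := by
    have h : Z x = z := FiberBundle.extend_apply_self ..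
    rwa [h]
  have le2 : minSmoothness ℝ 2 ≤ ∞ := by
    rw [minSmoothness_of_isRCLikeNormedField]; exact WithTop.coe_le_coe.2 le_top
  have hfd : ∀ y, MDifferentiableAt 𝓘(ℝ, E) 𝓘(ℝ, ℝ) f y :=
    fun y ↦ (hf y).mdifferentiableAt (by simp)
  have hmd {h : M → ℝ} (hh : ContMDiffAt 𝓘(ℝ, E) 𝓘(ℝ, ℝ) ∞ h x) :
      MDifferentiableAt 𝓘(ℝ, E) 𝓘(ℝ, ℝ) h x := hh.mdifferentiableAt (by simp)
  have hXf := hmd (ContMDiffAt.mvfderiv_apply hf (hX x))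
  have hYf := hmd (ContMDiffAt.mvfderiv_apply hf (hY x))
  have hfx := hfd x
  obtain ⟨s, hs, hsZ⟩ := FiberBundle.exists_mdifferentiableOn_extend 𝓘(ℝ, E) E
    (V := fun y : M ↦ TangentSpace 𝓘(ℝ, E) y) (x₀ := x) z
  have hZe : ∀ᶠ y in 𝓝 x, MDifferentiableAt 𝓘(ℝ, E) 𝓘(ℝ, E).tangent
      (fun y ↦ (⟨y, Z y⟩ : TangentBundle 𝓘(ℝ, E) M)) y := by
    filter_upwards [interior_mem_nhds.2 hs] with y hy
    exact (hsZ y (interior_subset hy)).mdifferentiableAt (mem_interior_iff_mem_nhds.1 hy)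
  have hZx' := hZe.self_of_nhds
  have key {X : HermGeom.VField E M} : mlieBracket 𝓘(ℝ, E) X (f • Z) =ᶠ[𝓝 x]
      (fun y ↦ mvfderiv 𝓘(ℝ, E) f y (X y)) • Z + f • mlieBracket 𝓘(ℝ, E) X Z := by
    filter_upwards [hZe] with y hy
    exact mlieBracket_smul_right (hfd y) hy
  have hbr {X : HermGeom.VField E M} (hX : HermGeom.SmoothVF X) :
      MDifferentiableAt 𝓘(ℝ, E) 𝓘(ℝ, E).tangent
      (fun y ↦ (⟨y, mlieBracket 𝓘(ℝ, E) X Z y⟩ : TangentBundle 𝓘(ℝ, E) M)) x := by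
    have : IsManifold 𝓘(ℝ, E) ((2 : ℕ∞) + 1) M := .of_le (n := ∞) (WithTop.coe_le_coe.2 le_top)
    have l2 : ((2 : ℕ∞) : WithTop ℕ∞) ≤ ∞ := WithTop.coe_le_coe.2 le_top
    refine (((hX x).of_le l2).mlieBracket_vectorField (m := 1) (hZ.of_le l2)
      ?_).mdifferentiableAt one_ne_zero
    rw [minSmoothness_of_isRCLikeNormedField]
    norm_num
  have expand {X Y : HermGeom.VField E M} (hX : HermGeom.SmoothVF X) (hY : HermGeom.SmoothVF Y)
      (hYf : MDifferentiableAt 𝓘(ℝ, E) 𝓘(ℝ, ℝ) (fun y ↦ mvfderiv 𝓘(ℝ, E) f y (Y y)) x) :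
      mlieBracket 𝓘(ℝ, E) X (mlieBracket 𝓘(ℝ, E) Y (f • Z)) x =
      mvfderiv 𝓘(ℝ, E) (fun y ↦ mvfderiv 𝓘(ℝ, E) f y (Y y)) x (X x) • Z x
        + mvfderiv 𝓘(ℝ, E) f x (Y x) • mlieBracket 𝓘(ℝ, E) X Z x
        + (mvfderiv 𝓘(ℝ, E) f x (X x) • mlieBracket 𝓘(ℝ, E) Y Z x
          + f x • mlieBracket 𝓘(ℝ, E) X (mlieBracket 𝓘(ℝ, E) Y Z) x) := by
    rw [(EventuallyEq.refl _ X).mlieBracket_vectorField_eq key,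
      mlieBracket_add_right (hYf.smul_section hZx') (hfx.smul_section (hbr hY)),
      mlieBracket_smul_right hYf hZx', mlieBracket_smul_right hfx (hbr hY)]
  have hfZ : ContMDiffAt 𝓘(ℝ, E) 𝓘(ℝ, E).tangent ∞
      (fun y ↦ (⟨y, (f • Z) y⟩ : TangentBundle 𝓘(ℝ, E) M)) x := (hf x).smul_section hZ
  have J1 := leibniz_identity_mlieBracket_apply ((hX x).of_le le2) ((hY x).of_le le2)
    (hfZ.of_le le2)
  have J2 := leibniz_identity_mlieBracket_apply ((hX x).of_le le2) ((hY x).of_le le2)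
    (hZ.of_le le2)
  rw [expand hX hY hYf, expand hY hX hXf, mlieBracket_smul_right hfx hZx', J2] at J1
  have h0 : (mvfderiv 𝓘(ℝ, E) f x (mlieBracket 𝓘(ℝ, E) X Y x) -
      (mvfderiv 𝓘(ℝ, E) (fun y ↦ mvfderiv 𝓘(ℝ, E) f y (Y y)) x (X x)
        - mvfderiv 𝓘(ℝ, E) (fun y ↦ mvfderiv 𝓘(ℝ, E) f y (X y)) x (Y x))) • Z x = 0 := by
    linear_combination (norm := module) -J1
  exact sub_eq_zero.1 ((smul_eq_zero.1 h0).resolve_right hZx)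

end VectorFieldsAsDerivations

noncomputable section InvariantFields

variable {E : Type*} [NormedAddCommGroup E] [NormedSpace ℝ E]
variable {G : Type*} [Group G] [TopologicalSpace G] [ChartedSpace E G] [LieGroup 𝓘(ℝ, E) ∞ G]

lemma smoothVF_mulInvariantVectorField (v : GroupLieAlgebra 𝓘(ℝ, E) G) :
    HermGeom.SmoothVF (mulInvariantVectorField v : HermGeom.VField E G) := by
  -- The map `g ↦ D(mul) (g, 1) (0, v)`.
  let fg : G → TangentBundle 𝓘(ℝ, E) G := fun g ↦ TotalSpace.mk' E g 0
  have sfg : ContMDiff 𝓘(ℝ, E) 𝓘(ℝ, E).tangent ∞ fg := contMDiff_zeroSection _ _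
  let fv : G → TangentBundle 𝓘(ℝ, E) G := fun _ ↦ TotalSpace.mk' E 1 v
  have sfv : ContMDiff 𝓘(ℝ, E) 𝓘(ℝ, E).tangent ∞ fv := contMDiff_const
  have S := ((contMDiff_mul 𝓘(ℝ, E) ∞ (G := G)).contMDiff_tangentMap (m := ∞) le_rfl).comp
    (contMDiff_equivTangentBundleProd_symm.comp (sfg.prodMk sfv))
  unfold HermGeom.SmoothVF
  convert! S with g
  · simp [fg, fv]
  · simp only [Function.comp_apply, tangentMap, fg, fv]
    rw [mfderiv_prod_eq_add_apply ((contMDiff_mul 𝓘(ℝ, E) ∞).mdifferentiableAt (by simp))]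
    change mfderiv 𝓘(ℝ, E) 𝓘(ℝ, E) (fun x ↦ g * x) 1 v =
      mfderiv 𝓘(ℝ, E) 𝓘(ℝ, E) (fun z ↦ z * (1 : G)) g 0
        + mfderiv 𝓘(ℝ, E) 𝓘(ℝ, E) (fun x ↦ g * x) 1 v
    rw [map_zero]
    exact (zero_add (M := E) _).symm

end InvariantFields

noncomputable section SeparatingFunctions

open Set Filter
open scoped Topology

variable {E : Type*} [NormedAddCommGroup E] [NormedSpace ℝ E] [FiniteDimensional ℝ E]
variable {M : Type*} [TopologicalSpace M] [ChartedSpace E M] [IsManifold 𝓘(ℝ, E) ∞ M]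

/-- Tangent vectors are separated by the derivatives of globally defined smooth functions. -/
lemma eq_of_forall_mvfderiv_eq [T2Space M] {x : M} {v w : TangentSpace 𝓘(ℝ, E) x}
    (h : ∀ f : M → ℝ, ContMDiff 𝓘(ℝ, E) 𝓘(ℝ, ℝ) ∞ f →
      mvfderiv 𝓘(ℝ, E) f x v = mvfderiv 𝓘(ℝ, E) f x w) : v = w := by
  have hinj := (isInvertible_mfderiv_extChartAt (I := 𝓘(ℝ, E)) (mem_extChartAt_source x)).injective
  apply hinj
  refine (SeparatingDual.eq_iff_forall_dual_eq (V := E) (R := ℝ)).2 fun ℓ ↦ ?_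
  obtain ⟨χ⟩ : Nonempty (SmoothBumpFunction 𝓘(ℝ, E) x) := inferInstance
  have hg : ContMDiffOn 𝓘(ℝ, E) 𝓘(ℝ, ℝ) ∞ (fun y ↦ ℓ (extChartAt 𝓘(ℝ, E) x y))
      (chartAt E x).source :=
    ℓ.contDiff.contMDiff.comp_contMDiffOn contMDiffOn_extChartAt
  have key := h _ (χ.contMDiff_smul hg)
  have hev : (fun y ↦ χ y • ℓ (extChartAt 𝓘(ℝ, E) x y)) =ᶠ[𝓝 x]
      fun y ↦ ℓ (extChartAt 𝓘(ℝ, E) x y) := by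
    filter_upwards [χ.eventuallyEq_one] with y hy
    simp [hy]
  have hφ : HasMFDerivAt 𝓘(ℝ, E) 𝓘(ℝ, E) (extChartAt 𝓘(ℝ, E) x) x
      (mfderiv 𝓘(ℝ, E) 𝓘(ℝ, E) (extChartAt 𝓘(ℝ, E) x) x) :=
    (mdifferentiableAt_extChartAt (mem_chart_source E x)).hasMFDerivAt
  have hd := ((ℓ.hasMFDerivAt (x := extChartAt 𝓘(ℝ, E) x x)).comp x hφ).congr_of_eventuallyEq hev
  have e : ∀ u : TangentSpace 𝓘(ℝ, E) x,
      mvfderiv 𝓘(ℝ, E) (fun y ↦ χ y • ℓ (extChartAt 𝓘(ℝ, E) x y)) x u =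
        ℓ (mfderiv 𝓘(ℝ, E) 𝓘(ℝ, E) (extChartAt 𝓘(ℝ, E) x) x u) := fun u ↦
    congrArg (fun T : E →L[ℝ] ℝ ↦ T u) hd.mfderiv
  rw [e, e] at key
  exact key

end SeparatingFunctions

/-! ### Functions of a real parameter -/

noncomputable section ParametricDerivatives

open Set Filter MeasureTheory
open scoped Topology

variable {E : Type*} [NormedAddCommGroup E] [NormedSpace ℝ E]
variable {M : Type*} [TopologicalSpace M] [ChartedSpace E M] [IsManifold 𝓘(ℝ, E) ∞ M]

lemma contMDiff_deriv_param {H : ℝ → M → ℝ}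
    (hH : ContMDiff (𝓘(ℝ, ℝ).prod 𝓘(ℝ, E)) 𝓘(ℝ, ℝ) ∞ (Function.uncurry H)) :
    ContMDiff (𝓘(ℝ, ℝ).prod 𝓘(ℝ, E)) 𝓘(ℝ, ℝ) ∞
      (fun q : ℝ × M ↦ deriv (fun t ↦ H t q.2) q.1) := by
  intro q₀
  have h1 : ContMDiffAt ((𝓘(ℝ, ℝ).prod 𝓘(ℝ, E)).prod 𝓘(ℝ, ℝ)) 𝓘(ℝ, ℝ) ∞
      (Function.uncurry (fun (q : ℝ × M) (t : ℝ) ↦ H t q.2)) (q₀, q₀.1) :=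
    hH.contMDiffAt.comp (f := fun r : (ℝ × M) × ℝ ↦ (r.2, r.1.2)) _
      (contMDiff_snd.prodMk (contMDiff_snd.comp contMDiff_fst)).contMDiffAt
  have h2 := h1.mfderiv (m := ∞) (fun (q : ℝ × M) (t : ℝ) ↦ H t q.2) (fun q ↦ q.1)
    contMDiffAt_fst le_rfl
  have h3 : ContMDiffAt (𝓘(ℝ, ℝ).prod 𝓘(ℝ, E)) 𝓘(ℝ, ℝ →L[ℝ] ℝ) ∞
      (fun q : ℝ × M ↦ fderiv ℝ (fun t ↦ H t q.2) q.1) q₀ := by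
    simpa [inTangentCoordinates_model_space, mfderiv_eq_fderiv] using h2
  exact h3.clm_apply contMDiffAt_const

/-- Differentiation under the integral sign, on a space of parameters carrying a measure. -/
lemma hasDerivAt_integral_param [T2Space M] [SecondCountableTopology M] [MeasurableSpace M]
    [BorelSpace M] (μ : Measure M) [IsFiniteMeasureOnCompacts μ] {H : ℝ → M → ℝ}
    (hH : ContMDiff (𝓘(ℝ, ℝ).prod 𝓘(ℝ, E)) 𝓘(ℝ, ℝ) ∞ (Function.uncurry H)) {K : Set M}
    (hK : IsCompact K) (hHK : ∀ t ∈ Icc (-1 : ℝ) 1, ∀ x ∉ K, H t x = 0) :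
    HasDerivAt (fun t ↦ ∫ x, H t x ∂μ) (∫ x, deriv (fun t ↦ H t x) 0 ∂μ) 0 := by
  have hc := (contMDiff_deriv_param hH).continuous
  have hHc (t : ℝ) : Continuous (H t) := hH.continuous.comp (Continuous.prodMk_right t)
  have hd (x : M) : Differentiable ℝ (fun t ↦ H t x) := by
    have : ContMDiff 𝓘(ℝ, ℝ) 𝓘(ℝ, ℝ) ∞ (fun t ↦ H t x) :=
      hH.comp (contMDiff_id.prodMk contMDiff_const)
    exact this.contDiff.differentiable (by simp)
  obtain ⟨C, hC⟩ := (isCompact_Icc (a := (-1 : ℝ)) (b := 1)).prod hK |>.exists_bound_of_continuousOn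
    hc.continuousOn
  have hball : Metric.ball (0 : ℝ) 1 ⊆ Ioo (-1) 1 := by rw [Real.ball_eq_Ioo]; simp
  refine (hasDerivAt_integral_of_dominated_loc_of_deriv_le (bound := K.indicator fun _ ↦ C)
    (F' := fun t x ↦ deriv (fun t ↦ H t x) t)
    (Metric.ball_mem_nhds (0 : ℝ) one_pos) ?_ ?_ ?_ ?_ ?_ ?_).2
  · exact Eventually.of_forall fun t ↦ (hHc t).aestronglyMeasurable
  · exact (hHc 0).integrable_of_hasCompactSupport
      (HasCompactSupport.intro hK fun x hx ↦ hHK 0 (by simp) x hx)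
  · exact (hc.comp (Continuous.prodMk_right 0)).aestronglyMeasurable
  · refine Eventually.of_forall fun x t ht ↦ ?_
    have ht' := hball ht
    by_cases hx : x ∈ K
    · rw [indicator_of_mem hx]
      exact hC (t, x) ⟨Ioo_subset_Icc_self ht', hx⟩
    · rw [indicator_of_notMem hx]
      have : (fun t ↦ H t x) =ᶠ[𝓝 t] fun _ ↦ 0 := by
        filter_upwards [isOpen_Ioo.mem_nhds ht'] with s hs
        exact hHK s (Ioo_subset_Icc_self hs) x hx
      rw [this.deriv_eq, deriv_const, norm_zero]
  · rw [integrable_indicator_iff hK.measurableSet]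
    exact integrableOn_const hK.measure_lt_top.ne
  · exact Eventually.of_forall fun x t _ ↦ (hd x t).hasDerivAt

/-- Mixed derivatives of a smooth function of two real variables commute. -/
lemma deriv_deriv_comm {H : ℝ → ℝ → ℝ} (hH : ContDiff ℝ ∞ (Function.uncurry H)) :
    deriv (fun s ↦ deriv (fun t ↦ H s t) 0) 0 = deriv (fun t ↦ deriv (fun s ↦ H s t) 0) 0 := by
  set F := Function.uncurry H with hF
  have hd (q : ℝ × ℝ) : HasFDerivAt F (fderiv ℝ F q) q :=
    (hH.differentiable (by simp) q).hasFDerivAt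
  have hd2 (q : ℝ × ℝ) : HasFDerivAt (fderiv ℝ F) (fderiv ℝ (fderiv ℝ F) q) q :=
    ((hH.fderiv_right (m := ∞) le_rfl).differentiable (by simp) q).hasFDerivAt
  have hs (s t : ℝ) : HasDerivAt (fun s ↦ ((s, t) : ℝ × ℝ)) (1, 0) s :=
    (hasDerivAt_id s).prodMk (hasDerivAt_const s t)
  have ht (s t : ℝ) : HasDerivAt (fun t ↦ ((s, t) : ℝ × ℝ)) (0, 1) t :=
    (hasDerivAt_const t s).prodMk (hasDerivAt_id t)
  have e1 (s : ℝ) : deriv (fun t ↦ H s t) 0 = fderiv ℝ F (s, 0) (0, 1) :=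
    ((hd (s, 0)).comp_hasDerivAt (f := fun t ↦ (s, t)) 0 (ht s 0)).deriv
  have e2 (t : ℝ) : deriv (fun s ↦ H s t) 0 = fderiv ℝ F (0, t) (1, 0) :=
    ((hd (0, t)).comp_hasDerivAt (f := fun s ↦ (s, t)) 0 (hs 0 t)).deriv
  simp only [e1, e2]
  have e3 := (((hd2 (0, 0)).comp_hasDerivAt (f := fun s : ℝ ↦ (s, (0 : ℝ))) 0 (hs 0 0)).clm_apply
    (hasDerivAt_const 0 ((0, 1) : ℝ × ℝ))).deriv
  have e4 := (((hd2 (0, 0)).comp_hasDerivAt (f := fun t : ℝ ↦ ((0 : ℝ), t)) 0 (ht 0 0)).clm_apply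
    (hasDerivAt_const 0 ((1, 0) : ℝ × ℝ))).deriv
  simp only [Function.comp_def, map_zero, add_zero] at e3 e4
  rw [e3, e4]
  exact (hH.contDiffAt.isSymmSndFDerivAt (by
    rw [minSmoothness_of_isRCLikeNormedField]; exact WithTop.coe_le_coe.2 le_top)).eq _ _

end ParametricDerivatives

/-! ### Smooth curves with given velocity -/

noncomputable section Curves

open Set Filter MeasureTheory
open scoped Topology

variable {E : Type*} [NormedAddCommGroup E] [NormedSpace ℝ E]
variable {M : Type*} [TopologicalSpace M] [ChartedSpace E M]

/-- Smooth curves `c` through the point `x` with velocity `v` there; the velocity is recorded by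
its action on functions. -/
structure IsCurveAt (c : ℝ → M) (x : M) (v : TangentSpace 𝓘(ℝ, E) x) : Prop where
  contMDiff : ContMDiff 𝓘(ℝ, ℝ) 𝓘(ℝ, E) ∞ c
  map_zero : c 0 = x
  hasDerivAt : ∀ g : M → ℝ, MDifferentiableAt 𝓘(ℝ, E) 𝓘(ℝ, ℝ) g x →
    HasDerivAt (fun t ↦ g (c t)) (mvfderiv 𝓘(ℝ, E) g x v) 0

lemma isCurveAt_of_mfderiv_eq {c : ℝ → M} {x : M} {v : TangentSpace 𝓘(ℝ, E) x}
    (hc : ContMDiff 𝓘(ℝ, ℝ) 𝓘(ℝ, E) ∞ c) (hx : c 0 = x)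
    (hv : (mfderiv 𝓘(ℝ, ℝ) 𝓘(ℝ, E) c 0 (1 : ℝ) : E) = v) : IsCurveAt c x v := by
  subst hx
  refine ⟨hc, rfl, fun g hg ↦ ?_⟩
  have hcd : MDifferentiableAt 𝓘(ℝ, ℝ) 𝓘(ℝ, E) c 0 := (hc 0).mdifferentiableAt (by simp)
  let T : ℝ →L[ℝ] ℝ :=
    (mfderiv 𝓘(ℝ, E) 𝓘(ℝ, ℝ) g (c 0)).comp (mfderiv 𝓘(ℝ, ℝ) 𝓘(ℝ, E) c 0)
  have h : HasFDerivAt (fun t ↦ g (c t)) T 0 :=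
    (hg.hasMFDerivAt.comp (0 : ℝ) hcd.hasMFDerivAt).hasFDerivAt
  have e : v = mfderiv 𝓘(ℝ, ℝ) 𝓘(ℝ, E) c 0 (1 : ℝ) := hv.symm
  rw [e]
  exact h.hasDerivAt

/-- The curve is the image under a chart of the segment in the direction of `v`, reparametrised by
`ε * sin (t / ε)` in order to stay in the domain of the chart for all times. -/
lemma exists_isCurveAt [IsManifold 𝓘(ℝ, E) ∞ M] (x : M) (v : TangentSpace 𝓘(ℝ, E) x) :
    ∃ c : ℝ → M, IsCurveAt c x v := by
  set φ := extChartAt 𝓘(ℝ, E) x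
  set v' : E := mfderiv 𝓘(ℝ, E) 𝓘(ℝ, E) φ x v
  have hopen : IsOpen φ.target := isOpen_extChartAt_target (I := 𝓘(ℝ, E)) x
  obtain ⟨ε, hε, hball⟩ : ∃ ε > 0, ∀ t : ℝ, |t| ≤ ε → φ x + t • v' ∈ φ.target := by
    have hcont : ContinuousAt (fun t : ℝ ↦ φ x + t • v') 0 := by fun_prop
    have h0 : φ x + (0 : ℝ) • v' ∈ φ.target := by
      rw [zero_smul, add_zero]
      exact mem_extChartAt_target (I := 𝓘(ℝ, E)) x
    obtain ⟨ε, hε, h⟩ := Metric.mem_nhds_iff.1 (hcont (hopen.mem_nhds h0))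
    exact ⟨ε / 2, by positivity, fun t ht ↦ h (by
      rw [Metric.mem_ball, Real.dist_0_eq_abs]; linarith)⟩
  set r : ℝ → E := fun t ↦ φ x + (ε * Real.sin (t / ε)) • v' with hr_def
  have hr : ContDiff ℝ ∞ r := by fun_prop
  have hrm (t : ℝ) : r t ∈ φ.target := hball _ (by
    rw [abs_mul, abs_of_pos hε]
    exact mul_le_of_le_one_right hε.le (Real.abs_sin_le_one _))
  have hr' : HasDerivAt r v' 0 := by
    have h1 : HasDerivAt (fun t : ℝ ↦ ε * Real.sin (t / ε)) 1 0 := by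
      have := ((hasDerivAt_id (0 : ℝ)).div_const ε).sin.const_mul ε
      convert! this using 1
      simp [hε.ne']
    have := (h1.smul_const v').const_add (φ x)
    rwa [one_smul] at this
  set c : ℝ → M := fun t ↦ φ.symm (r t) with hc_def
  have hc : ContMDiff 𝓘(ℝ, ℝ) 𝓘(ℝ, E) ∞ c :=
    (contMDiffOn_extChartAt_symm x).comp_contMDiff hr.contMDiff hrm
  have hc0 : c 0 = x := by
    have : r 0 = φ x := by simp [r]
    rw [hc_def]
    simp only [this]
    exact extChartAt_to_inv (I := 𝓘(ℝ, E)) x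
  refine ⟨c, isCurveAt_of_mfderiv_eq hc hc0 ?_⟩
  have hinj := (isInvertible_mfderiv_extChartAt (I := 𝓘(ℝ, E)) (mem_extChartAt_source x)).injective
  apply hinj
  have hφ : MDifferentiableAt 𝓘(ℝ, E) 𝓘(ℝ, E) φ x := mdifferentiableAt_extChartAt (mem_chart_source E x)
  have h1 := mfderiv_comp_apply_of_eq (I := 𝓘(ℝ, ℝ)) (0 : ℝ) hφ ((hc 0).mdifferentiableAt (by simp))
    hc0 (1 : ℝ)
  have h2 : φ ∘ c = r := funext fun t ↦ φ.right_inv (hrm t)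
  rw [h2, mfderiv_eq_fderiv] at h1
  refine h1.symm.trans ?_
  exact hr'.deriv

end Curves

/-! ### Left-invariant and right-invariant vector fields -/

noncomputable section GroupFields

open Set Filter MeasureTheory
open scoped Topology Pointwise

variable {E : Type*} [NormedAddCommGroup E] [NormedSpace ℝ E]

lemma inTangentCoordinates_const {M N : Type*} [TopologicalSpace M] [ChartedSpace E M]
    [IsManifold 𝓘(ℝ, E) 1 M] (a b : M) (ϕ : N → E →L[ℝ] E) (x₀ : N) :
    inTangentCoordinates 𝓘(ℝ, E) 𝓘(ℝ, E) (fun _ ↦ a) (fun _ ↦ b) ϕ x₀ = ϕ := by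
  funext x
  rw [inTangentCoordinates_eq _ _ _ (mem_chart_source E a) (mem_chart_source E b)]
  ext v
  simp only [ContinuousLinearMap.comp_apply]
  rw [(tangentBundleCore 𝓘(ℝ, E) M).coordChange_self _ _ (mem_chart_source E b),
    (tangentBundleCore 𝓘(ℝ, E) M).coordChange_self _ _ (mem_chart_source E a)]

variable {G : Type*} [Group G] [TopologicalSpace G] [ChartedSpace E G]

/-- The right-invariant vector field with value `w` at the identity. -/
def rightInvariantVectorField (w : GroupLieAlgebra 𝓘(ℝ, E) G) (x : G) : TangentSpace 𝓘(ℝ, E) x :=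
  mfderiv 𝓘(ℝ, E) 𝓘(ℝ, E) (fun y : G ↦ y * x) 1 w

/-- The adjoint representation, applied to a fixed vector `v`. -/
def adjointOrbit (v : GroupLieAlgebra 𝓘(ℝ, E) G) (x : G) : GroupLieAlgebra 𝓘(ℝ, E) G :=
  mfderiv 𝓘(ℝ, E) 𝓘(ℝ, E) (fun y : G ↦ x * y * x⁻¹) 1 v

lemma rightInvariantVectorField_one (w : GroupLieAlgebra 𝓘(ℝ, E) G) :
    rightInvariantVectorField w (1 : G) = w := by
  have h : (fun y : G ↦ y * 1) = id := by ext; simp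
  have : mfderiv 𝓘(ℝ, E) 𝓘(ℝ, E) (fun y : G ↦ y * 1) 1 = ContinuousLinearMap.id ℝ E := by
    rw [h, mfderiv_id]; rfl
  exact congrArg (fun T : E →L[ℝ] E ↦ T w) this

lemma mulInvariantVectorField_one (w : GroupLieAlgebra 𝓘(ℝ, E) G) :
    mulInvariantVectorField w (1 : G) = w := by
  have h : (fun y : G ↦ 1 * y) = id := by ext; simp
  have : mfderiv 𝓘(ℝ, E) 𝓘(ℝ, E) (fun y : G ↦ 1 * y) 1 = ContinuousLinearMap.id ℝ E := by
    rw [h, mfderiv_id]; rfl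
  exact congrArg (fun T : E →L[ℝ] E ↦ T w) this

variable [LieGroup 𝓘(ℝ, E) ∞ G]

lemma mdifferentiable_mul_left' (x : G) :
    MDifferentiable 𝓘(ℝ, E) 𝓘(ℝ, E) (fun y : G ↦ x * y) :=
  (contMDiff_mul_left (I := 𝓘(ℝ, E)) (n := ∞)).mdifferentiable (by simp)

lemma mdifferentiable_mul_right' (x : G) :
    MDifferentiable 𝓘(ℝ, E) 𝓘(ℝ, E) (fun y : G ↦ y * x) :=
  (contMDiff_mul_right (I := 𝓘(ℝ, E)) (n := ∞)).mdifferentiable (by simp)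

/-- Left-invariant fields are the combinations of right-invariant ones whose coefficients are given
by the adjoint representation. -/
lemma mulInvariantVectorField_eq_right (v : GroupLieAlgebra 𝓘(ℝ, E) G) (x : G) :
    mulInvariantVectorField v x = rightInvariantVectorField (adjointOrbit v x) x := by
  have h : (fun y : G ↦ x * y) = (fun y ↦ y * x) ∘ (fun y ↦ x * y * x⁻¹) := by
    ext y; simp
  have hc : MDifferentiable 𝓘(ℝ, E) 𝓘(ℝ, E) (fun y : G ↦ x * y * x⁻¹) :=
    (mdifferentiable_mul_right' x⁻¹).comp (mdifferentiable_mul_left' x)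
  have := mfderiv_comp_apply_of_eq (I := 𝓘(ℝ, E)) (1 : G) (mdifferentiable_mul_right' x 1) (hc 1)
    (by simp) v
  rw [← h] at this
  exact this

lemma contMDiff_adjointOrbit (v : GroupLieAlgebra 𝓘(ℝ, E) G) (ℓ : E →L[ℝ] ℝ) :
    ContMDiff 𝓘(ℝ, E) 𝓘(ℝ, ℝ) ∞ (fun x : G ↦ ℓ (adjointOrbit v x)) := by
  intro x₀
  let f : G → G → G := fun x y ↦ x * y * x⁻¹
  have hf : ContMDiff (𝓘(ℝ, E).prod 𝓘(ℝ, E)) 𝓘(ℝ, E) ∞ (Function.uncurry f) :=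
    (contMDiff_fst.mul contMDiff_snd).mul contMDiff_fst.inv
  have h := (hf (x₀, 1)).mfderiv (m := ∞) f (fun _ ↦ (1 : G)) contMDiffAt_const le_rfl
  have e : ∀ (f' : G → G) (ϕ : G → E →L[ℝ] E), f' = (fun _ ↦ 1) →
      inTangentCoordinates 𝓘(ℝ, E) 𝓘(ℝ, E) (fun _ ↦ (1 : G)) f' ϕ x₀ = ϕ := by
    rintro f' ϕ rfl
    exact inTangentCoordinates_const _ _ _ _
  let ϕ : G → E →L[ℝ] E := fun x ↦ mfderiv 𝓘(ℝ, E) 𝓘(ℝ, E) (f x) 1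
  have h : ContMDiffAt 𝓘(ℝ, E) 𝓘(ℝ, E →L[ℝ] E) ∞ ϕ x₀ := by
    rw [← e (fun x ↦ f x 1) ϕ (by ext x; simp [f])]
    exact h
  let v' : E := v
  exact (ℓ.contMDiff (n := ∞)).contMDiffAt.comp x₀ (h.clm_apply (contMDiffAt_const (c := v')))

lemma IsCurveAt.hasDerivAt_mul_left {c : ℝ → G} {v : GroupLieAlgebra 𝓘(ℝ, E) G}
    (hc : IsCurveAt c (1 : G) v) {f : G → ℝ} (hf : ContMDiff 𝓘(ℝ, E) 𝓘(ℝ, ℝ) ∞ f) (x : G) :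
    HasDerivAt (fun t ↦ f (x * c t))
      (mvfderiv 𝓘(ℝ, E) f x (mulInvariantVectorField v x)) 0 := by
  have hfx : MDifferentiable 𝓘(ℝ, E) 𝓘(ℝ, ℝ) f := hf.mdifferentiable (by simp)
  have h := hc.hasDerivAt (f ∘ (fun y ↦ x * y)) ((hfx _).comp _ (mdifferentiable_mul_left' x 1))
  rwa [mvfderiv_comp_apply_of_eq (1 : G) (hfx x) (mdifferentiable_mul_left' x 1) (mul_one x)] at h

lemma IsCurveAt.hasDerivAt_mul_right {c : ℝ → G} {v : GroupLieAlgebra 𝓘(ℝ, E) G}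
    (hc : IsCurveAt c (1 : G) v) {f : G → ℝ} (hf : ContMDiff 𝓘(ℝ, E) 𝓘(ℝ, ℝ) ∞ f) (x : G) :
    HasDerivAt (fun t ↦ f (c t * x))
      (mvfderiv 𝓘(ℝ, E) f x (rightInvariantVectorField v x)) 0 := by
  have hfx : MDifferentiable 𝓘(ℝ, E) 𝓘(ℝ, ℝ) f := hf.mdifferentiable (by simp)
  have h := hc.hasDerivAt (f ∘ (fun y ↦ y * x)) ((hfx _).comp _ (mdifferentiable_mul_right' x 1))
  rwa [mvfderiv_comp_apply_of_eq (1 : G) (hfx x) (mdifferentiable_mul_right' x 1) (one_mul x)] at h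

lemma contMDiff_mvfderiv_left {f : G → ℝ} (hf : ContMDiff 𝓘(ℝ, E) 𝓘(ℝ, ℝ) ∞ f)
    (v : GroupLieAlgebra 𝓘(ℝ, E) G) :
    ContMDiff 𝓘(ℝ, E) 𝓘(ℝ, ℝ) ∞ (fun x ↦ mvfderiv 𝓘(ℝ, E) f x (mulInvariantVectorField v x)) :=
  fun x ↦ ContMDiffAt.mvfderiv_apply hf (smoothVF_mulInvariantVectorField v x)

lemma contMDiff_mvfderiv_right {f : G → ℝ} (hf : ContMDiff 𝓘(ℝ, E) 𝓘(ℝ, ℝ) ∞ f)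
    (w : GroupLieAlgebra 𝓘(ℝ, E) G) :
    ContMDiff 𝓘(ℝ, E) 𝓘(ℝ, ℝ) ∞
      (fun x ↦ mvfderiv 𝓘(ℝ, E) f x (rightInvariantVectorField w x)) := by
  obtain ⟨c, hc⟩ := exists_isCurveAt (1 : G) w
  have hH : ContMDiff (𝓘(ℝ, ℝ).prod 𝓘(ℝ, E)) 𝓘(ℝ, ℝ) ∞
      (Function.uncurry fun (t : ℝ) (x : G) ↦ f (c t * x)) :=
    hf.comp ((hc.contMDiff.comp contMDiff_fst).mul contMDiff_snd)
  have h := (contMDiff_deriv_param hH).comp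
    (contMDiff_const (c := (0 : ℝ)).prodMk (contMDiff_id (M := G) (I := 𝓘(ℝ, E))))
  convert! h using 1
  ext x
  exact (hc.hasDerivAt_mul_right hf x).deriv.symm

/-- Left-invariant and right-invariant derivations commute. -/
lemma mvfderiv_left_right_comm {f : G → ℝ} (hf : ContMDiff 𝓘(ℝ, E) 𝓘(ℝ, ℝ) ∞ f)
    (v w : GroupLieAlgebra 𝓘(ℝ, E) G) (x : G) :
    mvfderiv 𝓘(ℝ, E) (fun x ↦ mvfderiv 𝓘(ℝ, E) f x (rightInvariantVectorField w x)) x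
        (mulInvariantVectorField v x) =
      mvfderiv 𝓘(ℝ, E) (fun x ↦ mvfderiv 𝓘(ℝ, E) f x (mulInvariantVectorField v x)) x
        (rightInvariantVectorField w x) := by
  obtain ⟨c, hc⟩ := exists_isCurveAt (1 : G) v
  obtain ⟨d, hd⟩ := exists_isCurveAt (1 : G) w
  rw [← (hc.hasDerivAt_mul_left (contMDiff_mvfderiv_right hf w) x).deriv,
    ← (hd.hasDerivAt_mul_right (contMDiff_mvfderiv_left hf v) x).deriv]
  simp only [← fun y ↦ (hd.hasDerivAt_mul_right hf y).deriv,
    ← fun y ↦ (hc.hasDerivAt_mul_left hf y).deriv]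
  have hH : ContMDiff (𝓘(ℝ, ℝ).prod 𝓘(ℝ, ℝ)) 𝓘(ℝ, ℝ) ∞
      (Function.uncurry fun s t : ℝ ↦ f (d t * (x * c s))) :=
    hf.comp ((hd.contMDiff.comp contMDiff_snd).mul
      (contMDiff_const.mul (hc.contMDiff.comp contMDiff_fst)))
  rw [← modelWithCornersSelf_prod, chartedSpaceSelf_prod] at hH
  have h := deriv_deriv_comm hH.contDiff
  simpa only [mul_assoc] using h

end GroupFields

/-! ### Unimodularity of the Lie algebra -/

noncomputable section Unimodularity

open Set Filter MeasureTheory Measure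
open scoped Topology Pointwise

variable {E : Type*} [NormedAddCommGroup E] [NormedSpace ℝ E]
variable {G : Type*} [Group G] [TopologicalSpace G] [ChartedSpace E G] [LieGroup 𝓘(ℝ, E) ∞ G]

section Integrals

variable [FiniteDimensional ℝ E] [T2Space G] [SecondCountableTopology G] [MeasurableSpace G] [BorelSpace G]

omit [FiniteDimensional ℝ E] in
lemma integral_mvfderiv_left (μ : Measure G) [IsFiniteMeasureOnCompacts μ] [IsMulRightInvariant μ]
    {f : G → ℝ} (hf : ContMDiff 𝓘(ℝ, E) 𝓘(ℝ, ℝ) ∞ f) (hfc : HasCompactSupport f)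
    (v : GroupLieAlgebra 𝓘(ℝ, E) G) :
    ∫ x, mvfderiv 𝓘(ℝ, E) f x (mulInvariantVectorField v x) ∂μ = 0 := by
  have : IsTopologicalGroup G := topologicalGroup_of_lieGroup 𝓘(ℝ, E) ∞
  obtain ⟨c, hc⟩ := exists_isCurveAt (1 : G) v
  have hH : ContMDiff (𝓘(ℝ, ℝ).prod 𝓘(ℝ, E)) 𝓘(ℝ, ℝ) ∞
      (Function.uncurry fun (t : ℝ) (x : G) ↦ f (x * c t)) :=
    hf.comp (contMDiff_snd.mul (hc.contMDiff.comp contMDiff_fst))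
  have hK : IsCompact (tsupport f * (c '' Icc (-1) 1)⁻¹) :=
    hfc.isCompact.mul (isCompact_Icc.image hc.contMDiff.continuous).inv
  have h := hasDerivAt_integral_param μ hH hK fun t ht x hx ↦ by
    by_contra h0
    refine hx ⟨x * c t, subset_tsupport f h0, (c t)⁻¹, Set.inv_mem_inv.2 ⟨t, ht, rfl⟩, by simp⟩
  simp only [fun x ↦ (hc.hasDerivAt_mul_left hf x).deriv, integral_mul_right_eq_self] at h
  exact h.unique (hasDerivAt_const _ _)

omit [FiniteDimensional ℝ E] in
lemma integral_mvfderiv_right (μ : Measure G) [IsFiniteMeasureOnCompacts μ] [IsMulLeftInvariant μ]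
    {f : G → ℝ} (hf : ContMDiff 𝓘(ℝ, E) 𝓘(ℝ, ℝ) ∞ f) (hfc : HasCompactSupport f)
    (w : GroupLieAlgebra 𝓘(ℝ, E) G) :
    ∫ x, mvfderiv 𝓘(ℝ, E) f x (rightInvariantVectorField w x) ∂μ = 0 := by
  have : IsTopologicalGroup G := topologicalGroup_of_lieGroup 𝓘(ℝ, E) ∞
  obtain ⟨c, hc⟩ := exists_isCurveAt (1 : G) w
  have hH : ContMDiff (𝓘(ℝ, ℝ).prod 𝓘(ℝ, E)) 𝓘(ℝ, ℝ) ∞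
      (Function.uncurry fun (t : ℝ) (x : G) ↦ f (c t * x)) :=
    hf.comp ((hc.contMDiff.comp contMDiff_fst).mul contMDiff_snd)
  have hK : IsCompact ((c '' Icc (-1) 1)⁻¹ * tsupport f) :=
    (isCompact_Icc.image hc.contMDiff.continuous).inv.mul hfc.isCompact
  have h := hasDerivAt_integral_param μ hH hK fun t ht x hx ↦ by
    by_contra h0
    refine hx ⟨(c t)⁻¹, Set.inv_mem_inv.2 ⟨t, ht, rfl⟩, c t * x, subset_tsupport f h0, by simp⟩
  simp only [fun x ↦ (hc.hasDerivAt_mul_right hf x).deriv, integral_mul_left_eq_self] at h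
  exact h.unique (hasDerivAt_const _ _)

end Integrals

variable {ι : Type*} [Fintype ι] (b : Module.Basis ι ℝ (GroupLieAlgebra 𝓘(ℝ, E) G))

/-- The coordinates of the adjoint orbit of `v`. -/
def adjointCoord (v : GroupLieAlgebra 𝓘(ℝ, E) G) (j : ι) (x : G) : ℝ := b.repr (adjointOrbit v x) j

omit [Fintype ι] in
lemma contMDiff_adjointCoord [FiniteDimensional ℝ E] (v : GroupLieAlgebra 𝓘(ℝ, E) G) (j : ι) :
    ContMDiff 𝓘(ℝ, E) 𝓘(ℝ, ℝ) ∞ (adjointCoord b v j) :=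
  let ℓ : E →ₗ[ℝ] ℝ := b.coord j
  contMDiff_adjointOrbit v (LinearMap.toContinuousLinearMap ℓ)

lemma mvfderiv_left_eq_sum [FiniteDimensional ℝ E] (f : G → ℝ) (v : GroupLieAlgebra 𝓘(ℝ, E) G) (x : G) :
    mvfderiv 𝓘(ℝ, E) f x (mulInvariantVectorField v x) =
      ∑ j, adjointCoord b v j x *
        mvfderiv 𝓘(ℝ, E) f x (rightInvariantVectorField (b j) x) := by
  let T : GroupLieAlgebra 𝓘(ℝ, E) G →L[ℝ] ℝ := (mvfderiv 𝓘(ℝ, E) f x).comp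
    (mfderiv 𝓘(ℝ, E) 𝓘(ℝ, E) (fun y : G ↦ y * x) 1)
  have h : T (adjointOrbit v x) = ∑ j, adjointCoord b v j x * T (b j) := by
    conv_lhs => rw [← b.sum_repr (adjointOrbit v x)]
    simp only [_root_.map_sum, _root_.map_smul, smul_eq_mul, adjointCoord]
  rw [mulInvariantVectorField_eq_right]
  exact h

lemma mvfderiv_sum_mul {M : Type*} [TopologicalSpace M] [ChartedSpace E M] {a g : ι → M → ℝ} {x : M}
    (ha : ∀ j, MDifferentiableAt 𝓘(ℝ, E) 𝓘(ℝ, ℝ) (a j) x)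
    (hg : ∀ j, MDifferentiableAt 𝓘(ℝ, E) 𝓘(ℝ, ℝ) (g j) x) (u : TangentSpace 𝓘(ℝ, E) x) :
    mvfderiv 𝓘(ℝ, E) (fun y ↦ ∑ j, a j y * g j y) x u =
      ∑ j, (a j x * mvfderiv 𝓘(ℝ, E) (g j) x u + g j x * mvfderiv 𝓘(ℝ, E) (a j) x u) := by
  have key (s : Finset ι) : MDifferentiableAt 𝓘(ℝ, E) 𝓘(ℝ, ℝ) (fun y ↦ ∑ j ∈ s, a j y * g j y) x ∧
      mvfderiv 𝓘(ℝ, E) (fun y ↦ ∑ j ∈ s, a j y * g j y) x u =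
      ∑ j ∈ s, (a j x * mvfderiv 𝓘(ℝ, E) (g j) x u + g j x * mvfderiv 𝓘(ℝ, E) (a j) x u) := by
    classical
    induction s using Finset.induction_on with
    | empty => simpa using ⟨mdifferentiableAt_const, by rw [mvfderiv_const]; rfl⟩
    | insert j s hj ih =>
      simp only [Finset.sum_insert hj]
      have hm : MDifferentiableAt 𝓘(ℝ, E) 𝓘(ℝ, ℝ) (fun y ↦ a j y * g j y) x := (ha j).mul (hg j)
      have e1 := mvfderiv_add hm ih.1
      have e2 := mvfderiv_mul (ha j) (hg j)
      refine ⟨hm.add ih.1, ?_⟩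
      change mvfderiv 𝓘(ℝ, E) ((fun y ↦ a j y * g j y) + fun y ↦ ∑ j ∈ s, a j y * g j y) x u = _
      rw [e1, _root_.add_apply, ih.2]
      change mvfderiv 𝓘(ℝ, E) (a j * g j) x u + _ = _
      rw [e2]
      simp
  exact (key Finset.univ).2

/-- The adjoint action in terms of the derivative of the adjoint orbit. -/
lemma bracket_eq_sum [FiniteDimensional ℝ E] [T2Space G] (u v : GroupLieAlgebra 𝓘(ℝ, E) G) :
    ⁅u, v⁆ = (∑ j, mvfderiv 𝓘(ℝ, E) (adjointCoord b v j) (1 : G) u • b j) := by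
  apply eq_of_forall_mvfderiv_eq (M := G)
  intro f hf
  rw [GroupLieAlgebra.bracket_def, mvfderiv_mlieBracket (smoothVF_mulInvariantVectorField u)
    (smoothVF_mulInvariantVectorField v) hf]
  have hR (j : ι) := contMDiff_mvfderiv_right hf (b j)
  have ha := contMDiff_adjointCoord b v
  rw [show (fun y ↦ mvfderiv 𝓘(ℝ, E) f y (mulInvariantVectorField v y)) = _ from
      funext fun y ↦ mvfderiv_left_eq_sum b f v y,
    mvfderiv_sum_mul (fun j ↦ (ha j 1).mdifferentiableAt (by simp))
      (fun j ↦ (hR j 1).mdifferentiableAt (by simp)), Finset.sum_add_distrib]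
  simp only [mvfderiv_left_right_comm hf]
  rw [← mvfderiv_left_eq_sum b, add_sub_cancel_left]
  simp only [rightInvariantVectorField_one, mulInvariantVectorField_one]
  simp [mul_comm]

section Integrals

variable [FiniteDimensional ℝ E] [T2Space G] [SecondCountableTopology G] [MeasurableSpace G]
  [BorelSpace G]

omit [FiniteDimensional ℝ E] in
lemma mvfderiv_eq_zero_of_notMem_tsupport {M : Type*} [TopologicalSpace M] [ChartedSpace E M]
    {f : M → ℝ} {x : M} (hx : x ∉ tsupport f) : mvfderiv 𝓘(ℝ, E) f x = 0 := by
  have h : f =ᶠ[𝓝 x] fun _ ↦ 0 := notMem_tsupport_iff_eventuallyEq.1 hx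
  ext v
  have h1 := h.mfderiv_eq (I := 𝓘(ℝ, E)) (I' := 𝓘(ℝ, ℝ))
  rw [mfderiv_const] at h1
  exact congrArg (fun T : E →L[ℝ] ℝ ↦ T v) h1

omit [Group G] [LieGroup 𝓘(ℝ, E) ∞ G] [SecondCountableTopology G] [FiniteDimensional ℝ E] in
lemma integrable_mvfderiv (μ : Measure G) [IsFiniteMeasureOnCompacts μ]
    {f : G → ℝ} (hfc : HasCompactSupport f) {X : HermGeom.VField E G}
    (hf : Continuous fun x ↦ mvfderiv 𝓘(ℝ, E) f x (X x)) :
    Integrable (fun x ↦ mvfderiv 𝓘(ℝ, E) f x (X x)) μ :=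
  hf.integrable_of_hasCompactSupport <| HasCompactSupport.intro hfc fun x hx ↦ by
    rw [mvfderiv_eq_zero_of_notMem_tsupport hx, zero_apply]

/-- The Lie algebra of a unimodular Lie group is unimodular: integration by parts along the
left-invariant field of `v`, expanded in right-invariant fields, shows that the divergence of the
coefficients of the expansion has integral zero against every test function. -/
lemma sum_mvfderiv_adjointCoord_eq_zero (μ : Measure G) [IsHaarMeasure μ] [IsMulRightInvariant μ]
    (v : GroupLieAlgebra 𝓘(ℝ, E) G) :
    ∑ j, mvfderiv 𝓘(ℝ, E) (adjointCoord b v j) (1 : G) (b j) = 0 := by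
  have : IsTopologicalGroup G := topologicalGroup_of_lieGroup 𝓘(ℝ, E) ∞
  have : LocallyCompactSpace G := Manifold.locallyCompact_of_finiteDimensional 𝓘(ℝ, E)
  have ha := contMDiff_adjointCoord b v
  let h : G → ℝ := fun x ↦
    ∑ j, mvfderiv 𝓘(ℝ, E) (adjointCoord b v j) x (rightInvariantVectorField (b j) x)
  have hcont : Continuous h := continuous_finsetSum _ fun j _ ↦
    (contMDiff_mvfderiv_right (ha j) (b j)).continuous
  have hae : h =ᵐ[μ] fun _ ↦ 0 := by
    refine ae_eq_zero_of_integral_contMDiff_smul_eq_zero 𝓘(ℝ, E) hcont.locallyIntegrable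
      fun g hg hgc ↦ ?_
    have hag (j : ι) : ContMDiff 𝓘(ℝ, E) 𝓘(ℝ, ℝ) ∞ (adjointCoord b v j * g) := (ha j).mul hg
    have hagc (j : ι) : HasCompactSupport (adjointCoord b v j * g) := hgc.mul_left
    have e (x : G) : g x • h x =
        ∑ j, mvfderiv 𝓘(ℝ, E) (adjointCoord b v j * g) x
          (rightInvariantVectorField (b j) x)
        - mvfderiv 𝓘(ℝ, E) g x (mulInvariantVectorField v x) := by
      rw [mvfderiv_left_eq_sum b, ← Finset.sum_sub_distrib, smul_eq_mul, Finset.mul_sum]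
      refine Finset.sum_congr rfl fun j _ ↦ ?_
      rw [mvfderiv_mul ((ha j x).mdifferentiableAt (by simp)) ((hg x).mdifferentiableAt (by simp))]
      simp
    have i1 (j : ι) := integrable_mvfderiv μ (hagc j)
      (contMDiff_mvfderiv_right (hag j) (b j)).continuous
    have i2 := integrable_mvfderiv μ hgc (contMDiff_mvfderiv_left hg v).continuous
    simp only [e]
    rw [integral_sub (integrable_finsetSum _ fun j _ ↦ i1 j) i2,
      integral_finsetSum _ fun j _ ↦ i1 j, integral_mvfderiv_left μ hg hgc]
    simp only [fun j ↦ integral_mvfderiv_right μ (hag j) (hagc j) (b j)]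
    simp
  have h0 := congrFun ((hcont.ae_eq_iff_eq μ continuous_const).1 hae) 1
  simpa only [h, rightInvariantVectorField_one] using h0

end Integrals

/-- If a Lie group has a discrete cocompact subgroup, then its Lie algebra is unimodular. -/
theorem trace_ad_eq_zero_of_compact_quotient [FiniteDimensional ℝ E] [T2Space G]
    [SecondCountableTopology G] {M : Type*} [TopologicalSpace M] [CompactSpace M]
    [ChartedSpace E M] {Γ : Subgroup G} {p : G → M} (hp : HermGeom.IsQuotientBy (E := E) Γ p)
    (v : GroupLieAlgebra 𝓘(ℝ, E) G) :
    LinearMap.trace ℝ (GroupLieAlgebra 𝓘(ℝ, E) G)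
  (LieAlgebra.ad ℝ (GroupLieAlgebra 𝓘(ℝ, E) G) v) = 0 := by
  have : IsTopologicalGroup G := topologicalGroup_of_lieGroup 𝓘(ℝ, E) ∞
  have : LocallyCompactSpace G := Manifold.locallyCompact_of_finiteDimensional 𝓘(ℝ, E)
  borelize G
  have : DiscreteTopology Γ := hp.discrete
  have hinj (x : G) : ∃ U ∈ 𝓝 x, InjOn p U := by
    obtain ⟨Φ, hx, hΦ⟩ := hp.localDiffeo x
    exact ⟨Φ.source, Φ.open_source.mem_nhds hx, hΦ.injOn_iff.2 Φ.injOn⟩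
  have := isMulRightInvariant_of_compact_quotient (haar (G := G)) Γ
    hp.localDiffeo.contMDiff.continuous hp.localDiffeo.isOpenMap hinj hp.surjective hp.fibre
  have : FiniteDimensional ℝ (GroupLieAlgebra 𝓘(ℝ, E) G) := inferInstanceAs (FiniteDimensional ℝ E)
  let b := Module.finBasis ℝ (GroupLieAlgebra 𝓘(ℝ, E) G)
  rw [LinearMap.trace_eq_matrix_trace ℝ b, Matrix.trace, ← neg_eq_zero, ← Finset.sum_neg_distrib,
    ← sum_mvfderiv_adjointCoord_eq_zero b haar v]
  refine Finset.sum_congr rfl fun j _ ↦ ?_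
  rw [Matrix.diag_apply, LinearMap.toMatrix_apply, LieAlgebra.ad_apply, ← lie_skew,
    bracket_eq_sum b]
  simp [Finsupp.single_apply]

end Unimodularity

/-! ### Invariant frames on the quotient -/

noncomputable section InvariantFrames

open Set Filter
open scoped Topology

variable {E : Type*} [NormedAddCommGroup E] [NormedSpace ℝ E]
variable {M : Type*} [TopologicalSpace M] [ChartedSpace E M]

attribute [local instance] isManifold_minSmoothness_three

namespace HermGeom

/-- An invariant global frame of a Hermitian manifold, modelled on a Lie algebra `W` with a
Hermitian structure `L`: each `w : W` gives a smooth vector field, and the metric, the complex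
structure and the brackets of these fields are given by those of `L`. -/
structure HermitianStructure.Frame [IsManifold 𝓘(ℝ, E) 1 M] (h : HermitianStructure E M)
    {W : Type*} [NormedAddCommGroup W] [InnerProductSpace ℝ W] (L : HermitianLieAlgebra W) where
  /-- the value at `x` of the vector field given by an element of `W` -/
  eval (x : M) : W →ₗ[ℝ] TangentSpace 𝓘(ℝ, E) x
  surjective (x : M) : Function.Surjective (eval x)
  smooth (w : W) : SmoothVF fun x ↦ eval x w
  inner_eval (x : M) (v w : W) : h.g.inner x (eval x v) (eval x w) = inner ℝ v w
  J_eval (x : M) (w : W) : h.J x (eval x w) = eval x (L.J w)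
  mlieBracket_eval (x : M) (v w : W) :
    mlieBracket 𝓘(ℝ, E) (fun x ↦ eval x v) (fun x ↦ eval x w) x = eval x (L.br v w)

variable {G : Type*} [Group G] [TopologicalSpace G] [ChartedSpace E G] {Γ : Subgroup G} {p : G → M}

namespace IsQuotientBy

/-- The left-invariant vector field of `v`, descended to the quotient. -/
def field (hp : IsQuotientBy (E := E) Γ p) (v : GroupLieAlgebra 𝓘(ℝ, E) G) : VField E M := fun y ↦
  (mfderiv 𝓘(ℝ, E) 𝓘(ℝ, E) p (Function.surjInv hp.surjective y)
    (mulInvariantVectorField v (Function.surjInv hp.surjective y)) : E)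

variable [LieGroup 𝓘(ℝ, E) ∞ G] (hp : IsQuotientBy (E := E) Γ p)

omit [LieGroup 𝓘(ℝ, E) ∞ G] in
include hp in
lemma mdifferentiable : MDifferentiable 𝓘(ℝ, E) 𝓘(ℝ, E) p :=
  hp.localDiffeo.contMDiff.mdifferentiable (by simp)

lemma _root_.mfderiv_mul_left_mulInvariantVectorField (v : GroupLieAlgebra 𝓘(ℝ, E) G) (a x : G) :
    mfderiv 𝓘(ℝ, E) 𝓘(ℝ, E) (fun y : G ↦ a * y) x (mulInvariantVectorField v x) =
      mulInvariantVectorField v (a * x) := by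
  have h : (fun y : G ↦ a * x * y) = (fun y ↦ a * y) ∘ (fun y ↦ x * y) := by
    ext y; simp [mul_assoc]
  have := mfderiv_comp_apply_of_eq (I := 𝓘(ℝ, E)) (1 : G) (mdifferentiable_mul_left' a x)
    (mdifferentiable_mul_left' x 1) (mul_one x) v
  rw [← h] at this
  exact this.symm

lemma field_apply (v : GroupLieAlgebra 𝓘(ℝ, E) G) (x : G) :
    hp.field v (p x) = mfderiv 𝓘(ℝ, E) 𝓘(ℝ, E) p x (mulInvariantVectorField v x) := by
  obtain ⟨γ, hγ, hγx⟩ := (hp.fibre x (Function.surjInv hp.surjective (p x))).1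
    (Function.surjInv_eq hp.surjective (p x)).symm
  have h : p ∘ (fun y ↦ γ * y) = p := funext fun y ↦ ((hp.fibre y (γ * y)).2 ⟨γ, hγ, rfl⟩).symm
  have h1 := mfderiv_comp_apply (I := 𝓘(ℝ, E)) (I' := 𝓘(ℝ, E)) x (hp.mdifferentiable (γ * x))
    (mdifferentiable_mul_left' γ x) (mulInvariantVectorField v x)
  rw [h, mfderiv_mul_left_mulInvariantVectorField] at h1
  refine Eq.trans ?_ h1.symm
  rw [field]
  exact hγx ▸ rfl

lemma smoothVF_field [IsManifold 𝓘(ℝ, E) ∞ M] (v : GroupLieAlgebra 𝓘(ℝ, E) G) :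
    SmoothVF (hp.field v) := by
  intro y
  obtain ⟨x, rfl⟩ := hp.surjective y
  have hx := hp.localDiffeo x
  have h1 : ContMDiff 𝓘(ℝ, E) 𝓘(ℝ, E).tangent ∞ (fun z : G ↦
      tangentMap 𝓘(ℝ, E) 𝓘(ℝ, E) p ⟨z, mulInvariantVectorField v z⟩) :=
    (hp.localDiffeo.contMDiff.contMDiff_tangentMap (m := ∞) le_rfl).comp
      (smoothVF_mulInvariantVectorField v)
  have h2 := h1.contMDiffAt.comp (p x) hx.localInverse_contMDiffAt
  refine h2.congr_of_eventuallyEq ?_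
  filter_upwards [hx.localInverse_eventuallyEq_right] with z hz
  have hz' : p (hx.localInverse z) = z := hz
  have e : tangentMap 𝓘(ℝ, E) 𝓘(ℝ, E) p ⟨hx.localInverse z, mulInvariantVectorField v
      (hx.localInverse z)⟩ = ⟨p (hx.localInverse z), hp.field v (p (hx.localInverse z))⟩ := by
    rw [hp.field_apply]
    rfl
  simp only [Function.comp_apply]
  rw [e, hz']

lemma mlieBracket_field [FiniteDimensional ℝ E] [IsManifold 𝓘(ℝ, E) ∞ M]
    (v w : GroupLieAlgebra 𝓘(ℝ, E) G) :
    mlieBracket 𝓘(ℝ, E) (hp.field v) (hp.field w) = hp.field ⁅v, w⁆ := by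
  funext y
  obtain ⟨x, rfl⟩ := hp.surjective y
  have hinv (x : G) : (mfderiv 𝓘(ℝ, E) 𝓘(ℝ, E) p x).IsInvertible :=
    ⟨hp.localDiffeo.mfderivToContinuousLinearEquiv (by simp) x,
      hp.localDiffeo.mfderivToContinuousLinearEquiv_coe (by simp) x⟩
  have hpull (u : GroupLieAlgebra 𝓘(ℝ, E) G) :
      mpullback 𝓘(ℝ, E) 𝓘(ℝ, E) p (hp.field u) = mulInvariantVectorField u := by
    funext x
    rw [mpullback_apply, hp.field_apply]
    exact (hinv x).inverse_apply_eq.2 rfl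
  have := mpullback_mlieBracket (n := ∞) ((hp.smoothVF_field v).mdifferentiableAt (p x))
    ((hp.smoothVF_field w).mdifferentiableAt (p x)) (hp.localDiffeo.contMDiff x)
    (by rw [minSmoothness_of_isRCLikeNormedField]; exact WithTop.coe_le_coe.2 le_top)
  rw [hpull, hpull, ← mulInvariantVector_mlieBracket, mpullback_apply,
    (hinv x).inverse_apply_eq] at this
  rw [this, hp.field_apply]
  rfl

lemma field_add (v w : GroupLieAlgebra 𝓘(ℝ, E) G) (y : M) :
    hp.field (v + w) y = hp.field v y + hp.field w y := by
  obtain ⟨x, rfl⟩ := hp.surjective y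
  simp only [field_apply, mulInvariantVectorField_add, Pi.add_apply, map_add]

lemma field_smul (t : ℝ) (v : GroupLieAlgebra 𝓘(ℝ, E) G) (y : M) :
    hp.field (t • v) y = t • hp.field v y := by
  obtain ⟨x, rfl⟩ := hp.surjective y
  simp only [field_apply, mulInvariantVectorField_smul, Pi.smul_apply, map_smul]

variable [IsManifold 𝓘(ℝ, E) 1 M] {hG : HermitianStructure E G} (hinv : hG.IsLeftInvariant)
  {hM : HermitianStructure E M} (hlift : hG.IsLift hM p)

include hinv hlift in
lemma inner_field (v w : GroupLieAlgebra 𝓘(ℝ, E) G) (y : M) :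
    hM.g.inner y (hp.field v y) (hp.field w y) = hG.g.inner 1 v w := by
  obtain ⟨x, rfl⟩ := hp.surjective y
  rw [hp.field_apply, hp.field_apply, (hlift x _ _).2, ← (hinv x 1 v w).2]
  have e : ∀ z : G, z = x → ∀ a b : E, hG.g.inner x a b = hG.g.inner z a b := by
    rintro z rfl a b; rfl
  exact e _ (mul_one x) _ _

include hinv hlift in
lemma J_field (v : GroupLieAlgebra 𝓘(ℝ, E) G) (y : M) :
    hM.J y (hp.field v y) = hp.field (hG.J 1 v) y := by
  obtain ⟨x, rfl⟩ := hp.surjective y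
  rw [hp.field_apply, hp.field_apply, ← (hlift x _ (mulInvariantVectorField v x)).1]
  congr 1
  refine Eq.trans ?_ (hinv x 1 v v).1.symm
  have e : ∀ z : G, z = x → ∀ a : E, (hG.J x a : E) = hG.J z a := by
    rintro z rfl a; rfl
  exact e _ (mul_one x) _

end IsQuotientBy

/-- The Lie algebra of `G`, with the scalar product at the identity carried to a Euclidean space,
gives an invariant frame on the quotient. -/
theorem IsQuotientBy.exists_frame [FiniteDimensional ℝ E] [T2Space G] [SecondCountableTopology G]
    [LieGroup 𝓘(ℝ, E) ∞ G] [CompactSpace M] [IsManifold 𝓘(ℝ, E) ∞ M]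
    (hp : IsQuotientBy (E := E) Γ p)
    {hG : HermitianStructure E G} (hinv : hG.IsLeftInvariant)
    {hM : HermitianStructure E M} (hlift : hG.IsLift hM p)
    (𝔞 : LieIdeal ℝ (GroupLieAlgebra 𝓘(ℝ, E) G)) (h𝔞 : IsLieAbelian 𝔞)
    (hcodim : Module.finrank ℝ (GroupLieAlgebra 𝓘(ℝ, E) G ⧸ 𝔞) = 1 ∨
      (Module.finrank ℝ (GroupLieAlgebra 𝓘(ℝ, E) G ⧸ 𝔞) = 2 ∧
        𝔞.toSubmodule.map (hG.J 1).toLinearMap = 𝔞.toSubmodule)) :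
    ∃ L : HermitianLieAlgebra
        (EuclideanSpace ℝ (Fin (Module.finrank ℝ (GroupLieAlgebra 𝓘(ℝ, E) G)))),
      Nonempty (hM.Frame L) ∧ Nonempty L.AdaptedIdeal ∧
        ∀ a, LinearMap.trace ℝ _ (L.br a) = 0 := by
  have : FiniteDimensional ℝ (GroupLieAlgebra 𝓘(ℝ, E) G) := inferInstanceAs (FiniteDimensional ℝ E)
  obtain ⟨φ, hφ⟩ := exists_linearEquiv_euclideanSpace (V := GroupLieAlgebra 𝓘(ℝ, E) G)
    (fun a b ↦ hG.g.inner 1 a b) (hG.g.symm 1) (fun a b c ↦ by simp) (fun t a b ↦ by simp)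
    (hG.g.pos 1)
  let eval (x : M) : EuclideanSpace ℝ (Fin (Module.finrank ℝ (GroupLieAlgebra 𝓘(ℝ, E) G))) →ₗ[ℝ]
      TangentSpace 𝓘(ℝ, E) x :=
    { toFun := fun w ↦ hp.field (φ w) x
      map_add' := fun v w ↦ by rw [map_add, hp.field_add]
      map_smul' := fun t v ↦ by rw [map_smul, hp.field_smul]; rfl }
  have inner_eval (x : M) (v w) : hM.g.inner x (eval x v) (eval x w) = inner ℝ v w := by
    rw [← hφ]; exact hp.inner_field hinv hlift _ _ _
  have eval_inj (x : M) : Function.Injective (eval x) := by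
    rw [← LinearMap.ker_eq_bot, LinearMap.ker_eq_bot']
    intro w hw
    have h := inner_eval x w w
    rw [hw, map_zero] at h
    exact inner_self_eq_zero.1 h.symm
  let br : EuclideanSpace ℝ (Fin (Module.finrank ℝ (GroupLieAlgebra 𝓘(ℝ, E) G))) →ₗ[ℝ]
      EuclideanSpace ℝ (Fin (Module.finrank ℝ (GroupLieAlgebra 𝓘(ℝ, E) G))) →ₗ[ℝ]
      EuclideanSpace ℝ (Fin (Module.finrank ℝ (GroupLieAlgebra 𝓘(ℝ, E) G))) :=
    LinearMap.mk₂ ℝ (fun v w ↦ φ.symm ⁅φ v, φ w⁆) (by simp) (by simp) (by simp) (by simp)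
  have br_eval (x : M) (v w) :
      mlieBracket 𝓘(ℝ, E) (fun x ↦ eval x v) (fun x ↦ eval x w) x = eval x (br v w) := by
    have := congrFun (hp.mlieBracket_field (φ v) (φ w)) x
    simpa [eval, br] using this
  let J : EuclideanSpace ℝ (Fin (Module.finrank ℝ (GroupLieAlgebra 𝓘(ℝ, E) G))) →ₗ[ℝ]
      EuclideanSpace ℝ (Fin (Module.finrank ℝ (GroupLieAlgebra 𝓘(ℝ, E) G))) :=
    φ.symm.toLinearMap ∘ₗ (hG.J 1).toLinearMap ∘ₗ φ.toLinearMap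
  have J_eval (x : M) (w) : hM.J x (eval x w) = eval x (J w) := by
    have := hp.J_field hinv hlift (φ w) x
    simpa [eval, J] using this
  have smooth (w) : SmoothVF fun x ↦ eval x w := hp.smoothVF_field (φ w)
  obtain ⟨y⟩ : Nonempty M := ⟨p 1⟩
  let L : HermitianLieAlgebra
      (EuclideanSpace ℝ (Fin (Module.finrank ℝ (GroupLieAlgebra 𝓘(ℝ, E) G)))) :=
    { br := br
      J := J
      br_self := fun a ↦ by simp [br]
      jacobi := fun a b c ↦ by simp [br]
      J_sq := fun a ↦ by simp [J, hG.J_sq]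
      inner_J_J := fun a b ↦ by simp [← hφ, J, hG.compatible]
      integrable := fun a b ↦ by
        apply eval_inj y
        have h := hM.integrable _ _ (smooth a) (smooth b) y
        simp only [J_eval, br_eval] at h
        simpa using h }
  refine ⟨L, ⟨⟨eval, fun x ↦ ?_, smooth, inner_eval, J_eval, br_eval⟩⟩, ?_, fun a ↦ ?_⟩
  · have : FiniteDimensional ℝ (TangentSpace 𝓘(ℝ, E) x) := inferInstanceAs (FiniteDimensional ℝ E)
    refine (LinearMap.injective_iff_surjective_of_finrank_eq_finrank ?_).1 (eval_inj x)
    rw [finrank_euclideanSpace_fin]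
    rfl
  · have hquot := (Submodule.Quotient.equiv (𝔞.toSubmodule.comap φ.toLinearMap) 𝔞.toSubmodule φ
      (Submodule.map_comap_eq_of_surjective φ.surjective _)).finrank_eq
    refine L.exists_adaptedIdeal (𝔟 := 𝔞.toSubmodule.comap φ.toLinearMap) (fun a u hu ↦ ?_)
      (fun u hu v hv ↦ ?_) (hcodim.imp (fun h ↦ hquot.trans h) fun h ↦ ⟨hquot.trans h.1, fun u hu ↦ ?_⟩)
    · have : ⁅φ a, φ u⁆ ∈ 𝔞 := lie_mem_right ℝ _ 𝔞 _ _ hu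
      simpa [L, br] using this
    · have h1 : (⁅(⟨φ u, hu⟩ : 𝔞), (⟨φ v, hv⟩ : 𝔞)⁆ : 𝔞) = 0 := h𝔞.trivial _ _
      have h2 : ⁅φ u, φ v⁆ = 0 := congrArg Subtype.val h1
      simp [L, br, h2]
    · have : hG.J 1 (φ u) ∈ 𝔞.toSubmodule := h.2 ▸ Submodule.mem_map_of_mem hu
      simpa [L, J] using this
  · have h : L.br a = φ.symm.conj (LieAlgebra.ad ℝ (GroupLieAlgebra 𝓘(ℝ, E) G) (φ a)) := by
      ext1 u
      simp [L, br, LinearEquiv.conj_apply]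
    rw [h, LinearMap.trace_conj', trace_ad_eq_zero_of_compact_quotient hp]

end HermGeom
end InvariantFrames

/-! ### Connections and brackets on combinations of vector fields -/

noncomputable section FrameCalculus

open Set Filter
open scoped Topology

variable {E : Type*} [NormedAddCommGroup E] [NormedSpace ℝ E]
variable {M : Type*} [TopologicalSpace M] [ChartedSpace E M]

namespace HermGeom

section Sums

variable [IsManifold 𝓘(ℝ, E) 1 M]

/-- An operator on vector fields which is additive and satisfies the Leibniz rule, evaluated on a
combination of fields. Covariant derivatives and Lie brackets are of this form. -/
lemma leibniz_sum {x : M} (T : VField E M → TangentSpace 𝓘(ℝ, E) x) (δ : (M → ℝ) → ℝ)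
    (hT0 : T 0 = 0)
    (hTadd : ∀ σ τ : VField E M, MDifferentiableAt 𝓘(ℝ, E) 𝓘(ℝ, E).tangent
        (fun y ↦ (⟨y, σ y⟩ : TangentBundle 𝓘(ℝ, E) M)) x →
      MDifferentiableAt 𝓘(ℝ, E) 𝓘(ℝ, E).tangent
        (fun y ↦ (⟨y, τ y⟩ : TangentBundle 𝓘(ℝ, E) M)) x → T (σ + τ) = T σ + T τ)
    (hTsmul : ∀ (f : M → ℝ) (σ : VField E M), MDifferentiableAt 𝓘(ℝ, E) 𝓘(ℝ, ℝ) f x →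
      MDifferentiableAt 𝓘(ℝ, E) 𝓘(ℝ, E).tangent
        (fun y ↦ (⟨y, σ y⟩ : TangentBundle 𝓘(ℝ, E) M)) x →
      T (f • σ) = δ f • σ x + f x • T σ)
    {ι : Type*} (s : Finset ι) {f : ι → M → ℝ} {σ : ι → VField E M}
    (hf : ∀ i, MDifferentiableAt 𝓘(ℝ, E) 𝓘(ℝ, ℝ) (f i) x)
    (hσ : ∀ i, MDifferentiableAt 𝓘(ℝ, E) 𝓘(ℝ, E).tangent
        (fun y ↦ (⟨y, σ i y⟩ : TangentBundle 𝓘(ℝ, E) M)) x) :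
    T (fun y ↦ ∑ i ∈ s, f i y • σ i y) = ∑ i ∈ s, (δ (f i) • σ i x + f i x • T (σ i)) := by
  classical
  induction s using Finset.induction_on with
  | empty =>
    simp only [Finset.sum_empty]
    exact hT0
  | insert i s hi ih =>
    simp only [Finset.sum_insert hi]
    rw [← ih, ← hTsmul _ _ (hf i) (hσ i)]
    exact hTadd (f i • σ i) (fun y ↦ ∑ i ∈ s, f i y • σ i y) ((hf i).smul_section (hσ i))
      (.sum_section fun j _ ↦ (hf j).smul_section (hσ j))

end Sums

variable [IsManifold 𝓘(ℝ, E) ∞ M] {ι : Type*} [Fintype ι] {f : ι → M → ℝ} {σ : ι → VField E M}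

lemma covariantDerivative_sum (D : Connection E M)
    (hf : ∀ i, ContMDiff 𝓘(ℝ, E) 𝓘(ℝ, ℝ) ∞ (f i)) (hσ : ∀ i, SmoothVF (σ i)) (x : M)
    (v : TangentSpace 𝓘(ℝ, E) x) :
    D (fun y ↦ ∑ i, f i y • σ i y) x v =
      ∑ i, (mvfderiv 𝓘(ℝ, E) (f i) x v • σ i x + f i x • D (σ i) x v) := by
  refine leibniz_sum (fun σ ↦ D σ x v) (fun f ↦ mvfderiv 𝓘(ℝ, E) f x v) ?_ ?_ ?_ Finset.univ
    (fun i ↦ (hf i x).mdifferentiableAt (by simp)) (fun i ↦ (hσ i).mdifferentiableAt x)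
  · simp
  · intro σ τ hσ hτ
    rw [D.isCovariantDerivativeOnUniv.add hσ hτ]; rfl
  · intro f σ hf hσ
    rw [D.isCovariantDerivativeOnUniv.leibniz hσ hf]
    simp [add_comm]

lemma mlieBracket_sum [CompleteSpace E] (X : VField E M)
    (hf : ∀ i, ContMDiff 𝓘(ℝ, E) 𝓘(ℝ, ℝ) ∞ (f i)) (hσ : ∀ i, SmoothVF (σ i)) (x : M) :
    mlieBracket 𝓘(ℝ, E) X (fun y ↦ ∑ i, f i y • σ i y) x =
      ∑ i, (mvfderiv 𝓘(ℝ, E) (f i) x (X x) • σ i x + f i x • mlieBracket 𝓘(ℝ, E) X (σ i) x) := by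
  refine leibniz_sum (fun σ ↦ mlieBracket 𝓘(ℝ, E) X σ x) (fun f ↦ mvfderiv 𝓘(ℝ, E) f x (X x))
    ?_ ?_ ?_ Finset.univ
    (fun i ↦ (hf i x).mdifferentiableAt (by simp)) (fun i ↦ (hσ i).mdifferentiableAt x)
  · simp
  · intro σ τ hσ hτ
    exact mlieBracket_add_right hσ hτ
  · intro f σ hf hσ
    exact mlieBracket_smul_right hf hσ

lemma SmoothVF.sum_smul (hf : ∀ i, ContMDiff 𝓘(ℝ, E) 𝓘(ℝ, ℝ) ∞ (f i)) (hσ : ∀ i, SmoothVF (σ i)) :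
    SmoothVF (fun y ↦ ∑ i, f i y • σ i y) :=
  ContMDiff.sum_section fun i _ ↦ (hf i).smul_section (hσ i)

lemma HermitianStructure.contMDiff_inner (h : HermitianStructure E M) {X Y : VField E M}
    (hX : SmoothVF X) (hY : SmoothVF Y) :
    ContMDiff 𝓘(ℝ, E) 𝓘(ℝ, ℝ) ∞ (fun x ↦ h.g.inner x (X x) (Y x)) := by
  have h1 := h.g.contMDiff
  have h2 : ContMDiff 𝓘(ℝ, E) (𝓘(ℝ, E).prod 𝓘(ℝ, ℝ)) ∞
      (fun x ↦ TotalSpace.mk' ℝ (E := Bundle.Trivial M ℝ) x (h.g.inner x (X x) (Y x))) :=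
    ContMDiff.clm_bundle_apply₂ (F₁ := E) (F₂ := E) h1 hX hY
  intro x
  have := (contMDiffAt_section x).1 (h2 x)
  simpa using this

end HermGeom
end FrameCalculus

/-! ### Connections in an invariant frame -/

noncomputable section FrameConnections

open Set Filter
open scoped Topology

variable {E : Type*} [NormedAddCommGroup E] [NormedSpace ℝ E]
variable {M : Type*} [TopologicalSpace M] [ChartedSpace E M] [IsManifold 𝓘(ℝ, E) ∞ M]
variable {W : Type*} [NormedAddCommGroup W] [InnerProductSpace ℝ W]

namespace HermGeom.HermitianStructure.Frame

variable {h : HermitianStructure E M} {L : HermitianLieAlgebra W} (F : h.Frame L)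

/-- The vector field of the frame given by `w`. -/
def vf (w : W) : VField E M := fun x ↦ F.eval x w

lemma smooth_vf (w : W) : SmoothVF (F.vf w) := F.smooth w

lemma vf_apply (w : W) (x : M) : F.vf w x = F.eval x w := rfl

lemma injective (x : M) : Function.Injective (F.eval x) := by
  rw [← LinearMap.ker_eq_bot, LinearMap.ker_eq_bot']
  intro w hw
  have h := F.inner_eval x w w
  rw [hw, map_zero] at h
  exact inner_self_eq_zero.1 h.symm

/-- The isomorphism of `W` with the tangent space at `x`, given by the values of the frame. -/
def equiv (x : M) : W ≃ₗ[ℝ] TangentSpace 𝓘(ℝ, E) x :=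
  LinearEquiv.ofBijective (F.eval x) ⟨F.injective x, F.surjective x⟩

lemma eval_equiv_symm (x : M) (v : TangentSpace 𝓘(ℝ, E) x) : F.eval x ((F.equiv x).symm v) = v :=
  (F.equiv x).apply_symm_apply v

lemma vf_add (v w : W) : F.vf (v + w) = F.vf v + F.vf w := by
  funext x; simp [vf]

lemma vf_smul (t : ℝ) (w : W) : F.vf (t • w) = (fun _ : M ↦ t) • F.vf w := by
  funext x; simp [vf]

lemma JV_vf (w : W) : h.JV (F.vf w) = F.vf (L.J w) := funext fun x ↦ F.J_eval x w

section Connection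

variable (D : Connection E M)

/-- The connection `D` at the point `x`, read in the frame: the bilinear map `(u, v) ↦ ∇_u v` on
`W`, which depends on the point. -/
def conn (x : M) : W →ₗ[ℝ] W →ₗ[ℝ] W :=
  LinearMap.mk₂ ℝ (fun u v ↦ (F.equiv x).symm (D (F.vf v) x (F.eval x u)))
    (fun u u' v ↦ by simp) (fun t u v ↦ by simp)
    (fun u v v' ↦ by
      rw [vf_add, D.isCovariantDerivativeOnUniv.add ((F.smooth_vf v).mdifferentiableAt x)
        ((F.smooth_vf v').mdifferentiableAt x)]
      simp)
    (fun t u v ↦ by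
      rw [vf_smul, D.isCovariantDerivativeOnUniv.leibniz ((F.smooth_vf v).mdifferentiableAt x)
        mdifferentiableAt_const, mvfderiv_const]
      simp)

lemma eval_conn (x : M) (u v : W) : F.eval x (F.conn D x u v) = D (F.vf v) x (F.eval x u) :=
  F.eval_equiv_symm _ _

variable {D}

lemma isMetric_conn (hD : h.IsMetric D) (x : M) : HermitianLieAlgebra.IsMetric (F.conn D x) := by
  intro a b z
  have h1 := hD _ _ (F.smooth_vf b) (F.smooth_vf z) x (F.eval x a)
  have h2 : (fun y ↦ h.g.inner y (F.vf b y) (F.vf z y)) = fun _ ↦ inner ℝ b z :=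
    funext fun y ↦ F.inner_eval y b z
  rw [h2, mvfderiv_const, ← F.eval_conn, ← F.eval_conn, vf_apply, vf_apply, F.inner_eval,
    F.inner_eval] at h1
  exact h1.symm

lemma isComplex_conn (hD : h.IsComplex D) (x : M) : L.IsComplex (F.conn D x) := by
  intro a b
  apply F.injective x
  rw [eval_conn, ← F.JV_vf, hD _ (F.smooth_vf b), ← F.eval_conn, F.J_eval]

variable [FiniteDimensional ℝ E]

lemma torsion_eval (x : M) (a b : W) : D.torsion x (F.eval x a) (F.eval x b) =
    F.eval x (F.conn D x a b - F.conn D x b a - L.br a b) := by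
  have h1 := D.torsion_apply ((F.smooth_vf a).mdifferentiableAt x)
    ((F.smooth_vf b).mdifferentiableAt x)
  rw [map_sub, map_sub, eval_conn, eval_conn, ← F.mlieBracket_eval]
  exact h1

lemma isTorsionFree_conn (hD : D.torsion = 0) (x : M) : L.IsTorsionFree (F.conn D x) := by
  intro a b
  have h1 := F.torsion_eval (D := D) x a b
  rw [hD] at h1
  have h2 : F.conn D x a b - F.conn D x b a - L.br a b = 0 := F.injective x (by
    rw [← h1, map_zero]; rfl)
  exact sub_eq_zero.1 h2

lemma isChernTorsion_conn
    (hD : ∀ (x : M) (v w : TangentSpace 𝓘(ℝ, E) x), D.torsion x (h.J x v) w = D.torsion x v (h.J x w))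
    (x : M) : L.IsChernTorsion (F.conn D x) := by
  intro a b
  have h1 := hD x (F.eval x a) (F.eval x b)
  rw [F.J_eval, F.J_eval, torsion_eval, torsion_eval] at h1
  exact F.injective x h1

omit [FiniteDimensional ℝ E] in
lemma curvature_vf {n : W →ₗ[ℝ] W →ₗ[ℝ] W} (hn : ∀ x, F.conn D x = n) (a b z : W) (x : M) :
    curvature D (F.vf a) (F.vf b) (F.vf z) x = F.eval x (L.curv n a b z) := by
  have h1 (b : W) : (fun y ↦ D (F.vf z) y (F.vf b y)) = F.vf (n b z) := funext fun y ↦ by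
    rw [vf_apply, vf_apply, ← F.eval_conn, hn]
  have h2 : mlieBracket 𝓘(ℝ, E) (F.vf a) (F.vf b) x = F.eval x (L.br a b) := F.mlieBracket_eval x a b
  rw [curvature, h1, h1, h2, vf_apply, vf_apply, ← F.eval_conn, ← F.eval_conn, ← F.eval_conn, hn]
  simp [HermitianLieAlgebra.curv]

omit [FiniteDimensional ℝ E] in
/-- Constant holomorphic sectional curvature, read on the vector fields of an invariant frame. -/
lemma hasConstHSC {n : W →ₗ[ℝ] W →ₗ[ℝ] W} (hn : ∀ x, F.conn D x = n)
    (hm : HermitianLieAlgebra.IsMetric n) {c : ℝ} (hc : h.HasConstHSC D c) [Nonempty M] :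
    L.HasConstHSC n c := by
  intro u
  obtain ⟨x⟩ := ‹Nonempty M›
  have h1 := hc _ (F.smooth_vf u) x
  have hskew (a b z w : W) : inner ℝ (L.curv n a b z) w = -inner ℝ (L.curv n a b w) z := by
    rw [L.inner_curv hm, L.inner_curv hm]
    linarith [hm (L.br a b) z w, real_inner_comm z (n (L.br a b) w),
      real_inner_comm (n a z) (n b w), real_inner_comm (n a w) (n b z)]
  have hskew0 (a b z : W) : inner ℝ (L.curv n a b z) z = 0 := by linarith [hskew a b z z]
  have hself (a z : W) : L.curv n a a z = 0 := by
    simp [HermitianLieAlgebra.curv, L.br_self]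
  have hanti (a b z : W) : L.curv n a b z = -L.curv n b a z := by
    simp only [HermitianLieAlgebra.curv, L.br_skew b a, map_neg, LinearMap.neg_apply]
    abel
  have hneg1 (a b z : W) : L.curv n (-a) b z = -L.curv n a b z := by
    simp only [HermitianLieAlgebra.curv, map_neg, LinearMap.neg_apply]
    abel
  have hneg3 (a b z : W) : L.curv n a b (-z) = -L.curv n a b z := by
    simp only [HermitianLieAlgebra.curv, map_neg]
    abel
  have hperp : inner ℝ u (L.J u) = (0 : ℝ) := by rw [real_inner_comm, L.inner_J_self]
  have hneg : -F.vf (L.J u) = F.vf (-L.J u) := by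
    funext y; simp [vf]
  -- Of the sixteen terms of `R(ξ, ξ̄, ξ, ξ̄)` the symmetries of `R` leave four, which are equal.
  simp only [HermitianStructure.curvatureC, HermitianStructure.metricC, complexExt,
    HermitianStructure.type10, HermitianStructure.type01, F.JV_vf, hneg, F.curvature_vf hn,
    vf_apply, F.inner_eval, hneg1, hneg3, hself, hanti (L.J u) u, inner_neg_left, inner_zero_left,
    hskew0, hskew u (L.J u) u (L.J u), L.inner_J_J, L.inner_J_self,
    hperp, real_inner_self_eq_norm_sq] at h1
  have h2 := congrArg Complex.re h1
  simp [-Complex.ofReal_pow, -Complex.ofReal_neg, pow_two] at h2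
  linear_combination h2 / 4

end Connection

end HermGeom.HermitianStructure.Frame

namespace HermitianLieAlgebra

variable {L : HermitianLieAlgebra W} {n n' : W →ₗ[ℝ] W →ₗ[ℝ] W}

/-- A metric torsion-free connection is determined by the bracket, through the Koszul formula; so
the Levi-Civita connection has the same coefficients in an invariant frame at all points. -/
lemma leviCivita_unique (hm : IsMetric n) (ht : L.IsTorsionFree n) (hm' : IsMetric n')
    (ht' : L.IsTorsionFree n') : n = n' := by
  ext1 a; ext1 b
  refine ext_inner_right ℝ fun z ↦ ?_
  linarith [L.koszul hm ht a b z, L.koszul hm' ht' a b z]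

/-- The Chern connection is determined by the bracket, so it has the same coefficients in an
invariant frame at all points. -/
lemma chern_unique (hm : IsMetric n) (hJ : L.IsComplex n) (ht : L.IsChernTorsion n)
    (hm' : IsMetric n') (hJ' : L.IsComplex n') (ht' : L.IsChernTorsion n') : n = n' := by
  ext1 a; ext1 b
  -- The difference `δ a` is skew, and `δ (J a) = J ∘ δ a = δ a ∘ J` is both skew and symmetric.
  have key (a b : W) : n (L.J a) b - n' (L.J a) b = L.J (n a b - n' a b) := by
    have h1 := two_smul_chern_zero_one hJ ht a b
    rw [← two_smul_chern_zero_one hJ' ht'] at h1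
    have h2 := smul_right_injective W (two_ne_zero (α := ℝ)) h1
    rw [map_sub]
    linear_combination (norm := module) h2
  rw [← sub_eq_zero]
  refine ext_inner_right ℝ fun z ↦ ?_
  have hskew (a b z : W) : inner ℝ (n a b - n' a b) z = -inner ℝ (n a z - n' a z) b := by
    rw [inner_sub_left, inner_sub_left]
    linarith [hm a b z, hm' a b z, real_inner_comm b (n a z), real_inner_comm b (n' a z)]
  have h1 : inner ℝ (L.J (n a b - n' a b)) (L.J z) = 0 := by
    have h2 : inner ℝ (L.J (n a b - n' a b)) (L.J z) =
        -inner ℝ (L.J (n a b - n' a b)) (L.J z) := by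
      nth_rw 1 [← key, hskew, key, L.inner_J_left, hskew, hJ, hJ', ← map_sub]
      simp
    linarith
  rw [inner_zero_left, ← h1, L.inner_J_J]

end HermitianLieAlgebra
end FrameConnections

/-! ### Flatness and the Kähler condition in an invariant frame -/

noncomputable section CurvatureTensor

open Set Filter
open scoped Topology

variable {E : Type*} [NormedAddCommGroup E] [NormedSpace ℝ E]
variable {M : Type*} [TopologicalSpace M] [ChartedSpace E M] [IsManifold 𝓘(ℝ, E) ∞ M]
variable {ι : Type*} [Fintype ι] {f : ι → M → ℝ} {σ : ι → HermGeom.VField E M}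

namespace HermGeom

lemma SmoothVF.mvfderiv_apply {X : VField E M} (hX : SmoothVF X) {f : M → ℝ}
    (hf : ContMDiff 𝓘(ℝ, E) 𝓘(ℝ, ℝ) ∞ f) :
    ContMDiff 𝓘(ℝ, E) 𝓘(ℝ, ℝ) ∞ (fun y ↦ mvfderiv 𝓘(ℝ, E) f y (X y)) := fun x ↦
  ContMDiffAt.mvfderiv_apply hf (hX x)

variable (D : Connection E M)

lemma curvature_swap (X Y Z : VField E M) (x : M) :
    curvature D X Y Z x = -curvature D Y X Z x := by
  rw [curvature, curvature, mlieBracket_swap_apply, map_neg]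
  abel

/-- The curvature is tensorial in its second argument. -/
lemma curvature_sum_middle [CompleteSpace E] {X Z : VField E M}
    (hf : ∀ i, ContMDiff 𝓘(ℝ, E) 𝓘(ℝ, ℝ) ∞ (f i)) (hσ : ∀ i, SmoothVF (σ i))
    (hZ : ∀ i, SmoothVF fun y ↦ D Z y (σ i y)) (x : M) :
    curvature D X (fun y ↦ ∑ i, f i y • σ i y) Z x = ∑ i, f i x • curvature D X (σ i) Z x := by
  have h1 : (fun y ↦ D Z y (∑ i, f i y • σ i y)) = fun y ↦ ∑ i, f i y • D Z y (σ i y) :=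
    funext fun y ↦ by simp
  rw [curvature, h1, covariantDerivative_sum D hf hZ, mlieBracket_sum X hf hσ]
  simp only [curvature, map_sum, map_add, map_smul, Finset.sum_add_distrib, smul_sub,
    Finset.sum_sub_distrib]
  abel

/-- The curvature is tensorial in its third argument. -/
lemma curvature_sum_right [CompleteSpace E] {X Y : VField E M} (hX : SmoothVF X) (hY : SmoothVF Y)
    (hf : ∀ i, ContMDiff 𝓘(ℝ, E) 𝓘(ℝ, ℝ) ∞ (f i)) (hσ : ∀ i, SmoothVF (σ i))
    (hσX : ∀ i, SmoothVF fun y ↦ D (σ i) y (X y)) (hσY : ∀ i, SmoothVF fun y ↦ D (σ i) y (Y y))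
    (x : M) :
    curvature D X Y (fun y ↦ ∑ i, f i y • σ i y) x = ∑ i, f i x • curvature D X Y (σ i) x := by
  have h1 {X Y : VField E M} (hY : SmoothVF Y) (hσY : ∀ i, SmoothVF fun y ↦ D (σ i) y (Y y)) :
      D (fun y ↦ D (fun y ↦ ∑ i, f i y • σ i y) y (Y y)) x (X x) =
        ∑ i, (mvfderiv 𝓘(ℝ, E) (fun y ↦ mvfderiv 𝓘(ℝ, E) (f i) y (Y y)) x (X x) • σ i x
          + mvfderiv 𝓘(ℝ, E) (f i) x (Y x) • D (σ i) x (X x)) +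
        ∑ i, (mvfderiv 𝓘(ℝ, E) (f i) x (X x) • D (σ i) x (Y x)
          + f i x • D (fun y ↦ D (σ i) y (Y y)) x (X x)) := by
    have e : (fun y ↦ D (fun y ↦ ∑ i, f i y • σ i y) y (Y y)) =
        (fun y ↦ ∑ i, mvfderiv 𝓘(ℝ, E) (f i) y (Y y) • σ i y) +
          fun y ↦ ∑ i, f i y • D (σ i) y (Y y) := funext fun y ↦ by
      rw [covariantDerivative_sum D hf hσ, Finset.sum_add_distrib]; rfl
    have hd (i) := hY.mvfderiv_apply (hf i)
    rw [e, D.isCovariantDerivativeOnUniv.add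
      ((SmoothVF.sum_smul hd hσ).mdifferentiableAt x)
      ((SmoothVF.sum_smul hf hσY).mdifferentiableAt x), add_apply,
      covariantDerivative_sum D hd hσ, covariantDerivative_sum D hf hσY]
  rw [curvature, h1 hY hσY, h1 hX hσX, covariantDerivative_sum D hf hσ]
  simp only [mvfderiv_mlieBracket hX hY (hf _), curvature, sub_smul, smul_sub,
    Finset.sum_add_distrib, Finset.sum_sub_distrib]
  abel

namespace HermitianStructure.Frame

variable {W : Type*} [NormedAddCommGroup W] [InnerProductSpace ℝ W] [FiniteDimensional ℝ W]
variable {h : HermitianStructure E M} {L : HermitianLieAlgebra W} (F : h.Frame L)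

/-- The coefficients of a vector field in the orthonormal frame. -/
def coeff (Z : VField E M) (i : Fin (Module.finrank ℝ W)) (y : M) : ℝ :=
  h.g.inner y (Z y) (F.vf (stdOrthonormalBasis ℝ W i) y)

lemma contMDiff_coeff {Z : VField E M} (hZ : SmoothVF Z) (i : Fin (Module.finrank ℝ W)) :
    ContMDiff 𝓘(ℝ, E) 𝓘(ℝ, ℝ) ∞ (F.coeff Z i) :=
  h.contMDiff_inner hZ (F.smooth_vf _)

lemma sum_coeff (Z : VField E M) :
    (fun y ↦ ∑ i, F.coeff Z i y • F.vf (stdOrthonormalBasis ℝ W i) y) = Z := by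
  funext y
  obtain ⟨w, hw⟩ := F.surjective y (Z y)
  simp only [coeff, ← hw, vf_apply, F.inner_eval, ← map_smul, ← map_sum]
  congr 1
  conv_rhs => rw [← (stdOrthonormalBasis ℝ W).sum_repr' w]
  simp only [real_inner_comm]

lemma JV_eq_sum (Y : VField E M) :
    h.JV Y = fun y ↦ ∑ i, F.coeff Y i y • F.vf (L.J (stdOrthonormalBasis ℝ W i)) y := by
  conv_lhs => rw [← F.sum_coeff Y]
  funext y
  simp [JV, vf_apply, F.J_eval]

include F in
lemma smoothVF_JV {Y : VField E M} (hY : SmoothVF Y) : SmoothVF (h.JV Y) := by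
  rw [F.JV_eq_sum]
  exact SmoothVF.sum_smul (F.contMDiff_coeff hY) fun i ↦ F.smooth_vf _

variable {D} {n : W →ₗ[ℝ] W →ₗ[ℝ] W} (hn : ∀ x, F.conn D x = n)

include hn

omit [FiniteDimensional ℝ W] in
lemma covariantDerivative_vf (e w : W) (y : M) : D (F.vf e) y (F.vf w y) = F.vf (n w e) y := by
  rw [vf_apply, ← F.eval_conn, hn, vf_apply]

lemma smoothVF_covariantDerivative_vf {X : VField E M} (hX : SmoothVF X) (e : W) :
    SmoothVF fun y ↦ D (F.vf e) y (X y) := by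
  rw [← F.sum_coeff X]
  simp only [map_sum, map_smul, F.covariantDerivative_vf hn]
  exact SmoothVF.sum_smul (F.contMDiff_coeff hX) fun i ↦ F.smooth_vf _

/-- A connection which has constant coefficients in the frame is flat if its algebraic curvature
vanishes. -/
lemma isFlat [CompleteSpace E] (hR : ∀ a b z, L.curv n a b z = 0) : IsFlat D := by
  have h0 (a b z : W) (x : M) : curvature D (F.vf a) (F.vf b) (F.vf z) x = 0 := by
    rw [F.curvature_vf hn, hR, map_zero]
  have h1 {X : VField E M} (hX : SmoothVF X) (b z : W) (x : M) :
      curvature D X (F.vf b) (F.vf z) x = 0 := by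
    rw [curvature_swap, ← F.sum_coeff X, curvature_sum_middle D (F.contMDiff_coeff hX)
      (fun i ↦ F.smooth_vf _) fun i ↦ F.smoothVF_covariantDerivative_vf hn (F.smooth_vf _) _]
    simp [h0]
  intro X Y Z hX hY hZ x
  rw [← F.sum_coeff Z, curvature_sum_right D hX hY (F.contMDiff_coeff hZ) (fun i ↦ F.smooth_vf _)
    (fun i ↦ F.smoothVF_covariantDerivative_vf hn hX _)
    (fun i ↦ F.smoothVF_covariantDerivative_vf hn hY _)]
  refine Finset.sum_eq_zero fun i _ ↦ ?_
  rw [← F.sum_coeff Y, curvature_sum_middle D (F.contMDiff_coeff hY)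
    (fun i ↦ F.smooth_vf _) fun i ↦ F.smoothVF_covariantDerivative_vf hn (F.smooth_vf _) _]
  simp [h1 hX]

/-- A connection which has constant coefficients in the frame preserves `J` if it does so on the
fields of the frame. -/
lemma isComplex (hJ : ∀ a b, n a (L.J b) = L.J (n a b)) : h.IsComplex D := by
  intro Y hY x v
  obtain ⟨w, rfl⟩ := F.surjective x v
  rw [F.JV_eq_sum, covariantDerivative_sum D (F.contMDiff_coeff hY) fun i ↦ F.smooth_vf _]
  conv_rhs => rw [← F.sum_coeff Y,
    covariantDerivative_sum D (F.contMDiff_coeff hY) fun i ↦ F.smooth_vf _]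
  rw [map_sum]
  refine Finset.sum_congr rfl fun i _ ↦ ?_
  simp only [← F.vf_apply w x, F.covariantDerivative_vf hn, hJ, map_add, map_smul]
  simp only [vf_apply, F.J_eval]

end HermitianStructure.Frame

namespace HermitianStructure

variable (h : HermitianStructure E M)

lemma inner_J_left (x : M) (v w : TangentSpace 𝓘(ℝ, E) x) :
    h.g.inner x (h.J x v) w = -h.g.inner x v (h.J x w) := by
  rw [← h.compatible x v (h.J x w), h.J_sq, map_neg, neg_neg]

variable {h}

/-- A Hermitian metric whose Levi-Civita connection preserves `J` is Kähler. -/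
lemma isKahler [FiniteDimensional ℝ E] {D : Connection E M} (hm : h.IsMetric D)
    (ht : D.torsion = 0) (hJ : h.IsComplex D) (hJV : ∀ Y, SmoothVF Y → SmoothVF (h.JV Y)) :
    h.IsKahler := by
  intro X Y Z hX hY hZ x
  have hd {Y Z : VField E M} (hY : SmoothVF Y) (hZ : SmoothVF Z) (v : TangentSpace 𝓘(ℝ, E) x) :
      mvfderiv 𝓘(ℝ, E) (h.omega Y Z) x v =
        h.g.inner x (h.J x (D Y x v)) (Z x) + h.g.inner x (h.J x (Y x)) (D Z x v) := by
    rw [← hJ Y hY]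
    exact hm _ _ (hJV Y hY) hZ x v
  have hb {X Y : VField E M} (hX : SmoothVF X) (hY : SmoothVF Y) :
      mlieBracket 𝓘(ℝ, E) X Y x = D Y x (X x) - D X x (Y x) := by
    have := D.torsion_apply (hX.mdifferentiableAt x) (hY.mdifferentiableAt x)
    rw [ht] at this
    exact (sub_eq_zero.1 this.symm).symm
  have hs (v w : TangentSpace 𝓘(ℝ, E) x) :
      h.g.inner x (h.J x v) w = -h.g.inner x (h.J x w) v := by
    rw [h.inner_J_left, h.g.symm]
  simp only [hd hY hZ, hd hX hZ, hd hX hY, omega, hb hX hY, hb hX hZ, hb hY hZ, map_sub,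
    sub_apply]
  rw [hs (X x), hs (Y x), hs (X x)]
  ring

end HermitianStructure

end HermGeom
end CurvatureTensor

/-! ### Constant holomorphic sectional curvature on compact quotients -/

theorem theorem1
    {E : Type*} [NormedAddCommGroup E] [NormedSpace ℝ E] [FiniteDimensional ℝ E]
    {G : Type*} [Group G] [TopologicalSpace G] [T2Space G] [SecondCountableTopology G]
    [ChartedSpace E G] [LieGroup 𝓘(ℝ, E) ∞ G]
    {M : Type*} [TopologicalSpace M] [T2Space M] [CompactSpace M]
    [ChartedSpace E M] [IsManifold 𝓘(ℝ, E) ∞ M]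
    (Γ : Subgroup G) (p : G → M) (hp : HermGeom.IsQuotientBy (E := E) Γ p)
    (hG : HermGeom.HermitianStructure E G) (hinv : hG.IsLeftInvariant)
    (hM : HermGeom.HermitianStructure E M) (hlift : hG.IsLift hM p)
    (𝔞 : LieIdeal ℝ (GroupLieAlgebra 𝓘(ℝ, E) G)) (h𝔞 : IsLieAbelian 𝔞)
    (hcodim : Module.finrank ℝ (GroupLieAlgebra 𝓘(ℝ, E) G ⧸ 𝔞) = 1 ∨
      (Module.finrank ℝ (GroupLieAlgebra 𝓘(ℝ, E) G ⧸ 𝔞) = 2 ∧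
        𝔞.toSubmodule.map (hG.J 1).toLinearMap = 𝔞.toSubmodule)) :
    (∀ (D : HermGeom.Connection E M) (c : ℝ),
      hM.IsChern D → hM.HasConstHSC D c → c = 0 ∧ HermGeom.IsFlat D) ∧
    (∀ (D : HermGeom.Connection E M) (c : ℝ),
      hM.IsLeviCivita D → hM.HasConstHSC D c →
        c = 0 ∧ HermGeom.IsFlat D ∧ hM.IsKahler) := by
  have : CompleteSpace E := FiniteDimensional.complete ℝ E
  obtain ⟨L, ⟨F⟩, ⟨A⟩, huni⟩ := hp.exists_frame hinv hlift 𝔞 h𝔞 hcodim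
  have : Nonempty M := ⟨p 1⟩
  let x₀ : M := p 1
  refine ⟨fun D c ⟨hm, hJ, ht⟩ hc ↦ ?_, fun D c ⟨hm, ht⟩ hc ↦ ?_⟩
  · have hn (x : M) : F.conn D x = F.conn D x₀ :=
      HermitianLieAlgebra.chern_unique (F.isMetric_conn hm x) (F.isComplex_conn hJ x)
        (F.isChernTorsion_conn ht x) (F.isMetric_conn hm x₀) (F.isComplex_conn hJ x₀)
        (F.isChernTorsion_conn ht x₀)
    obtain ⟨h0, hR⟩ := A.chern_rigidity huni (F.isMetric_conn hm x₀) (F.isComplex_conn hJ x₀)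
      (F.isChernTorsion_conn ht x₀) (F.hasConstHSC hn (F.isMetric_conn hm x₀) hc)
    exact ⟨h0, F.isFlat hn hR⟩
  · have hn (x : M) : F.conn D x = F.conn D x₀ :=
      HermitianLieAlgebra.leviCivita_unique (F.isMetric_conn hm x) (F.isTorsionFree_conn ht x)
        (F.isMetric_conn hm x₀) (F.isTorsionFree_conn ht x₀)
    obtain ⟨h0, hR, hJ⟩ := HermitianLieAlgebra.AdaptedIdeal.leviCivita_rigidity A huni
      (F.isMetric_conn hm x₀) (F.isTorsionFree_conn ht x₀)
      (F.hasConstHSC hn (F.isMetric_conn hm x₀) hc)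
    exact ⟨h0, F.isFlat hn hR,
      HermGeom.HermitianStructure.isKahler hm ht (F.isComplex hn hJ) fun _ ↦ F.smoothVF_JV⟩
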